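/- Let $k$ be an algebraically closed field of characteristic $0$, let $n\ge 1$, $\ell\ge 1$, and let $q\in k$ be a primitive $\ell$-th root of unity. Put $\Lambda=\mathbb Z^n$ with standard basis $\varepsilon_1,\dots,\varepsilon_n$ and standard form $\langle\alpha,\beta\rangle=\sum_i\alpha_i\beta_i$, and for $\alpha,\beta\in\Lambda$ let $\alpha*\beta=\sum_{j}\sum_{i>j}\alpha_i\beta_j$ and $\theta(\alpha,\beta)=q^{\alpha*\beta-\beta*\alpha}$. The *$n$-rank Taft algebra* $\bar{\mathscr A}=\bar{\mathscr A}_q(n)$ is the $k$-algebra generated by $K(\varepsilon_i)^{\pm1},x_i$ $(1\le i\le n)$ with the relations $$K(\varepsilon_i)K(\varepsilon_j)=K(\varepsilon_j)K(\varepsilon_i),\quad K(\varepsilon_i)^{\pm1}K(\varepsilon_i)^{\mp1}=1,\quad K(\varepsilon_i)^\ell=1,$$ $$K(\varepsilon_i)x_jK(\varepsilon_i)^{-1}=\theta(\varepsilon_i,\varepsilon_j)q^{\delta_{ij}}x_j,\quad x_ix_j=\theta(\varepsilon_i,\varepsilon_j)x_jx_i,\quad x_i^\ell=0,$$ and with the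 Hopf algebra structure $$\Delta(K(\varepsilon_i)^{\pm1})=K(\varepsilon_i)^{\pm1}\otimes K(\varepsilon_i)^{\pm1},\quad \Delta(x_i)=x_i\otimes 1+K(\varepsilon_i)\otimes x_i,\quad \varepsilon(K(\varepsilon_i)^{\pm1})=1,\quad \varepsilon(x_i)=0,$$ $$s(K(\varepsilon_i)^{\pm1})=K(\varepsilon_i)^{\mp1},\quad s(x_i)=-K(\varepsilon_i)^{-1}x_i .$$ For $\alpha\in\Lambda$ put $K(\alpha)=\prod_iK(\varepsilon_i)^{\alpha_i}$. For $\beta\in\Lambda$ let $\tilde{\mathfrak K}(\beta)\in\bar{\mathscr A}^*$ be the algebra homomorphism $\bar{\mathscr A}\to k$ with $\tilde{\mathfrak K}(\beta)(K(\alpha))=\theta(\alpha,\beta)q^{\langle\alpha,\beta\rangle}$ for all $\alpha\in\Lambda$ and $\tilde{\mathfrak K}(\beta)(x_i)=0$ for all $i$; it is invertible in the convolution algebra $\bar{\mathscr A}^*$. For a finite-dimensional Hopf algebra $H$ over $k$, the *Drinfel'd double* $D(H)=(H^*)^{\mathrm{cop}}\bowtie H$ is the Hopf algebra with underlying coalgebra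 $(H^*)^{\mathrm{cop}}\otimes H$ and multiplication $$(p\otimes h)(p'\otimes h')=p\,\bigl(h_{(1)}\rightharpoonup p'\leftharpoonup s^{-1}(h_{(3)})\bigr)\otimes h_{(2)}h',\qquad (h\rightharpoonup p)(x)=p(xh),\quad (p\leftharpoonup h)(x)=p(hx),$$ equipped with the element $\mathcal R=\sum_i(\varepsilon\otimes h_i)\otimes(h^i\otimes1)\in D(H)\otimes D(H)$, where $(h_i)$ is a basis of $H$ and $(h^i)$ the dual basis of $H^*$. For a Hopf algebra $H$, an invertible element $R=\sum_ia_i\otimes b_i\in H\otimes H$ is a *universal $R$-matrix* if $\tau(\Delta(h))=R\Delta(h)R^{-1}$ for all $h\in H$ ($\tau$ is the flip), $(\Delta\otimes\mathrm{id})R=R^{13}R^{23}$ and $(\mathrm{id}\otimes\Delta)R=R^{13}R^{12}$. Its *Drinfel'd element* is $u=\sum_is(b_i)a_i$. A *ribbon element* of $(H,R)$ is a central element $v\in H$ with $$v^2=u\,s(u),\qquad s(v)=v,\qquad\varepsilon(v)=1,\qquad\Delta(v)=(R^{21}R)^{-1}(v\otimes v),$$ where $R^{21}=\tau(R)$. The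 pair $(H,R)$ is *ribbon* if $R$ is a universal $R$-matrix and $(H,R)$ has a ribbon element. **Theorem.** $(D(\bar{\mathscr A}),\mathcal R)$ is a ribbon Hopf algebra if and only if $\ell$ is odd. If $\ell$ is odd, then $(D(\bar{\mathscr A}),\mathcal R)$ has exactly one ribbon element, namely $$v=u\Bigl(\tilde{\mathfrak K}\bigl((\iota+\mathbf 1)/2\bigr)^{-1}\otimes K(\kappa/2)^{-1}\Bigr)=u\Bigl(\tilde{\mathfrak K}(\kappa/2)\otimes K\bigl((\iota+\mathbf 1)/2\bigr)\Bigr),$$ where $u$ is the Drinfel'd element of $\mathcal R$ and $\mathbf 1=(1,\dots,1)$, $\iota=(\ell,\dots,\ell)$, $\kappa=(\ell-1,\dots,\ell-1)$ in $\Lambda$. -/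

import Mathlib

open scoped TensorProduct

set_option linter.unusedSectionVars false

section Double

variable (k H : Type*) [Field k] [Ring H] [HopfAlgebra k H]

/-- The antipode `s` of `H` is bijective (automatic in finite dimension; an instance is
constructed below for the algebra of interest). -/
class HasBijectiveAntipode : Prop where
  bijective : Function.Bijective (HopfAlgebra.antipode k : H →ₗ[k] H)

/-- The inverse `s⁻¹` of the antipode. -/
noncomputable def antipodeInv [HasBijectiveAntipode k H] : H →ₗ[k] H :=
  (LinearEquiv.ofBijective (HopfAlgebra.antipode k : H →ₗ[k] H)
    HasBijectiveAntipode.bijective).symm.toLinearMap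

/-- `(H^*)^cop`: linear functionals on `H`, with the convolution product
`(p q)(x) = p(x₍₁₎) q(x₍₂₎)` and unit `ε`, and with the opposite of the comultiplication dual to
the product of `H`. -/
def DualCop : Type _ := WithConv (H →ₗ[k] k)

noncomputable instance : Ring (DualCop k H) := inferInstanceAs (Ring (WithConv (H →ₗ[k] k)))
noncomputable instance : Algebra k (DualCop k H) :=
  inferInstanceAs (Algebra k (WithConv (H →ₗ[k] k)))

namespace DualCop

/-- The underlying functional of an element of `(H^*)^cop`. -/
noncomputable def toDual : DualCop k H ≃ₗ[k] (H →ₗ[k] k) := WithConv.linearEquiv k (H →ₗ[k] k)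

variable {k H}

noncomputable instance : CoeFun (DualCop k H) (fun _ => H → k) := ⟨fun p => toDual k H p⟩

theorem ext {p q : DualCop k H} (h : ∀ x, p x = q x) : p = q :=
  (toDual k H).injective (LinearMap.ext h)

theorem add_apply (p q : DualCop k H) (x : H) : (p + q) x = p x + q x := rfl
theorem smul_apply (c : k) (p : DualCop k H) (x : H) : (c • p) x = c * p x := rfl
theorem one_apply (x : H) : (1 : DualCop k H) x = Coalgebra.counit (R := k) x := rfl

theorem mul_apply (p q : DualCop k H) (x : H) :
    (p * q) x = LinearMap.mul' k k
      (TensorProduct.map (toDual k H p) (toDual k H q) (Coalgebra.comul x)) := rfl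

theorem toDual_symm_apply (f : H →ₗ[k] k) (x : H) : ((toDual k H).symm f) x = f x := rfl

variable (k H)

/-- The pairing `⟨p ⊗ q, x ⊗ y⟩ = p(x) q(y)`. -/
noncomputable def pair : DualCop k H ⊗[k] DualCop k H →ₗ[k] (H ⊗[k] H →ₗ[k] k) :=
  TensorProduct.dualDistrib k H H ∘ₗ
    TensorProduct.map (toDual k H).toLinearMap (toDual k H).toLinearMap

variable {k H}
theorem pair_tmul (p q : DualCop k H) (x y : H) : pair k H (p ⊗ₜ q) (x ⊗ₜ y) = p x * q y := rfl

variable (k H) in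
theorem pair_bijective [Module.Finite k H] : Function.Bijective (pair k H) := by
  have h1 : Function.Bijective (TensorProduct.dualDistrib k H H) :=
    (TensorProduct.dualDistribEquiv k H H).bijective
  have h2 := (TensorProduct.congr (toDual k H) (toDual k H)).bijective
  exact h1.comp h2

variable [Module.Finite k H]

/-- The comultiplication `p ↦ p₍₂₎ ⊗ p₍₁₎`, characterised by `⟨Δ(p), x ⊗ y⟩ = p(y x)`
(see `DualCop.pair_comul`), and the counit `p ↦ p(1)`. -/
noncomputable instance : CoalgebraStruct k (DualCop k H) where
  comul := (LinearEquiv.ofBijective _ (pair_bijective k H)).symm.toLinearMap ∘ₗ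
    (LinearMap.mul' k H ∘ₗ (TensorProduct.comm k H H).toLinearMap).dualMap ∘ₗ
      (toDual k H).toLinearMap
  counit := LinearMap.applyₗ (1 : H) ∘ₗ (toDual k H).toLinearMap

theorem pair_comul (p : DualCop k H) (x y : H) :
    pair k H (Coalgebra.comul p) (x ⊗ₜ y) = p (y * x) := by
  change pair k H ((LinearEquiv.ofBijective _ (pair_bijective k H)).symm _) _ = _
  have := (LinearEquiv.ofBijective _ (pair_bijective k H)).apply_symm_apply
    ((LinearMap.mul' k H ∘ₗ (TensorProduct.comm k H H).toLinearMap).dualMap (toDual k H p))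
  rw [LinearEquiv.ofBijective_apply] at this
  exact (congrArg (fun f => f (x ⊗ₜ[k] y)) this)

theorem counit_apply (p : DualCop k H) : Coalgebra.counit (R := k) p = p 1 := rfl

variable (k H) in
/-- The pairing of triple tensors. -/
noncomputable def pair3 : DualCop k H ⊗[k] (DualCop k H ⊗[k] DualCop k H) →ₗ[k]
    (H ⊗[k] (H ⊗[k] H) →ₗ[k] k) :=
  TensorProduct.dualDistrib k H (H ⊗[k] H) ∘ₗ
    TensorProduct.map (toDual k H).toLinearMap (pair k H)

variable (k H) in
theorem pair3_injective : Function.Injective (pair3 k H) := by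
  have h1 : Function.Bijective (TensorProduct.dualDistrib k H (H ⊗[k] H)) :=
    (TensorProduct.dualDistribEquiv k H (H ⊗[k] H)).bijective
  have h2 := (TensorProduct.congr (toDual k H)
    (LinearEquiv.ofBijective _ (pair_bijective k H))).bijective
  exact (h1.comp h2).1

theorem pair3_tmul (p : DualCop k H) (t : DualCop k H ⊗[k] DualCop k H) (x y z : H) :
    pair3 k H (p ⊗ₜ t) (x ⊗ₜ (y ⊗ₜ z)) = p x * pair k H t (y ⊗ₜ z) := rfl

noncomputable instance : Coalgebra k (DualCop k H) where
  coassoc := by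
    ext p
    apply pair3_injective k H
    ext x y z
    have h1 : ∀ t : DualCop k H ⊗[k] DualCop k H,
        pair3 k H (TensorProduct.assoc k _ _ _ ((Coalgebra.comul (R := k)).rTensor _ t))
          (x ⊗ₜ (y ⊗ₜ z)) = pair k H t ((y * x) ⊗ₜ z) := by
      intro t
      induction t with
      | zero => simp
      | add a b ha hb => simp only [map_add, LinearMap.add_apply, ha, hb]
      | tmul a b =>
        rw [LinearMap.rTensor_tmul, pair_tmul, ← pair_comul]
        generalize (Coalgebra.comul a : DualCop k H ⊗[k] DualCop k H) = s
        induction s with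
        | zero => simp
        | add a b ha hb => simp only [map_add, LinearMap.add_apply, ha, hb,
            TensorProduct.add_tmul, add_mul]
        | tmul c d =>
          rw [TensorProduct.assoc_tmul, pair3_tmul, pair_tmul, pair_tmul, mul_assoc]
    have h2 : ∀ t : DualCop k H ⊗[k] DualCop k H,
        pair3 k H ((Coalgebra.comul (R := k)).lTensor _ t)
          (x ⊗ₜ (y ⊗ₜ z)) = pair k H t (x ⊗ₜ (z * y)) := by
      intro t
      induction t with
      | zero => simp
      | add a b ha hb => simp only [map_add, LinearMap.add_apply, ha, hb]
      | tmul a b =>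
        rw [LinearMap.lTensor_tmul, pair3_tmul, pair_comul, pair_tmul]
    change pair3 k H (TensorProduct.assoc k _ _ _ ((Coalgebra.comul (R := k)).rTensor _
      (Coalgebra.comul p))) (x ⊗ₜ (y ⊗ₜ z)) = pair3 k H ((Coalgebra.comul (R := k)).lTensor _
      (Coalgebra.comul p)) (x ⊗ₜ (y ⊗ₜ z))
    rw [h1, h2, pair_comul, pair_comul, mul_assoc]
  rTensor_counit_comp_comul := by
    ext p
    apply (TensorProduct.lid k _).injective
    apply ext
    intro x
    have h1 : ∀ t : DualCop k H ⊗[k] DualCop k H,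
        (TensorProduct.lid k _ ((Coalgebra.counit (R := k)).rTensor _ t) : DualCop k H) x
          = pair k H t (1 ⊗ₜ x) := by
      intro t
      induction t with
      | zero => simp
      | add a b ha hb => simp only [map_add, LinearMap.add_apply, ha, hb]
      | tmul a b =>
        simp [counit_apply, pair_tmul]
    exact (h1 _).trans (by rw [pair_comul]; simp)
  lTensor_counit_comp_comul := by
    ext p
    apply (TensorProduct.rid k _).injective
    apply ext
    intro x
    have h1 : ∀ t : DualCop k H ⊗[k] DualCop k H,
        (TensorProduct.rid k _ ((Coalgebra.counit (R := k)).lTensor _ t) : DualCop k H) x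
          = pair k H t (x ⊗ₜ 1) := by
      intro t
      induction t with
      | zero => simp
      | add a b ha hb => simp only [map_add, LinearMap.add_apply, ha, hb]
      | tmul a b =>
        simp [counit_apply, pair_tmul, mul_comm]
    exact (h1 _).trans (by rw [pair_comul]; simp)

end DualCop

section AntipodeFacts
variable {k H : Type*} [Field k] [Ring H] [HopfAlgebra k H]
open Coalgebra HopfAlgebra WithConv

theorem comul_antipode (h : H) :
    comul (R := k) (antipode k h) =
      TensorProduct.map (antipode k) (antipode k) (TensorProduct.comm k H H (comul h)) := by
  have key : (comul (R := k) ∘ₗ antipode k : H →ₗ[k] H ⊗[k] H) =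
      TensorProduct.map (antipode k) (antipode k) ∘ₗ
        (TensorProduct.comm k H H).toLinearMap ∘ₗ comul := by
    apply WithConv.toConv_injective
    symm
    apply left_inv_eq_right_inv (a := WithConv.toConv (comul (R := k) : H →ₗ[k] H ⊗[k] H))
    · let iL : H →ₐ[k] H ⊗[k] H := Algebra.TensorProduct.includeLeft
      let iR : H →ₐ[k] H ⊗[k] H := Algebra.TensorProduct.includeRight
      have e1 : toConv (TensorProduct.map (antipode k) (antipode k) ∘ₗ
          (TensorProduct.comm k H H).toLinearMap ∘ₗ (comul : H →ₗ[k] H ⊗[k] H)) =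
          toConv (iR.toLinearMap ∘ₗ antipode k) * toConv (iL.toLinearMap ∘ₗ antipode k) := by
        apply WithConv.ext
        rw [LinearMap.convMul_def, ofConv_toConv, ofConv_toConv, ← LinearMap.comp_assoc,
          ← LinearMap.comp_assoc]
        congr 1
        ext x y
        simp [iL, iR]
      have e2 : toConv (comul : H →ₗ[k] H ⊗[k] H) = toConv iL.toLinearMap * toConv iR.toLinearMap := by
        apply WithConv.ext
        rw [LinearMap.convMul_def, ofConv_toConv, ofConv_toConv]
        conv_lhs => rw [← LinearMap.id_comp (comul : H →ₗ[k] H ⊗[k] H)]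
        rw [← LinearMap.comp_assoc]
        congr 1
        ext x y
        simp [iL, iR]
      have e3 : toConv (iL.toLinearMap ∘ₗ antipode k) * toConv iL.toLinearMap = 1 := by
        have := LinearMap.algHom_comp_convMul_distrib iL (toConv (antipode k (A := H)))
          (toConv LinearMap.id)
        rw [LinearMap.antipode_mul_id] at this
        apply WithConv.ext
        refine Eq.trans this.symm ?_
        ext x; exact iL.commutes (counit x)
      have e4 : toConv (iR.toLinearMap ∘ₗ antipode k) * toConv iR.toLinearMap = 1 := by
        have := LinearMap.algHom_comp_convMul_distrib iR (toConv (antipode k (A := H)))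
          (toConv LinearMap.id)
        rw [LinearMap.antipode_mul_id] at this
        apply WithConv.ext
        refine Eq.trans this.symm ?_
        ext x; exact iR.commutes (counit x)
      rw [e1, e2, mul_assoc, ← mul_assoc (toConv (iL.toLinearMap ∘ₗ antipode k)), e3, one_mul, e4]
    · exact LinearMap.comul_right_inv
  exact congrArg (fun f => f h) key

variable [HasBijectiveAntipode k H]

theorem antipode_antipodeInv (h : H) : antipode k (antipodeInv k H h) = h :=
  LinearEquiv.apply_symm_apply (LinearEquiv.ofBijective (HopfAlgebra.antipode k : H →ₗ[k] H)
    HasBijectiveAntipode.bijective) h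

theorem antipodeInv_antipode (h : H) : antipodeInv k H (antipode k h) = h :=
  LinearEquiv.symm_apply_apply (LinearEquiv.ofBijective (HopfAlgebra.antipode k : H →ₗ[k] H)
    HasBijectiveAntipode.bijective) h

theorem antipode_injective : Function.Injective (antipode k : H →ₗ[k] H) :=
  HasBijectiveAntipode.bijective.1

theorem antipodeInv_mul (a b : H) :
    antipodeInv k H (a * b) = antipodeInv k H b * antipodeInv k H a := by
  apply antipode_injective (k := k)
  rw [antipode_mul_antidistrib]
  simp only [antipode_antipodeInv]

theorem antipodeInv_one : antipodeInv k H (1 : H) = 1 := by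
  apply antipode_injective (k := k)
  rw [antipode_antipodeInv, antipode_one]

theorem counit_antipodeInv (h : H) : counit (R := k) (antipodeInv k H h) = counit (R := k) h := by
  rw [← counit_antipode, antipode_antipodeInv]

theorem comul_antipodeInv (h : H) :
    comul (R := k) (antipodeInv k H h) =
      TensorProduct.map (antipodeInv k H) (antipodeInv k H)
        (TensorProduct.comm k H H (comul h)) := by
  have := comul_antipode (k := k) (antipodeInv k H h)
  rw [antipode_antipodeInv] at this
  rw [this]
  generalize (comul (R := k) ((antipodeInv k H) h)) = t
  induction t with
  | zero => simp
  | add a b ha hb => simp only [map_add, ← ha, ← hb]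
  | tmul a b => simp [antipodeInv_antipode]

/-- `s⁻¹(h₍₂₎) h₍₁₎ = ε(h)` -/
theorem antipodeInv_mul_comul (h : H) :
    LinearMap.mul' k H (TensorProduct.map (antipodeInv k H) LinearMap.id
      (TensorProduct.comm k H H (comul h))) = algebraMap k H (counit h) := by
  apply antipode_injective (k := k)
  have h1 : ∀ t : H ⊗[k] H, antipode k (LinearMap.mul' k H (TensorProduct.map (antipodeInv k H)
      LinearMap.id (TensorProduct.comm k H H t))) =
      LinearMap.mul' k H ((antipode k).rTensor H t) := by
    intro t
    induction t with
    | zero => simp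
    | add a b ha hb => simp only [map_add, ha, hb]
    | tmul a b => simp [antipode_mul_antidistrib, antipode_antipodeInv]
  rw [h1, mul_antipode_rTensor_comul_apply, Algebra.algebraMap_eq_smul_one, map_smul, antipode_one]

/-- `h₍₂₎ s⁻¹(h₍₁₎) = ε(h)` -/
theorem mul_antipodeInv_comul (h : H) :
    LinearMap.mul' k H (TensorProduct.map LinearMap.id (antipodeInv k H)
      (TensorProduct.comm k H H (comul h))) = algebraMap k H (counit h) := by
  apply antipode_injective (k := k)
  have h1 : ∀ t : H ⊗[k] H, antipode k (LinearMap.mul' k H (TensorProduct.map LinearMap.id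
      (antipodeInv k H) (TensorProduct.comm k H H t))) =
      LinearMap.mul' k H ((antipode k).lTensor H t) := by
    intro t
    induction t with
    | zero => simp
    | add a b ha hb => simp only [map_add, ha, hb]
    | tmul a b => simp [antipode_mul_antidistrib, antipode_antipodeInv]
  rw [h1, mul_antipode_lTensor_comul_apply, Algebra.algebraMap_eq_smul_one, map_smul, antipode_one]

end AntipodeFacts

section Coassoc
variable {k H : Type*} [Field k] [Ring H] [HopfAlgebra k H]
open Coalgebra

/-- `h ↦ h₍₁₎ ⊗ (h₍₂₎ ⊗ h₍₃₎)` -/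
noncomputable def comul3 : H →ₗ[k] H ⊗[k] (H ⊗[k] H) :=
  TensorProduct.map LinearMap.id comul ∘ₗ comul

theorem comul5 :
    TensorProduct.map LinearMap.id
        ((TensorProduct.assoc k H (H ⊗[k] H) H).symm.toLinearMap ∘ₗ
          TensorProduct.map LinearMap.id (TensorProduct.assoc k H H H).symm.toLinearMap) ∘ₗ
      (TensorProduct.assoc k H H (H ⊗[k] (H ⊗[k] H))).toLinearMap ∘ₗ
        TensorProduct.map (comul (R := k)) (TensorProduct.map LinearMap.id (comul (R := k))) ∘ₗ
          comul3 (k := k) (H := H) =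
    TensorProduct.map LinearMap.id (TensorProduct.map comul3 LinearMap.id) ∘ₗ comul3 := by
  simp only [comul3, coassoc_simps]

theorem comul6 :
    TensorProduct.map LinearMap.id (TensorProduct.assoc k H H (H ⊗[k] H)).symm.toLinearMap ∘ₗ
      (TensorProduct.assoc k (H ⊗[k] H) H (H ⊗[k] (H ⊗[k] H))).toLinearMap ∘ₗ
        TensorProduct.map (TensorProduct.assoc k H H H).symm.toLinearMap LinearMap.id ∘ₗ
          TensorProduct.map comul3 comul3 ∘ₗ (comul (R := k) : H →ₗ[k] H ⊗[k] H) =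
    TensorProduct.map LinearMap.id (TensorProduct.map comul comul ∘ₗ comul) ∘ₗ
      (TensorProduct.assoc k H H H).symm.toLinearMap ∘ₗ comul3 := by
  simp only [comul3, coassoc_simps]

theorem comul4 :
    (TensorProduct.assoc k H H (H ⊗[k] H)).symm.toLinearMap ∘ₗ
      TensorProduct.map LinearMap.id ((TensorProduct.assoc k H H H).toLinearMap ∘ₗ
        TensorProduct.map comul LinearMap.id) ∘ₗ comul3 =
    TensorProduct.map LinearMap.id (comul (R := k)) ∘ₗ
      (TensorProduct.assoc k H H H).symm.toLinearMap ∘ₗ comul3 (k := k) (H := H) := by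
  simp only [comul3, coassoc_simps]

end Coassoc

/-- The underlying space `H^* ⊗ H` of the Drinfeld double `D(H) = (H^*)^cop ⋈ H`. -/
def DrinfeldDouble (k H : Type*) [Field k] [Ring H] [HopfAlgebra k H] : Type _ :=
  DualCop k H ⊗[k] H

namespace DrinfeldDouble
open Coalgebra HopfAlgebra

section Carrier
variable (k H : Type*) [Field k] [Ring H] [HopfAlgebra k H]

noncomputable instance : AddCommGroup (DrinfeldDouble k H) :=
  inferInstanceAs (AddCommGroup (DualCop k H ⊗[k] H))
noncomputable instance : Module k (DrinfeldDouble k H) :=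
  inferInstanceAs (Module k (DualCop k H ⊗[k] H))

variable {k H}

/-- The pure tensor `p ⊗ h`. -/
noncomputable def tmul (p : DualCop k H) (h : H) : DrinfeldDouble k H := p ⊗ₜ[k] h

variable (k H) in
/-- The bilinear map `(p, h) ↦ p ⊗ h`. -/
noncomputable def mk : DualCop k H →ₗ[k] H →ₗ[k] DrinfeldDouble k H :=
  TensorProduct.mk k (DualCop k H) H

theorem mk_apply (p : DualCop k H) (h : H) : mk k H p h = tmul p h := rfl

/-- The linear map on `D(H)` induced by a bilinear map. -/
noncomputable def tlift {M : Type*} [AddCommGroup M] [Module k M]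
    (f : DualCop k H →ₗ[k] H →ₗ[k] M) : DrinfeldDouble k H →ₗ[k] M :=
  TensorProduct.lift f

theorem tlift_tmul {M : Type*} [AddCommGroup M] [Module k M]
    (f : DualCop k H →ₗ[k] H →ₗ[k] M) (p : DualCop k H) (h : H) :
    tlift f (tmul p h) = f p h := rfl

theorem induction_on {P : DrinfeldDouble k H → Prop} (t : DrinfeldDouble k H) (zero : P 0)
    (tm : ∀ p h, P (tmul p h)) (add : ∀ a b, P a → P b → P (a + b)) : P t :=
  TensorProduct.induction_on (motive := P) t zero tm add

theorem hom_ext {M : Type*} [AddCommGroup M] [Module k M] {f g : DrinfeldDouble k H →ₗ[k] M}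
    (h : ∀ p x, f (tmul p x) = g (tmul p x)) : f = g :=
  TensorProduct.ext' h

/-- `h ⇀ p = p₍₂₎(h) p₍₁₎`, i.e. `(h ⇀ p)(x) = p(x h)`. -/
noncomputable def lact : H →ₗ[k] DualCop k H →ₗ[k] DualCop k H :=
  LinearMap.mk₂ k (fun h p => (DualCop.toDual k H).symm
      (DualCop.toDual k H p ∘ₗ LinearMap.mulRight k h))
    (fun a b p => DualCop.ext fun x => (congrArg (DualCop.toDual k H p) (mul_add x a b)).trans (map_add _ _ _))
    (fun c a p => DualCop.ext fun x => (congrArg (DualCop.toDual k H p) (mul_smul_comm c x a)).trans (map_smul _ _ _))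
    (fun _ _ _ => DualCop.ext fun _ => rfl)
    (fun _ _ _ => DualCop.ext fun _ => rfl)

/-- `ract h p` is `p ↼ h = p₍₁₎(h) p₍₂₎`, i.e. `(p ↼ h)(x) = p(h x)`. -/
noncomputable def ract : H →ₗ[k] DualCop k H →ₗ[k] DualCop k H :=
  LinearMap.mk₂ k (fun h p => (DualCop.toDual k H).symm
      (DualCop.toDual k H p ∘ₗ LinearMap.mulLeft k h))
    (fun a b p => DualCop.ext fun x => (congrArg (DualCop.toDual k H p) (add_mul a b x)).trans (map_add _ _ _))
    (fun c a p => DualCop.ext fun x => (congrArg (DualCop.toDual k H p) (smul_mul_assoc c a x)).trans (map_smul _ _ _))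
    (fun _ _ _ => DualCop.ext fun _ => rfl)
    (fun _ _ _ => DualCop.ext fun _ => rfl)

theorem lact_apply (h : H) (p : DualCop k H) (x : H) : (lact h p) x = p (x * h) := rfl
theorem ract_apply (h : H) (p : DualCop k H) (x : H) : (ract h p) x = p (h * x) := rfl

noncomputable instance : One (DrinfeldDouble k H) := ⟨tmul 1 1⟩

theorem one_def : (1 : DrinfeldDouble k H) = tmul 1 1 := rfl

variable (k H) in
/-- `q ⊗ h ↦ p q ⊗ h l`. -/
noncomputable def bimul (p : DualCop k H) (l : H) : DrinfeldDouble k H →ₗ[k] DrinfeldDouble k H :=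
  TensorProduct.map (LinearMap.mulLeft k p) (LinearMap.mulRight k l)


theorem bimul_tmul (p q : DualCop k H) (h l : H) :
    bimul k H p l (tmul q h) = tmul (p * q) (h * l) := rfl


theorem tmul_add (p : DualCop k H) (h h' : H) : tmul p (h + h') = tmul p h + tmul p h' :=
  TensorProduct.tmul_add _ _ _

theorem add_tmul (p p' : DualCop k H) (h : H) : tmul (p + p') h = tmul p h + tmul p' h :=
  TensorProduct.add_tmul _ _ _

theorem tmul_smul (r : k) (p : DualCop k H) (h : H) : tmul p (r • h) = r • tmul p h :=
  TensorProduct.tmul_smul _ _ _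

theorem smul_tmul (r : k) (p : DualCop k H) (h : H) : tmul (r • p) h = r • tmul p h :=
  TensorProduct.smul_tmul' _ _ _


theorem bimul_add_left (p p' : DualCop k H) (l : H) :
    bimul k H (p + p') l = bimul k H p l + bimul k H p' l :=
  hom_ext fun q h => by simp [bimul_tmul, add_mul, add_tmul]

theorem bimul_add_right (p : DualCop k H) (l l' : H) :
    bimul k H p (l + l') = bimul k H p l + bimul k H p l' :=
  hom_ext fun q h => by simp [bimul_tmul, mul_add, tmul_add]

theorem bimul_smul_left (r : k) (p : DualCop k H) (l : H) :
    bimul k H (r • p) l = r • bimul k H p l :=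
  hom_ext fun q h => by simp [bimul_tmul, smul_tmul]

theorem bimul_smul_right (r : k) (p : DualCop k H) (l : H) :
    bimul k H p (r • l) = r • bimul k H p l :=
  hom_ext fun q h => by simp [bimul_tmul, tmul_smul]

theorem comul3_mul (a b : H) : comul3 (k := k) (a * b) = comul3 (k := k) a * comul3 (k := k) b := by
  let f : H →ₐ[k] H ⊗[k] (H ⊗[k] H) :=
    (Algebra.TensorProduct.map (AlgHom.id k H) (Bialgebra.comulAlgHom k H)).comp
      (Bialgebra.comulAlgHom k H)
  have h : ∀ x, comul3 (k := k) x = f x := fun x => rfl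
  simp only [h, map_mul]


theorem comul3_one : comul3 (k := k) (1 : H) = 1 ⊗ₜ (1 ⊗ₜ 1) := by
  simp [comul3, Algebra.TensorProduct.one_def]

theorem exists_sum (X : DrinfeldDouble k H) :
    ∃ s : Finset (DualCop k H × H), X = ∑ i ∈ s, tmul i.1 i.2 :=
  TensorProduct.exists_finset (R := k) X

variable [HasBijectiveAntipode k H]

/-- `a ⊗ (b ⊗ c) ↦ (a ⇀ q ↼ s⁻¹(c)) ⊗ b` -/
noncomputable def crossAux (q : DualCop k H) : H ⊗[k] (H ⊗[k] H) →ₗ[k] DrinfeldDouble k H :=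
  TensorProduct.lift
    ((TensorProduct.lift.equiv (.id k) H H (DrinfeldDouble k H)).toLinearMap ∘ₗ
      LinearMap.mk₂ k (fun a b => (mk k H).flip b ∘ₗ
          (ract.flip (lact a q)) ∘ₗ antipodeInv k H)
        (fun a a' b => by ext c; simp)
        (fun r a b => by ext c; simp)
        (fun a b b' => by ext c; simp)
        (fun r a b => by ext c; simp))

theorem crossAux_tmul (q : DualCop k H) (a b c : H) :
    crossAux q (a ⊗ₜ (b ⊗ₜ c)) = tmul (ract (antipodeInv k H c) (lact a q)) b := rfl

theorem crossAux_add (q q' : DualCop k H) (t : H ⊗[k] (H ⊗[k] H)) :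
    crossAux (q + q') t = crossAux q t + crossAux q' t := by
  rw [← LinearMap.add_apply]
  congr 1
  ext a b c
  change (tmul _ _ : DrinfeldDouble k H) = tmul _ _ + tmul _ _
  simp [← mk_apply]

theorem crossAux_smul (r : k) (q : DualCop k H) (t : H ⊗[k] (H ⊗[k] H)) :
    crossAux (r • q) t = r • crossAux q t := by
  rw [← LinearMap.smul_apply]
  congr 1
  ext a b c
  change (tmul _ _ : DrinfeldDouble k H) = r • (tmul _ _ : DrinfeldDouble k H)
  simp [← mk_apply]

/-- `(ε ⊗ h)(q ⊗ 1) = (h₍₁₎ ⇀ q ↼ s⁻¹(h₍₃₎)) ⊗ h₍₂₎` -/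
noncomputable def cross : H →ₗ[k] DualCop k H →ₗ[k] DrinfeldDouble k H :=
  LinearMap.mk₂ k (fun h q => crossAux q (comul3 h))
    (fun a b q => by simp) (fun c a q => by simp)
    (fun a q q' => crossAux_add _ _ _) (fun c a q => crossAux_smul _ _ _)

theorem cross_apply (h : H) (q : DualCop k H) : cross h q = crossAux q (comul3 h) := rfl


/-- `(p ⊗ h)(q ⊗ l) = p (h₍₁₎ ⇀ q ↼ s⁻¹(h₍₃₎)) ⊗ h₍₂₎ l`, as a function of `q ⊗ l` -/
noncomputable def mulLeft (p : DualCop k H) (h : H) :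
    DrinfeldDouble k H →ₗ[k] DrinfeldDouble k H :=
  tlift (LinearMap.mk₂ k (fun q l => bimul k H p l (cross h q))
    (fun q q' l => by simp) (fun c q l => by simp)
    (fun q l l' => by simp [bimul_add_right]) (fun c q l => by simp [bimul_smul_right]))

theorem mulLeft_tmul (p q : DualCop k H) (h l : H) :
    mulLeft p h (tmul q l) = bimul k H p l (cross h q) := rfl

variable (k H) in
/-- The multiplication `(p ⊗ h)(q ⊗ l) = p (h₍₁₎ ⇀ q ↼ s⁻¹(h₍₃₎)) ⊗ h₍₂₎ l` of `D(H)`. -/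
noncomputable def mulMap :
    DrinfeldDouble k H →ₗ[k] DrinfeldDouble k H →ₗ[k] DrinfeldDouble k H :=
  tlift (LinearMap.mk₂ k mulLeft
    (fun p p' h => hom_ext fun q l => by simp [mulLeft_tmul, bimul_add_left])
    (fun c p h => hom_ext fun q l => by simp [mulLeft_tmul, bimul_smul_left])
    (fun p h h' => hom_ext fun q l => by simp [mulLeft_tmul])
    (fun c p h => hom_ext fun q l => by simp [mulLeft_tmul]))

noncomputable instance : Mul (DrinfeldDouble k H) := ⟨fun x y => mulMap k H x y⟩

theorem mul_def (x y : DrinfeldDouble k H) : x * y = mulMap k H x y := rfl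

theorem tmul_mul_tmul (p q : DualCop k H) (h l : H) :
    tmul p h * tmul q l = bimul k H p l (crossAux q (comul3 h)) := rfl


theorem crossAux_mul (q : DualCop k H) (t t' : H ⊗[k] (H ⊗[k] H)) :
    crossAux q (t * t') =
      tlift (LinearMap.mk₂ k (fun r l => bimul k H 1 l (crossAux r t))
        (fun q q' l => by simp [crossAux_add]) (fun c q l => by simp [crossAux_smul])
        (fun q l l' => by simp [bimul_add_right]) (fun c q l => by simp [bimul_smul_right]))
        (crossAux q t') := by
  induction t' with
  | zero => simp
  | add a b ha hb => simp only [mul_add, map_add, ha, hb]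
  | tmul a' d =>
    induction d with
    | zero => simp
    | add a b ha hb => simp only [mul_add, TensorProduct.tmul_add, map_add, ha, hb]
    | tmul b' c' =>
      rw [crossAux_tmul, tlift_tmul, LinearMap.mk₂_apply]
      induction t with
      | zero => simp
      | add a b ha hb => simp only [add_mul, map_add, ha, hb]
      | tmul a d =>
        induction d with
        | zero => simp
        | add a b ha hb => simp only [add_mul, TensorProduct.tmul_add, map_add, ha, hb]
        | tmul b c =>
          rw [Algebra.TensorProduct.tmul_mul_tmul, Algebra.TensorProduct.tmul_mul_tmul,
            crossAux_tmul, crossAux_tmul, bimul_tmul, one_mul]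
          congr 1
          apply DualCop.ext
          intro x
          simp only [ract_apply, lact_apply, antipodeInv_mul, mul_assoc]


/-- `p ↦ bimul p 1` -/
noncomputable def lmulMap : DualCop k H →ₗ[k] DrinfeldDouble k H →ₗ[k] DrinfeldDouble k H :=
  LinearMap.mk₂ k (fun p X => bimul k H p 1 X)
    (fun p q X => by simp [bimul_add_left]) (fun c p X => by simp [bimul_smul_left])
    (fun p X Y => map_add _ _ _) (fun c p X => map_smul _ _ _)

/-- `a ⊗ (t ⊗ c) ↦ (a ⇀ q ↼ s⁻¹(c)) • crossAux r t` -/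
noncomputable def cross5 (q r : DualCop k H) :
    H ⊗[k] ((H ⊗[k] (H ⊗[k] H)) ⊗[k] H) →ₗ[k] DrinfeldDouble k H :=
  TensorProduct.lift
    ((TensorProduct.lift.equiv (.id k) (H ⊗[k] (H ⊗[k] H)) H
      (DrinfeldDouble k H)).toLinearMap ∘ₗ
      LinearMap.mk₂ k (fun a t => lmulMap.flip (crossAux r t) ∘ₗ
          (ract.flip (lact a q)) ∘ₗ antipodeInv k H)
        (fun a a' b => by ext c; simp)
        (fun r a b => by ext c; simp)
        (fun a b b' => by ext c; simp)
        (fun r a b => by ext c; simp))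

theorem cross5_tmul (q r : DualCop k H) (a c : H) (t : H ⊗[k] (H ⊗[k] H)) :
    cross5 q r (a ⊗ₜ (t ⊗ₜ c)) =
      bimul k H (ract (antipodeInv k H c) (lact a q)) 1 (crossAux r t) := rfl

theorem ract_lact_mul (q r : DualCop k H) (a b c : H) (S T : H ⊗[k] H)
    (hS : S = comul a) (hT : T = comul c) :
    crossAux (q * r) (a ⊗ₜ (b ⊗ₜ c)) = cross5 q r (TensorProduct.map LinearMap.id
        ((TensorProduct.assoc k H (H ⊗[k] H) H).symm.toLinearMap ∘ₗ
          TensorProduct.map LinearMap.id (TensorProduct.assoc k H H H).symm.toLinearMap)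
      ((TensorProduct.assoc k H H (H ⊗[k] (H ⊗[k] H))) (S ⊗ₜ (b ⊗ₜ T)))) := by
  have key : ∀ S T : H ⊗[k] H, ∃ z : DualCop k H,
      cross5 q r (TensorProduct.map LinearMap.id
        ((TensorProduct.assoc k H (H ⊗[k] H) H).symm.toLinearMap ∘ₗ
          TensorProduct.map LinearMap.id (TensorProduct.assoc k H H H).symm.toLinearMap)
      ((TensorProduct.assoc k H H (H ⊗[k] (H ⊗[k] H))) (S ⊗ₜ (b ⊗ₜ T)))) = tmul z b ∧
      ∀ x, z x = LinearMap.mul' k k (TensorProduct.map (DualCop.toDual k H q)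
        (DualCop.toDual k H r) (TensorProduct.map (antipodeInv k H) (antipodeInv k H)
        (TensorProduct.comm k H H T) * (comul x * S))) := by
    intro S T
    induction S with
    | zero => exact ⟨0, by simp [← mk_apply], fun x => by simp⟩
    | add S S' hS hS' =>
      obtain ⟨z, h1, h2⟩ := hS
      obtain ⟨z', h1', h2'⟩ := hS'
      refine ⟨z + z', ?_, fun x => ?_⟩
      · rw [TensorProduct.add_tmul, map_add, map_add, map_add, h1, h1', add_tmul]
      · rw [DualCop.add_apply, h2, h2', mul_add, mul_add, map_add, map_add]
    | tmul a₁ a₂ =>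
      induction T with
      | zero => exact ⟨0, by simp [← mk_apply], fun x => by simp⟩
      | add S S' hS hS' =>
        obtain ⟨z, h1, h2⟩ := hS
        obtain ⟨z', h1', h2'⟩ := hS'
        refine ⟨z + z', ?_, fun x => ?_⟩
        · rw [TensorProduct.tmul_add, TensorProduct.tmul_add, map_add, map_add, map_add, h1, h1',
            add_tmul]
        · rw [DualCop.add_apply, h2, h2', map_add, map_add, add_mul, map_add, map_add]
      | tmul c₁ c₂ =>
        refine ⟨ract (antipodeInv k H c₂) (lact a₁ q) * ract (antipodeInv k H c₁) (lact a₂ r),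
          ?_, fun x => ?_⟩
        · change bimul k H (ract (antipodeInv k H c₂) (lact a₁ q)) 1
            (tmul (ract (antipodeInv k H c₁) (lact a₂ r)) b) = _
          rw [bimul_tmul, mul_one]
        · rw [DualCop.mul_apply]
          generalize (comul x : H ⊗[k] H) = t
          induction t with
          | zero => simp
          | add t t' h h' => simp only [map_add, add_mul, mul_add, h, h']
          | tmul x y =>
            simp only [TensorProduct.comm_tmul, TensorProduct.map_tmul,
              Algebra.TensorProduct.tmul_mul_tmul, LinearMap.mul'_apply, ract_apply, lact_apply,
              mul_assoc]
  subst hS hT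
  obtain ⟨z, h1, h2⟩ := key (comul a) (comul c)
  rw [h1, crossAux_tmul]
  congr 1
  apply DualCop.ext
  intro x
  rw [h2, ract_apply, lact_apply, DualCop.mul_apply, Bialgebra.comul_mul, Bialgebra.comul_mul,
    comul_antipodeInv, mul_assoc]

theorem cross_mul_right (h : H) (q r : DualCop k H) :
    crossAux (q * r) (comul3 h) =
      tlift (LinearMap.mk₂ k (fun p l => bimul k H p 1 (crossAux r (comul3 l)))
        (fun q q' l => by simp [bimul_add_left]) (fun c q l => by simp [bimul_smul_left])
        (fun q l l' => by simp) (fun c q l => by simp))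
        (crossAux q (comul3 h)) := by
  have h5 := congrArg (fun f => cross5 q r (f h)) (comul5 (k := k) (H := H))
  simp only [LinearMap.comp_apply] at h5
  generalize comul3 (k := k) h = t at h5 ⊢
  have e1 : crossAux (q * r) t = cross5 q r ((TensorProduct.map LinearMap.id
      (TensorProduct.map comul3 LinearMap.id)) t) := by
    rw [← h5]
    clear h5
    induction t with
    | zero => simp
    | add a b ha hb => simp only [map_add, ha, hb]
    | tmul a d =>
      induction d with
      | zero => simp
      | add a b ha hb => simp only [TensorProduct.tmul_add, map_add, ha, hb]
      | tmul b c => exact ract_lact_mul q r a b c _ _ rfl rfl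
  rw [e1]
  clear e1 h5
  induction t with
  | zero => simp
  | add a b ha hb => simp only [map_add, ha, hb]
  | tmul a d =>
    induction d with
    | zero => simp
    | add a b ha hb => simp only [TensorProduct.tmul_add, map_add, ha, hb]
    | tmul b c => rfl

theorem mul_assoc' (X Y Z : DrinfeldDouble k H) : X * Y * Z = X * (Y * Z) := by
  simp only [mul_def]
  induction X using induction_on with
  | zero => simp
  | add a b ha hb => simp only [map_add, LinearMap.add_apply, ha, hb]
  | tm p h =>
  induction Y using induction_on with
  | zero => simp
  | add a b ha hb => simp only [map_add, LinearMap.add_apply, ha, hb]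
  | tm q l =>
  induction Z using induction_on with
  | zero => simp
  | add a b ha hb => simp only [map_add, ha, hb]
  | tm r m =>
  change mulMap k H (bimul k H p l (crossAux q (comul3 h))) (tmul r m) =
    mulMap k H (tmul p h) (bimul k H q m (crossAux r (comul3 l)))
  obtain ⟨s, hs⟩ := exists_sum (crossAux q (comul3 h))
  obtain ⟨t, ht⟩ := exists_sum (crossAux r (comul3 l))
  rw [hs, ht]
  simp only [map_sum, LinearMap.sum_apply, bimul_tmul]
  change ∑ i ∈ s, bimul k H (p * i.1) m (crossAux r (comul3 (i.2 * l))) =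
    ∑ j ∈ t, bimul k H p (j.2 * m) (crossAux (q * j.1) (comul3 h))
  simp only [comul3_mul, crossAux_mul, cross_mul_right, hs, ht, map_sum, tlift_tmul,
    LinearMap.mk₂_apply]
  rw [Finset.sum_comm]
  refine Finset.sum_congr rfl fun i _ => Finset.sum_congr rfl fun j _ => ?_
  generalize crossAux i.1 (comul3 j.2) = W
  induction W using induction_on with
  | zero => simp
  | add a b ha hb => simp only [map_add, ha, hb]
  | tm a b => simp only [bimul_tmul, mul_assoc, one_mul, mul_one]

theorem crossAux_comul3_one (h : H) : crossAux (1 : DualCop k H) (comul3 h) = tmul 1 h := by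
  have e : ∀ t : H ⊗[k] (H ⊗[k] H), crossAux (1 : DualCop k H) t =
      mk k H 1 (TensorProduct.lid k H (TensorProduct.map counit
        ((TensorProduct.rid k H).toLinearMap ∘ₗ TensorProduct.map LinearMap.id counit) t)) := by
    intro t
    induction t with
    | zero => simp
    | add a b ha hb => simp only [map_add, ha, hb]
    | tmul a d =>
      induction d with
      | zero => simp
      | add a b ha hb => simp only [TensorProduct.tmul_add, map_add, ha, hb]
      | tmul b c =>
        rw [crossAux_tmul]
        have : ract (antipodeInv k H c) (lact a (1 : DualCop k H)) =
            (counit (R := k) a * counit (R := k) c) • (1 : DualCop k H) := by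
          apply DualCop.ext
          intro x
          rw [ract_apply, lact_apply, DualCop.smul_apply, DualCop.one_apply, DualCop.one_apply,
            Bialgebra.counit_mul, Bialgebra.counit_mul, counit_antipodeInv]
          ring
        rw [this, smul_tmul]
        simp [mul_smul, ← mk_apply, smul_comm (counit (R := k) a)]
  have h1 : (TensorProduct.map (counit (R := k) (A := H))
        ((TensorProduct.rid k H).toLinearMap ∘ₗ TensorProduct.map LinearMap.id counit)) ∘ₗ comul3 =
      TensorProduct.map counit LinearMap.id ∘ₗ comul := by
    rw [comul3, ← LinearMap.comp_assoc, ← TensorProduct.map_comp]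
    congr 2
    have := lTensor_counit_comp_comul (R := k) (A := H)
    rw [LinearMap.comp_assoc]
    change _ ∘ₗ (LinearMap.lTensor H counit ∘ₗ comul) = _
    rw [this]
    ext x; simp
  have h2 := congrArg (fun f => TensorProduct.lid k H (f h)) h1
  rw [e, ← mk_apply]
  congr 1
  refine Eq.trans h2 ?_
  change TensorProduct.lid k H (LinearMap.rTensor H counit (comul h)) = h
  rw [rTensor_counit_comul]; simp

theorem crossAux_one_tmul (q : DualCop k H) : crossAux q (comul3 1) = tmul q 1 := by
  rw [comul3_one, crossAux_tmul, antipodeInv_one]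
  congr 1
  apply DualCop.ext
  intro x
  rw [ract_apply, lact_apply, one_mul, mul_one]

noncomputable instance : Ring (DrinfeldDouble k H) where
  left_distrib a b c := by simp only [mul_def, map_add]
  right_distrib a b c := by simp only [mul_def, map_add, LinearMap.add_apply]
  zero_mul a := by simp only [mul_def, map_zero, LinearMap.zero_apply]
  mul_zero a := by simp only [mul_def, map_zero]
  mul_assoc := mul_assoc'
  one_mul a := by
    induction a using induction_on with
    | zero => simp only [mul_def, map_zero]
    | add a b ha hb => simp only [mul_def, map_add] at ha hb ⊢; rw [ha, hb]
    | tm p h => rw [one_def, tmul_mul_tmul, crossAux_one_tmul, bimul_tmul, one_mul, one_mul]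
  mul_one a := by
    induction a using induction_on with
    | zero => simp only [mul_def, map_zero, LinearMap.zero_apply]
    | add a b ha hb => simp only [mul_def, map_add, LinearMap.add_apply] at ha hb ⊢; rw [ha, hb]
    | tm p h => rw [one_def, tmul_mul_tmul, crossAux_comul3_one, bimul_tmul, mul_one, mul_one]
  zsmul := fun n a => n • a
  zsmul_zero' := SubNegMonoid.zsmul_zero'
  zsmul_succ' := SubNegMonoid.zsmul_succ'
  zsmul_neg' := SubNegMonoid.zsmul_neg'
  neg_add_cancel := neg_add_cancel

noncomputable instance : Algebra k (DrinfeldDouble k H) :=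
  Algebra.ofModule (fun r x y => by simp only [mul_def, map_smul, LinearMap.smul_apply])
    (fun r x y => by simp only [mul_def, map_smul])


theorem tmul_one_mul (p q : DualCop k H) (h : H) : tmul p 1 * tmul q h = tmul (p * q) h := by
  rw [tmul_mul_tmul, crossAux_one_tmul, bimul_tmul, one_mul]

theorem mul_one_tmul (q : DualCop k H) (h l : H) : tmul q h * tmul 1 l = tmul q (h * l) := by
  rw [tmul_mul_tmul, crossAux_comul3_one, bimul_tmul, mul_one]

theorem bimul_eq (p : DualCop k H) (l : H) (X : DrinfeldDouble k H) :
    bimul k H p l X = tmul p 1 * X * tmul 1 l := by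
  induction X using induction_on with
  | zero => simp
  | add a b ha hb => rw [map_add, ha, hb, mul_add, add_mul]
  | tm q h => rw [bimul_tmul, tmul_one_mul, mul_one_tmul]

theorem tmul_mul_tmul' (p q : DualCop k H) (h l : H) :
    tmul p h * tmul q l = tmul p 1 * crossAux q (comul3 h) * tmul 1 l := by
  rw [tmul_mul_tmul, bimul_eq]

theorem one_tmul_mul (q : DualCop k H) (h : H) :
    tmul 1 h * tmul q 1 = crossAux q (comul3 h) := by
  rw [tmul_mul_tmul', ← one_def, one_mul, mul_one]

variable [Module.Finite k H]

/-- The coalgebra structure of `D(H)` is that of the tensor product `(H^*)^cop ⊗ H`. -/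
noncomputable instance : Coalgebra k (DrinfeldDouble k H) :=
  inferInstanceAs (Coalgebra k (DualCop k H ⊗[k] H))

variable (k H) in
/-- `(p ⊗ q) ⊗ (h ⊗ l) ↦ (p ⊗ h) ⊗ (q ⊗ l)` -/
noncomputable def shuffle : (DualCop k H ⊗[k] DualCop k H) ⊗[k] (H ⊗[k] H) →ₗ[k]
    DrinfeldDouble k H ⊗[k] DrinfeldDouble k H :=
  (TensorProduct.tensorTensorTensorComm k (DualCop k H) (DualCop k H) H H).toLinearMap

theorem shuffle_tmul (p q : DualCop k H) (h l : H) :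
    shuffle k H ((p ⊗ₜ q) ⊗ₜ (h ⊗ₜ l)) = tmul p h ⊗ₜ tmul q l := rfl

theorem comul_tmul (p : DualCop k H) (h : H) :
    comul (R := k) (tmul p h) = shuffle k H (comul p ⊗ₜ comul h) := rfl

theorem counit_tmul (p : DualCop k H) (h : H) :
    counit (R := k) (tmul p h) = p 1 * counit (R := k) h :=  by
  change counit (R := k) h • counit (R := k) p = _
  rw [DualCop.counit_apply, smul_eq_mul, mul_comm]

theorem comul_dual_mul (p q : DualCop k H) :
    comul (R := k) (p * q) = comul (R := k) p * comul (R := k) q := by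
  apply (DualCop.pair_bijective k H).1
  ext x y
  change DualCop.pair k H _ (x ⊗ₜ y) = DualCop.pair k H _ (x ⊗ₜ y)
  rw [DualCop.pair_comul, DualCop.mul_apply, Bialgebra.comul_mul]
  have e : ∀ S T : DualCop k H ⊗[k] DualCop k H, DualCop.pair k H (S * T) (x ⊗ₜ y) =
      LinearMap.mul' k k (TensorProduct.map (DualCop.pair k H S) (DualCop.pair k H T)
        (TensorProduct.tensorTensorTensorComm k H H H H (comul x ⊗ₜ comul y))) := by
    intro S T
    induction S with
    | zero => simp
    | add a b ha hb => simp only [add_mul, map_add, TensorProduct.map_add_left,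
        LinearMap.add_apply, ha, hb]
    | tmul a b =>
      induction T with
      | zero => simp
      | add a b ha hb => simp only [mul_add, map_add, TensorProduct.map_add_right,
          LinearMap.add_apply, ha, hb]
      | tmul c d =>
        rw [Algebra.TensorProduct.tmul_mul_tmul, DualCop.pair_tmul, DualCop.mul_apply,
          DualCop.mul_apply]
        generalize (comul x : H ⊗[k] H) = X
        generalize (comul y : H ⊗[k] H) = Y
        induction X with
        | zero => simp
        | add a b ha hb => simp only [add_mul, map_add, TensorProduct.add_tmul, ha, hb]
        | tmul x₁ x₂ =>
          induction Y with
          | zero => simp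
          | add a b ha hb => simp only [mul_add, map_add, TensorProduct.tmul_add, ha, hb]
          | tmul y₁ y₂ =>
            simp only [TensorProduct.tensorTensorTensorComm_tmul, TensorProduct.map_tmul,
              LinearMap.mul'_apply, DualCop.pair_tmul]
            ring
  rw [e]
  generalize (comul x : H ⊗[k] H) = X
  generalize (comul y : H ⊗[k] H) = Y
  induction X with
  | zero => simp
  | add a b ha hb => simp only [mul_add, map_add, TensorProduct.add_tmul, ha, hb]
  | tmul x₁ x₂ =>
    induction Y with
    | zero => simp
    | add a b ha hb => simp only [add_mul, map_add, TensorProduct.tmul_add, ha, hb]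
    | tmul y₁ y₂ =>
      simp only [TensorProduct.tensorTensorTensorComm_tmul, TensorProduct.map_tmul,
        LinearMap.mul'_apply, DualCop.pair_comul, Algebra.TensorProduct.tmul_mul_tmul]

theorem comul_dual_one : comul (R := k) (1 : DualCop k H) = 1 ⊗ₜ[k] 1 := by
  apply (DualCop.pair_bijective k H).1
  ext x y
  change DualCop.pair k H (comul 1) (x ⊗ₜ y) =
    DualCop.pair k H ((1 : DualCop k H) ⊗ₜ[k] (1 : DualCop k H)) (x ⊗ₜ y)
  rw [DualCop.pair_comul, DualCop.pair_tmul, DualCop.one_apply, DualCop.one_apply,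
    DualCop.one_apply, Bialgebra.counit_mul, mul_comm]

theorem comul_tmul_one_mul (p : DualCop k H) (X : DrinfeldDouble k H) :
    comul (R := k) (tmul p 1 * X) = comul (R := k) (tmul p 1) * comul (R := k) X := by
  induction X using induction_on with
  | zero => simp
  | add a b ha hb => rw [mul_add, map_add, ha, hb, map_add, mul_add]
  | tm q h =>
    rw [tmul_one_mul, comul_tmul, comul_tmul, comul_tmul, comul_dual_mul, Bialgebra.comul_one,
      Algebra.TensorProduct.one_def]
    generalize (comul p : DualCop k H ⊗[k] DualCop k H) = P
    generalize (comul q : DualCop k H ⊗[k] DualCop k H) = Q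
    generalize (comul h : H ⊗[k] H) = X
    induction P with
    | zero => simp
    | add a b ha hb => simp only [add_mul, map_add, TensorProduct.add_tmul, ha, hb]
    | tmul p₁ p₂ =>
      induction Q with
      | zero => simp
      | add a b ha hb => simp only [mul_add, map_add, TensorProduct.add_tmul, ha, hb]
      | tmul q₁ q₂ =>
        induction X with
        | zero => simp
        | add a b ha hb => simp only [mul_add, map_add, TensorProduct.tmul_add, ha, hb]
        | tmul x₁ x₂ =>
          simp only [Algebra.TensorProduct.tmul_mul_tmul, shuffle_tmul, tmul_one_mul]

theorem comul_mul_one_tmul (l : H) (X : DrinfeldDouble k H) :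
    comul (R := k) (X * tmul 1 l) = comul (R := k) X * comul (R := k) (tmul 1 l) := by
  induction X using induction_on with
  | zero => simp
  | add a b ha hb => rw [add_mul, map_add, ha, hb, map_add, add_mul]
  | tm q h =>
    rw [mul_one_tmul, comul_tmul, comul_tmul, comul_tmul, Bialgebra.comul_mul, comul_dual_one]
    generalize (comul l : H ⊗[k] H) = P
    generalize (comul q : DualCop k H ⊗[k] DualCop k H) = Q
    generalize (comul h : H ⊗[k] H) = X
    induction P with
    | zero => simp
    | add a b ha hb => simp only [mul_add, map_add, TensorProduct.tmul_add, ha, hb]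
    | tmul p₁ p₂ =>
      induction Q with
      | zero => simp
      | add a b ha hb => simp only [add_mul, map_add, TensorProduct.add_tmul, ha, hb]
      | tmul q₁ q₂ =>
        induction X with
        | zero => simp
        | add a b ha hb => simp only [add_mul, map_add, TensorProduct.tmul_add, ha, hb]
        | tmul x₁ x₂ =>
          simp only [Algebra.TensorProduct.tmul_mul_tmul, shuffle_tmul, mul_one_tmul]

/-- `a ⊗ b ↦ (p ⊗ h ↦ (a ⇀ p) ⊗ h b)` -/
noncomputable def opL : H ⊗[k] H →ₗ[k] DrinfeldDouble k H →ₗ[k] DrinfeldDouble k H :=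
  TensorProduct.homTensorHomMap (RingHom.id k) _ _ _ _ ∘ₗ TensorProduct.map lact (LinearMap.mul k H).flip

/-- `b ⊗ c ↦ (p ⊗ h ↦ (p ↼ s⁻¹(c)) ⊗ h b)` -/
noncomputable def opR : H ⊗[k] H →ₗ[k] DrinfeldDouble k H →ₗ[k] DrinfeldDouble k H :=
  TensorProduct.homTensorHomMap (RingHom.id k) _ _ _ _ ∘ₗ (TensorProduct.comm k _ _).toLinearMap ∘ₗ
    TensorProduct.map (LinearMap.mul k H).flip (ract ∘ₗ antipodeInv k H)

theorem opL_tmul (a b : H) (p : DualCop k H) (h : H) :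
    opL (a ⊗ₜ b) (tmul p h) = tmul (lact a p) (h * b) := rfl

theorem opR_tmul (b c : H) (p : DualCop k H) (h : H) :
    opR (b ⊗ₜ c) (tmul p h) = tmul (ract (antipodeInv k H c) p) (h * b) := rfl


/-- `(a ⊗ b) ⊗ (m ⊗ (b' ⊗ c)) ↦ (a ⇀ q₍₁₎ ⊗ b) ⊗ ((m ⇀ q₍₂₎) ↼ s⁻¹(c) ⊗ b')` -/
noncomputable def crossComul (q : DualCop k H) : (H ⊗[k] H) ⊗[k] (H ⊗[k] (H ⊗[k] H)) →ₗ[k]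
    DrinfeldDouble k H ⊗[k] DrinfeldDouble k H :=
  TensorProduct.lift
    ((TensorProduct.lift.equiv (.id k) H (H ⊗[k] H)
      (DrinfeldDouble k H ⊗[k] DrinfeldDouble k H)).toLinearMap ∘ₗ
      LinearMap.mk₂ k (fun S m =>
          LinearMap.applyₗ (shuffle k H ((TensorProduct.map LinearMap.id (lact m) (comul q)) ⊗ₜ
            ((1 : H) ⊗ₜ[k] (1 : H)))) ∘ₗ
          (TensorProduct.mapBilinear (.id k) (DrinfeldDouble k H) (DrinfeldDouble k H)
            (DrinfeldDouble k H) (DrinfeldDouble k H) (opL S)) ∘ₗ opR)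
        (fun S S' m => by ext; simp)
        (fun r S m => by ext; simp)
        (fun S m m' => by ext; simp [TensorProduct.map_add_right, TensorProduct.add_tmul])
        (fun r S m => by
          ext; simp [TensorProduct.map_smul_right, ← TensorProduct.smul_tmul']))

theorem crossComul_tmul (q : DualCop k H) (S T : H ⊗[k] H) (m : H) :
    crossComul q (S ⊗ₜ (m ⊗ₜ T)) = TensorProduct.map (opL S) (opR T)
      (shuffle k H ((TensorProduct.map LinearMap.id (lact m) (comul q)) ⊗ₜ
            ((1 : H) ⊗ₜ[k] (1 : H)))) := rfl

theorem comul_ract_lact (q : DualCop k H) (a c : H) :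
    comul (R := k) (ract c (lact a q)) = TensorProduct.map (lact a) (ract c) (comul (R := k) q) := by
  apply (DualCop.pair_bijective k H).1
  ext x y
  change DualCop.pair k H _ (x ⊗ₜ y) = DualCop.pair k H (TensorProduct.map (lact a) (ract c)
    (comul (R := k) q)) (x ⊗ₜ y)
  rw [DualCop.pair_comul, ract_apply, lact_apply]
  have e : ∀ S : DualCop k H ⊗[k] DualCop k H, DualCop.pair k H (TensorProduct.map (lact a)
      (ract c) S) (x ⊗ₜ y) = DualCop.pair k H S ((x * a) ⊗ₜ (c * y)) := by
    intro S
    induction S with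
    | zero => simp
    | add a b ha hb => simp only [map_add, LinearMap.add_apply, ha, hb]
    | tmul p r => rfl
  rw [e, DualCop.pair_comul]
  simp only [mul_assoc]

theorem map_ract_comul (q : DualCop k H) (c : H) :
    TensorProduct.map (ract c) LinearMap.id (comul (R := k) q) =
      TensorProduct.map LinearMap.id (lact c) (comul (R := k) q) := by
  apply (DualCop.pair_bijective k H).1
  ext x y
  change DualCop.pair k H (TensorProduct.map (ract c) LinearMap.id (comul (R := k) q)) (x ⊗ₜ y) =
    DualCop.pair k H (TensorProduct.map LinearMap.id (lact c) (comul (R := k) q)) (x ⊗ₜ y)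
  have e : ∀ S : DualCop k H ⊗[k] DualCop k H, DualCop.pair k H (TensorProduct.map (ract c)
      LinearMap.id S) (x ⊗ₜ y) = DualCop.pair k H S ((c * x) ⊗ₜ y) := by
    intro S
    induction S with
    | zero => simp
    | add a b ha hb => simp only [map_add, LinearMap.add_apply, ha, hb]
    | tmul p r => rfl
  have e' : ∀ S : DualCop k H ⊗[k] DualCop k H, DualCop.pair k H (TensorProduct.map
      LinearMap.id (lact c) S) (x ⊗ₜ y) = DualCop.pair k H S (x ⊗ₜ (y * c)) := by
    intro S
    induction S with
    | zero => simp
    | add a b ha hb => simp only [map_add, LinearMap.add_apply, ha, hb]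
    | tmul p r => rfl
  rw [e, e', DualCop.pair_comul, DualCop.pair_comul, mul_assoc]

theorem lact_one (q : DualCop k H) : lact 1 q = q :=
  DualCop.ext fun x => by rw [lact_apply, mul_one]

theorem lact_mul (a b : H) (q : DualCop k H) : lact (a * b) q = lact a (lact b q) :=
  DualCop.ext fun x => by rw [lact_apply, lact_apply, lact_apply, mul_assoc]

theorem ract_lact_comm (a b : H) (q : DualCop k H) : ract a (lact b q) = lact b (ract a q) :=
  DualCop.ext fun x => by rw [lact_apply, ract_apply, lact_apply, ract_apply, mul_assoc]

theorem comul_crossAux_tmul (q : DualCop k H) (a b c : H) :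
    comul (R := k) (crossAux q (a ⊗ₜ (b ⊗ₜ c))) =
      crossComul q (TensorProduct.map LinearMap.id (TensorProduct.mk k H (H ⊗[k] H) 1)
        ((TensorProduct.assoc k H H (H ⊗[k] H)).symm
          (TensorProduct.map LinearMap.id ((TensorProduct.assoc k H H H).toLinearMap ∘ₗ
            TensorProduct.map comul LinearMap.id) (a ⊗ₜ (b ⊗ₜ c))))) := by
  rw [crossAux_tmul, comul_tmul, comul_ract_lact, TensorProduct.map_tmul, LinearMap.comp_apply,
    TensorProduct.map_tmul]
  generalize (comul b : H ⊗[k] H) = B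
  induction B with
  | zero => simp
  | add x y hx hy => simp only [map_add, TensorProduct.tmul_add, TensorProduct.add_tmul, hx, hy]
  | tmul x y =>
    change _ = crossComul q ((a ⊗ₜ x) ⊗ₜ (1 ⊗ₜ (y ⊗ₜ c)))
    rw [crossComul_tmul]
    generalize (comul q : DualCop k H ⊗[k] DualCop k H) = Q
    induction Q with
    | zero => simp
    | add x y hx hy => simp only [map_add, TensorProduct.add_tmul, hx, hy]
    | tmul q₁ q₂ =>
      simp only [TensorProduct.map_tmul, shuffle_tmul, opL_tmul, opR_tmul, lact_one, one_mul,
        LinearMap.id_apply]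

variable (k H) in
/-- `c ⊗ a ↦ a s⁻¹(c)` -/
noncomputable def contr : H ⊗[k] H →ₗ[k] H :=
  LinearMap.mul' k H ∘ₗ TensorProduct.map LinearMap.id (antipodeInv k H) ∘ₗ
    (TensorProduct.comm k H H).toLinearMap

theorem contr_comul (h : H) : contr k H (comul h) = algebraMap k H (counit h) :=
  mul_antipodeInv_comul h

variable (k H) in
/-- h₁, h₂ -/
noncomputable def reassoc6 : (H ⊗[k] (H ⊗[k] H)) ⊗[k] (H ⊗[k] (H ⊗[k] H)) →ₗ[k]
    (H ⊗[k] H) ⊗[k] ((H ⊗[k] H) ⊗[k] (H ⊗[k] H)) :=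
  TensorProduct.map LinearMap.id (TensorProduct.assoc k H H (H ⊗[k] H)).symm.toLinearMap ∘ₗ
      (TensorProduct.assoc k (H ⊗[k] H) H (H ⊗[k] (H ⊗[k] H))).toLinearMap ∘ₗ
        TensorProduct.map (TensorProduct.assoc k H H H).symm.toLinearMap LinearMap.id

/-- `q ↦ crossAux q T` -/
noncomputable def crossFlip (T : H ⊗[k] (H ⊗[k] H)) : DualCop k H →ₗ[k] DrinfeldDouble k H where
  toFun q := crossAux q T
  map_add' _ _ := crossAux_add _ _ _
  map_smul' _ _ := crossAux_smul _ _ _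

theorem crossFlip_add (T T' : H ⊗[k] (H ⊗[k] H)) :
    crossFlip (T + T') = crossFlip T + crossFlip T' := LinearMap.ext fun q => map_add (crossAux q) T T'

theorem crossFlip_zero : crossFlip (0 : H ⊗[k] (H ⊗[k] H)) = 0 :=
  LinearMap.ext fun q => map_zero (crossAux q)

theorem map_crossFlip (q : DualCop k H) (T T' : H ⊗[k] (H ⊗[k] H)) :
    TensorProduct.map (crossFlip T) (crossFlip T') (comul q) =
      crossComul q (TensorProduct.map LinearMap.id (TensorProduct.map (contr k H) LinearMap.id)
        (reassoc6 k H (T ⊗ₜ T'))) := by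
  induction T with
  | zero => simp [crossFlip_zero]
  | add x y hx hy => simp only [crossFlip_add, TensorProduct.map_add_left, LinearMap.add_apply,
      TensorProduct.add_tmul, map_add, hx, hy]
  | tmul a d =>
  induction d with
  | zero => simp [crossFlip_zero]
  | add x y hx hy => simp only [crossFlip_add, TensorProduct.map_add_left, LinearMap.add_apply,
      TensorProduct.add_tmul, TensorProduct.tmul_add, map_add, hx, hy]
  | tmul b c =>
  induction T' with
  | zero => simp [crossFlip_zero]
  | add x y hx hy => simp only [crossFlip_add, TensorProduct.map_add_right, LinearMap.add_apply,
      TensorProduct.tmul_add, map_add, hx, hy]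
  | tmul a' d =>
  induction d with
  | zero => simp [crossFlip_zero]
  | add x y hx hy => simp only [crossFlip_add, TensorProduct.map_add_right, LinearMap.add_apply,
      TensorProduct.tmul_add, map_add, hx, hy]
  | tmul b' c' =>
  change _ = crossComul q ((a ⊗ₜ b) ⊗ₜ ((a' * antipodeInv k H c) ⊗ₜ (b' ⊗ₜ c')))
  rw [crossComul_tmul]
  have e1 : ∀ Q : DualCop k H ⊗[k] DualCop k H,
      TensorProduct.map (crossFlip (a ⊗ₜ[k] (b ⊗ₜ[k] c))) (crossFlip (a' ⊗ₜ[k] (b' ⊗ₜ[k] c'))) Q =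
      TensorProduct.map (((mk k H).flip b) ∘ₗ lact a)
        (((mk k H).flip b') ∘ₗ ract (antipodeInv k H c') ∘ₗ lact a')
        (TensorProduct.map (ract (antipodeInv k H c)) LinearMap.id Q) := by
    intro Q
    induction Q with
    | zero => simp
    | add x y hx hy => simp only [map_add, hx, hy]
    | tmul q₁ q₂ =>
      change tmul (ract _ (lact a q₁)) b ⊗ₜ tmul _ b' = tmul (lact a (ract _ q₁)) b ⊗ₜ tmul _ b'
      rw [ract_lact_comm]
      rfl
  rw [e1, map_ract_comul]
  generalize (comul q : DualCop k H ⊗[k] DualCop k H) = Q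
  induction Q with
  | zero => simp
  | add x y hx hy => simp only [map_add, TensorProduct.add_tmul, hx, hy]
  | tmul q₁ q₂ =>
    simp only [TensorProduct.map_tmul, shuffle_tmul, opL_tmul, opR_tmul, one_mul,
      LinearMap.id_apply, lact_mul]
    rfl

theorem comul_one_tmul_mul (q : DualCop k H) (h : H) :
    comul (R := k) (tmul 1 h * tmul q 1) =
      comul (R := k) (tmul 1 h) * comul (R := k) (tmul q 1) := by
  have r1 : comul (R := k) (tmul 1 h) * comul (R := k) (tmul q 1) =
      crossComul q (TensorProduct.map LinearMap.id (TensorProduct.map (contr k H) LinearMap.id)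
        (reassoc6 k H (TensorProduct.map comul3 comul3 (comul h)))) := by
    rw [comul_tmul, comul_tmul, comul_dual_one, Bialgebra.comul_one, Algebra.TensorProduct.one_def]
    generalize (comul h : H ⊗[k] H) = S
    induction S with
    | zero => simp
    | add x y hx hy => simp only [map_add, TensorProduct.tmul_add, add_mul, hx, hy]
    | tmul h₁ h₂ =>
      rw [TensorProduct.map_tmul, ← map_crossFlip]
      generalize (comul q : DualCop k H ⊗[k] DualCop k H) = Q
      induction Q with
      | zero => simp
      | add x y hx hy => simp only [map_add, TensorProduct.add_tmul, mul_add, hx, hy]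
      | tmul q₁ q₂ =>
        rw [shuffle_tmul, shuffle_tmul, Algebra.TensorProduct.tmul_mul_tmul, one_tmul_mul,
          one_tmul_mul]
        rfl
  have h6 := congrArg (fun f => f h) (comul6 (k := k) (H := H))
  have h4 := congrArg (fun f => f h) (comul4 (k := k) (H := H))
  have h6' : reassoc6 k H (TensorProduct.map comul3 comul3 (comul h)) =
    TensorProduct.map LinearMap.id (TensorProduct.map comul comul ∘ₗ comul)
      ((TensorProduct.assoc k H H H).symm (comul3 h)) := h6
  have c1 : ∀ w : H, TensorProduct.map (contr k H) LinearMap.id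
      (TensorProduct.map comul comul (comul w)) = (1 : H) ⊗ₜ[k] (comul (R := k) w) := by
    intro w
    have e : ∀ W : H ⊗[k] H, TensorProduct.map (contr k H) LinearMap.id
      (TensorProduct.map comul comul W) =
        TensorProduct.map (Algebra.linearMap k H) comul (LinearMap.rTensor H counit W) := by
      intro W
      induction W with
      | zero => simp
      | add x y hx hy => simp only [map_add, hx, hy]
      | tmul x y =>
        simp only [TensorProduct.map_tmul, contr_comul, LinearMap.rTensor_tmul,
          LinearMap.id_apply, Algebra.linearMap_apply]
    rw [e, rTensor_counit_comul, TensorProduct.map_tmul, Algebra.linearMap_apply, map_one]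
  have r2 : TensorProduct.map LinearMap.id (TensorProduct.map (contr k H) LinearMap.id)
      (reassoc6 k H (TensorProduct.map comul3 comul3 (comul h))) =
      TensorProduct.map LinearMap.id (TensorProduct.mk k H (H ⊗[k] H) 1)
        (TensorProduct.map LinearMap.id (comul (R := k))
          ((TensorProduct.assoc k H H H).symm (comul3 h))) := by
    rw [h6']
    generalize (TensorProduct.assoc k H H H).symm (comul3 (k := k) h) = W
    induction W with
    | zero => simp
    | add x y hx hy => simp only [map_add, hx, hy]
    | tmul x y =>
      simp only [TensorProduct.map_tmul, LinearMap.comp_apply, c1, LinearMap.id_apply]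
      rfl
  rw [r1, r2, one_tmul_mul]
  refine Eq.trans ?_ (congrArg (fun X => crossComul q (TensorProduct.map LinearMap.id
    (TensorProduct.mk k H (H ⊗[k] H) 1) X)) h4)
  simp only [LinearMap.comp_apply]
  generalize comul3 (k := k) h = t
  induction t with
  | zero => simp
  | add x y hx hy => simp only [map_add, hx, hy]
  | tmul a d =>
    induction d with
    | zero => simp
    | add x y hx hy => simp only [TensorProduct.tmul_add, map_add, hx, hy]
    | tmul b c => exact comul_crossAux_tmul q a b c

theorem comul_mul' (X Y : DrinfeldDouble k H) :
    comul (R := k) (X * Y) = comul (R := k) X * comul (R := k) Y := by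
  induction X using induction_on with
  | zero => simp
  | add a b ha hb => rw [add_mul, map_add, ha, hb, map_add, add_mul]
  | tm p h =>
  induction Y using induction_on with
  | zero => simp
  | add a b ha hb => rw [mul_add, map_add, ha, hb, map_add, mul_add]
  | tm q l =>
    have e1 : tmul p h = tmul p 1 * tmul 1 h := by rw [tmul_one_mul, mul_one]
    have e2 : tmul q l = tmul q 1 * tmul 1 l := by rw [mul_one_tmul, one_mul]
    rw [e1, e2, comul_tmul_one_mul, comul_mul_one_tmul, mul_assoc (tmul p 1),
      ← mul_assoc (tmul 1 h), comul_tmul_one_mul, comul_mul_one_tmul, comul_one_tmul_mul]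
    simp only [mul_assoc]

theorem comul_one' : comul (R := k) (1 : DrinfeldDouble k H) = 1 := by
  rw [one_def, comul_tmul, comul_dual_one, Bialgebra.comul_one, Algebra.TensorProduct.one_def,
    shuffle_tmul]
  rfl

theorem counit_one' : counit (R := k) (1 : DrinfeldDouble k H) = 1 := by
  rw [one_def, counit_tmul, DualCop.one_apply, Bialgebra.counit_one, mul_one]

theorem counit_bimul (p : DualCop k H) (l : H) (X : DrinfeldDouble k H) :
    counit (R := k) (bimul k H p l X) = p 1 * counit (R := k) l * counit (R := k) X := by
  induction X using induction_on with
  | zero => simp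
  | add a b ha hb => rw [map_add, map_add, map_add, ha, hb, mul_add]
  | tm q h =>
    rw [bimul_tmul, counit_tmul, counit_tmul, DualCop.mul_apply, Bialgebra.comul_one,
      Algebra.TensorProduct.one_def, TensorProduct.map_tmul, LinearMap.mul'_apply,
      Bialgebra.counit_mul]
    ring

theorem counit_crossAux (q : DualCop k H) (h : H) :
    counit (R := k) (crossAux q (comul3 h)) = q 1 * counit (R := k) h := by
  have e : ∀ t : H ⊗[k] (H ⊗[k] H), counit (R := k) (crossAux q t) =
      q (LinearMap.mul' k H (TensorProduct.map (antipodeInv k H) LinearMap.id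
        (TensorProduct.comm k H H (TensorProduct.map LinearMap.id
          ((TensorProduct.lid k H).toLinearMap ∘ₗ TensorProduct.map counit LinearMap.id) t)))) := by
    intro t
    induction t with
    | zero => simp
    | add a b ha hb => simp only [map_add, ha, hb]
    | tmul a d =>
      induction d with
      | zero => simp
      | add a b ha hb => simp only [TensorProduct.tmul_add, map_add, ha, hb]
      | tmul b c =>
        rw [crossAux_tmul, counit_tmul, ract_apply, lact_apply, mul_one]
        simp [mul_comm]
  have h1 : TensorProduct.map LinearMap.id ((TensorProduct.lid k H).toLinearMap ∘ₗ
      TensorProduct.map (counit (R := k)) LinearMap.id) (comul3 h) = comul (R := k) h := by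
    rw [comul3, LinearMap.comp_apply]
    generalize (comul h : H ⊗[k] H) = W
    induction W with
    | zero => simp
    | add x y hx hy => simp only [map_add, hx, hy]
    | tmul x y =>
      rw [TensorProduct.map_tmul, TensorProduct.map_tmul]
      change x ⊗ₜ (TensorProduct.lid k H (LinearMap.rTensor H counit (comul y))) = _
      rw [rTensor_counit_comul, TensorProduct.lid_tmul, one_smul]
  rw [e, h1, antipodeInv_mul_comul, Algebra.algebraMap_eq_smul_one, map_smul, smul_eq_mul, mul_comm]

theorem counit_mul' (X Y : DrinfeldDouble k H) :
    counit (R := k) (X * Y) = counit (R := k) X * counit (R := k) Y := by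
  induction X using induction_on with
  | zero => simp
  | add a b ha hb => rw [add_mul, map_add, ha, hb, map_add, add_mul]
  | tm p h =>
  induction Y using induction_on with
  | zero => simp
  | add a b ha hb => rw [mul_add, map_add, ha, hb, map_add, mul_add]
  | tm q l =>
    rw [tmul_mul_tmul, counit_bimul, counit_crossAux, counit_tmul, counit_tmul]
    ring

noncomputable instance : Bialgebra k (DrinfeldDouble k H) :=
  Bialgebra.mk' k (DrinfeldDouble k H) counit_one' (fun {a b} => counit_mul' a b) comul_one'
    (fun {a b} => comul_mul' a b)


/-- `p ↦ p ∘ s⁻¹` -/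
noncomputable def dualAntipodeInv : DualCop k H →ₗ[k] DualCop k H :=
  (DualCop.toDual k H).symm.toLinearMap ∘ₗ LinearMap.lcomp k k (antipodeInv k H) ∘ₗ
    (DualCop.toDual k H).toLinearMap

theorem dualAntipodeInv_apply (p : DualCop k H) (x : H) :
    (dualAntipodeInv p) x = p (antipodeInv k H x) := rfl

/-- `S(p ⊗ h) = (ε ⊗ s(h)) (p ∘ s⁻¹ ⊗ 1)` -/
noncomputable def antipodeMap : DrinfeldDouble k H →ₗ[k] DrinfeldDouble k H :=
  tlift (LinearMap.mk₂ k (fun p h => tmul 1 (antipode k h) * tmul (dualAntipodeInv p) 1)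
    (fun p p' h => by rw [map_add, add_tmul, mul_add])
    (fun c p h => by rw [map_smul, smul_tmul, mul_smul_comm])
    (fun p h h' => by rw [map_add, tmul_add, add_mul])
    (fun c p h => by rw [map_smul, tmul_smul, smul_mul_assoc]))

theorem antipodeMap_tmul (p : DualCop k H) (h : H) :
    antipodeMap (tmul p h) = tmul 1 (antipode k h) * tmul (dualAntipodeInv p) 1 := rfl

theorem dual_antipode_left (p : DualCop k H) :
    LinearMap.mul' k (DualCop k H) (TensorProduct.map dualAntipodeInv LinearMap.id (comul p)) =
      (p 1) • 1 := by
  apply DualCop.ext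
  intro x
  have e : ∀ P : DualCop k H ⊗[k] DualCop k H,
      (LinearMap.mul' k (DualCop k H) (TensorProduct.map dualAntipodeInv LinearMap.id P)) x =
        DualCop.pair k H P (TensorProduct.map (antipodeInv k H) LinearMap.id (comul x)) := by
    intro P
    induction P with
    | zero => simp
    | add a b ha hb => simp only [map_add, LinearMap.add_apply, ha, hb]
    | tmul a b =>
      rw [TensorProduct.map_tmul, LinearMap.mul'_apply, DualCop.mul_apply]
      generalize (comul x : H ⊗[k] H) = X
      induction X with
      | zero => simp
      | add a b ha hb => simp only [map_add, ha, hb]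
      | tmul x y => rfl
  have e' : ∀ X : H ⊗[k] H, DualCop.pair k H (comul p) X =
      p (LinearMap.mul' k H (TensorProduct.comm k H H X)) := by
    intro X
    induction X with
    | zero => simp
    | add a b ha hb => simp only [map_add, ha, hb]
    | tmul x y => rw [DualCop.pair_comul]; rfl
  rw [e, e', DualCop.smul_apply, DualCop.one_apply, ← TensorProduct.map_comm,
    mul_antipodeInv_comul, Algebra.algebraMap_eq_smul_one, map_smul, smul_eq_mul, mul_comm]

theorem dual_antipode_right (p : DualCop k H) :
    LinearMap.mul' k (DualCop k H) (TensorProduct.map LinearMap.id dualAntipodeInv (comul p)) =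
      (p 1) • 1 := by
  apply DualCop.ext
  intro x
  have e : ∀ P : DualCop k H ⊗[k] DualCop k H,
      (LinearMap.mul' k (DualCop k H) (TensorProduct.map LinearMap.id dualAntipodeInv P)) x =
        DualCop.pair k H P (TensorProduct.map LinearMap.id (antipodeInv k H) (comul x)) := by
    intro P
    induction P with
    | zero => simp
    | add a b ha hb => simp only [map_add, LinearMap.add_apply, ha, hb]
    | tmul a b =>
      rw [TensorProduct.map_tmul, LinearMap.mul'_apply, DualCop.mul_apply]
      generalize (comul x : H ⊗[k] H) = X
      induction X with
      | zero => simp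
      | add a b ha hb => simp only [map_add, ha, hb]
      | tmul x y => rfl
  have e' : ∀ X : H ⊗[k] H, DualCop.pair k H (comul p) X =
      p (LinearMap.mul' k H (TensorProduct.comm k H H X)) := by
    intro X
    induction X with
    | zero => simp
    | add a b ha hb => simp only [map_add, ha, hb]
    | tmul x y => rw [DualCop.pair_comul]; rfl
  rw [e, e', DualCop.smul_apply, DualCop.one_apply, ← TensorProduct.map_comm,
    antipodeInv_mul_comul, Algebra.algebraMap_eq_smul_one, map_smul, smul_eq_mul, mul_comm]

theorem algebraMap_eq (c : k) :
    algebraMap k (DrinfeldDouble k H) c = c • tmul 1 1 := by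
  rw [Algebra.algebraMap_eq_smul_one, one_def]

theorem antipode_left (p : DualCop k H) (h : H) :
    LinearMap.mul' k (DrinfeldDouble k H) (antipodeMap.rTensor _ (comul (tmul p h))) =
      algebraMap k _ (counit (tmul p h)) := by
  have e : ∀ (P : DualCop k H ⊗[k] DualCop k H) (a b : H),
      LinearMap.mul' k (DrinfeldDouble k H) (antipodeMap.rTensor _ (shuffle k H (P ⊗ₜ (a ⊗ₜ b)))) =
      tmul 1 (antipode k a) * tmul (LinearMap.mul' k (DualCop k H)
        (TensorProduct.map dualAntipodeInv LinearMap.id P)) 1 * tmul 1 b := by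
    intro P a b
    induction P with
    | zero => simp [← mk_apply]
    | add x y hx hy => simp only [TensorProduct.add_tmul, map_add, hx, hy, add_tmul, mul_add,
        add_mul]
    | tmul p q =>
      rw [shuffle_tmul, LinearMap.rTensor_tmul, LinearMap.mul'_apply, antipodeMap_tmul,
        TensorProduct.map_tmul, LinearMap.mul'_apply, LinearMap.id_apply, mul_assoc, mul_assoc,
        mul_one_tmul, tmul_one_mul, one_mul]
  have e2 : ∀ X : H ⊗[k] H, LinearMap.mul' k (DrinfeldDouble k H) (antipodeMap.rTensor _
      (shuffle k H (comul p ⊗ₜ X))) =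
      p 1 • tmul 1 (LinearMap.mul' k H ((antipode k).rTensor H X)) := by
    intro X
    induction X with
    | zero => simp [← mk_apply]
    | add x y hx hy => simp only [TensorProduct.tmul_add, map_add, hx, hy, tmul_add, smul_add]
    | tmul a b =>
      rw [e, dual_antipode_left, smul_tmul, mul_smul_comm, smul_mul_assoc, ← one_def, mul_one,
        mul_one_tmul]
      rfl
  rw [comul_tmul, e2, mul_antipode_rTensor_comul_apply, counit_tmul, algebraMap_eq, mul_smul,
    Algebra.algebraMap_eq_smul_one, tmul_smul]

theorem antipode_right (p : DualCop k H) (h : H) :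
    LinearMap.mul' k (DrinfeldDouble k H) (antipodeMap.lTensor _ (comul (tmul p h))) =
      algebraMap k _ (counit (tmul p h)) := by
  have e : ∀ (r s : DualCop k H) (X : H ⊗[k] H),
      LinearMap.mul' k (DrinfeldDouble k H) (antipodeMap.lTensor _
        (shuffle k H ((r ⊗ₜ s) ⊗ₜ X))) =
      tmul r (LinearMap.mul' k H ((antipode k).lTensor H X)) *
        tmul (dualAntipodeInv s) 1 := by
    intro r s X
    induction X with
    | zero => simp [← mk_apply]
    | add x y hx hy => simp only [TensorProduct.tmul_add, map_add, hx, hy, tmul_add, add_mul]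
    | tmul a b =>
      rw [shuffle_tmul, LinearMap.lTensor_tmul, LinearMap.mul'_apply, antipodeMap_tmul,
        ← mul_assoc, mul_one_tmul]
      rfl
  have e2 : ∀ P : DualCop k H ⊗[k] DualCop k H, LinearMap.mul' k (DrinfeldDouble k H)
      (antipodeMap.lTensor _ (shuffle k H (P ⊗ₜ comul h))) =
      counit (R := k) h • tmul (LinearMap.mul' k (DualCop k H)
        (TensorProduct.map LinearMap.id dualAntipodeInv P)) 1 := by
    intro P
    induction P with
    | zero => simp [← mk_apply]
    | add x y hx hy => simp only [TensorProduct.add_tmul, map_add, hx, hy, add_tmul, smul_add]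
    | tmul r s =>
      rw [e, mul_antipode_lTensor_comul_apply, Algebra.algebraMap_eq_smul_one, tmul_smul,
        smul_mul_assoc, tmul_one_mul]
      rfl
  rw [comul_tmul, e2, dual_antipode_right, counit_tmul, algebraMap_eq, smul_tmul, smul_smul,
    mul_comm]

noncomputable instance : HopfAlgebra k (DrinfeldDouble k H) where
  antipode := antipodeMap
  mul_antipode_rTensor_comul := hom_ext fun p h => antipode_left p h
  mul_antipode_lTensor_comul := hom_ext fun p h => antipode_right p h

end Carrier
end DrinfeldDouble
end Double


section QBinomial
variable {k : Type*} [Field k] {B : Type*} [Ring B] [Algebra k B]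

/-- Gaussian binomial coefficients `binom(i + j, i)_q`. -/
def gaussCoeff (q : k) : ℕ → ℕ → k
  | 0, _ => 1
  | _ + 1, 0 => 1
  | i + 1, j + 1 => q ^ (j + 1) * gaussCoeff q i (j + 1) + gaussCoeff q (i + 1) j

theorem gaussCoeff_zero_left (q : k) (j : ℕ) : gaussCoeff q 0 j = 1 := by
  cases j <;> simp [gaussCoeff]

theorem gaussCoeff_zero_right (q : k) (i : ℕ) : gaussCoeff q i 0 = 1 := by
  cases i <;> simp [gaussCoeff]

/-- The `q`-factorial. -/
def qFactorial (q : k) (m : ℕ) : k := ∏ t ∈ Finset.range m, ∑ s ∈ Finset.range (t + 1), q ^ s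

theorem qFactorial_succ (q : k) (m : ℕ) :
    qFactorial q (m + 1) = qFactorial q m * ∑ s ∈ Finset.range (m + 1), q ^ s :=
  Finset.prod_range_succ _ _

theorem gaussCoeff_mul (q : k) (i j : ℕ) :
    gaussCoeff q i j * (qFactorial q i * qFactorial q j) = qFactorial q (i + j) := by
  induction i, j using gaussCoeff.induct with
  | case1 j => simp [gaussCoeff_zero_left, qFactorial]
  | case2 i => simp [gaussCoeff, qFactorial]
  | case3 i j h1 h2 =>
    have e : i + 1 + (j + 1) = (i + j + 1) + 1 := by ring
    have e3 : ∑ s ∈ Finset.range (i + j + 1 + 1), q ^ s =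
        ∑ s ∈ Finset.range (j + 1), q ^ s + q ^ (j + 1) * ∑ s ∈ Finset.range (i + 1), q ^ s := by
      rw [show i + j + 1 + 1 = (j + 1) + (i + 1) by ring, Finset.sum_range_add, Finset.mul_sum]
      simp only [pow_add]
    rw [e, qFactorial_succ q (i + j + 1), e3, gaussCoeff]
    have h1' : gaussCoeff q i (j + 1) * (qFactorial q i * qFactorial q (j + 1)) =
      qFactorial q (i + j + 1) := h1
    have h2' : gaussCoeff q (i + 1) j * (qFactorial q (i + 1) * qFactorial q j) =
      qFactorial q (i + j + 1) := by rw [h2]; congr 1; ring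
    rw [qFactorial_succ] at h1' h2'
    rw [qFactorial_succ q i, qFactorial_succ q j]
    linear_combination (q ^ (j + 1) * ∑ s ∈ Finset.range (i + 1), q ^ s) * h1' +
      (∑ s ∈ Finset.range (j + 1), q ^ s) * h2'

theorem pow_mul_of_qcomm {q : k} {a b : B} (h : b * a = q • (a * b)) (j : ℕ) :
    b ^ j * a = q ^ j • (a * b ^ j) := by
  induction j with
  | zero => simp
  | succ j ih =>
    rw [pow_succ, mul_assoc, h, mul_smul_comm, ← mul_assoc, ih, smul_mul_assoc, smul_smul,
      mul_assoc, ← pow_succ, ← pow_succ', pow_succ]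

theorem qbinomial {q : k} {a b : B} (h : b * a = q • (a * b)) (m : ℕ) :
    (a + b) ^ m = ∑ p ∈ Finset.HasAntidiagonal.antidiagonal m, gaussCoeff q p.1 p.2 • (a ^ p.1 * b ^ p.2) := by
  induction m with
  | zero => simp [gaussCoeff_zero_left]
  | succ m ih =>
    let H1 : ℕ → ℕ → k := fun i j => i.casesOn 0 (fun i => q ^ j * gaussCoeff q i j)
    let H2 : ℕ → ℕ → k := fun i j => j.casesOn 0 (fun j => gaussCoeff q i j)
    have hG : ∀ p ∈ Finset.HasAntidiagonal.antidiagonal (m + 1),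
        gaussCoeff q p.1 p.2 • (a ^ p.1 * b ^ p.2) =
          H1 p.1 p.2 • (a ^ p.1 * b ^ p.2) + H2 p.1 p.2 • (a ^ p.1 * b ^ p.2) := by
      rintro ⟨i, j⟩ hp
      rw [← add_smul]
      congr 1
      rcases i with _ | i <;> rcases j with _ | j
      · simp at hp
      · simp [H1, H2, gaussCoeff_zero_left]
      · simp [H1, H2, gaussCoeff_zero_right]
      · simp only [H1, H2]; rw [gaussCoeff]
    rw [Finset.sum_congr rfl hG, Finset.sum_add_distrib, Finset.Nat.sum_antidiagonal_succ,
      Finset.Nat.sum_antidiagonal_succ', pow_succ, ih, mul_add, Finset.sum_mul, Finset.sum_mul]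
    have h10 : H1 0 (m + 1) = 0 := rfl
    have h20 : H2 (m + 1) 0 = 0 := rfl
    have h1s : ∀ i j, H1 (i + 1) j = q ^ j * gaussCoeff q i j := fun _ _ => rfl
    have h2s : ∀ i j, H2 i (j + 1) = gaussCoeff q i j := fun _ _ => rfl
    simp only [h10, h20, h1s, h2s, zero_smul, zero_add]
    congr 1
    · refine Finset.sum_congr rfl fun p _ => ?_
      rw [smul_mul_assoc, mul_assoc, pow_mul_of_qcomm h, mul_smul_comm, smul_smul, ← mul_assoc,
        ← pow_succ, mul_comm]
    · refine Finset.sum_congr rfl fun p _ => ?_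
      rw [smul_mul_assoc, mul_assoc, ← pow_succ]

theorem add_pow_of_primitiveRoot {q : k} {ℓ : ℕ} (hℓ : ℓ ≠ 0) (hq : IsPrimitiveRoot q ℓ) {a b : B}
    (h : b * a = q • (a * b)) : (a + b) ^ ℓ = a ^ ℓ + b ^ ℓ := by
  obtain ⟨m, rfl⟩ := Nat.exists_eq_succ_of_ne_zero hℓ
  rw [qbinomial h, Finset.Nat.antidiagonal_succ]
  have hfac : ∀ t, t < m + 1 → qFactorial q t ≠ 0 := by
    intro t ht
    rw [qFactorial, Finset.prod_ne_zero_iff]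
    intro s hs h0
    have hs' : s + 1 < m + 1 := by have := Finset.mem_range.1 hs; omega
    have := mul_geom_sum q (s + 1)
    rw [h0, mul_zero] at this
    exact hq.pow_ne_one_of_pos_of_lt (Nat.succ_ne_zero s) hs' (sub_eq_zero.1 this.symm)
  have hz : ∀ i j, i + 1 + (j + 1) = m + 1 → gaussCoeff q (i + 1) (j + 1) = 0 := by
    intro i j hij
    have h1 := gaussCoeff_mul q (i + 1) (j + 1)
    rw [hij, qFactorial_succ q m, hq.geom_sum_eq_zero (by omega), mul_zero] at h1
    exact (mul_eq_zero.1 h1).resolve_right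
      (mul_ne_zero (hfac _ (by omega)) (hfac _ (by omega)))
  rw [Finset.sum_cons, Finset.sum_map]
  rcases m with _ | m
  · simp [gaussCoeff, add_comm]
  · rw [Finset.Nat.antidiagonal_succ', Finset.sum_cons, Finset.sum_map, Finset.sum_eq_zero]
    · simp [gaussCoeff_zero_left, gaussCoeff_zero_right, add_comm]
    · rintro ⟨i, j⟩ hp
      have := Finset.HasAntidiagonal.mem_antidiagonal.1 hp
      change gaussCoeff q (i + 1) (j + 1) • _ = 0
      rw [hz i j (by simp at this; omega), zero_smul]

end QBinomial


section Taft

/-- `α * β = ∑_{j} ∑_{i > j} α_i β_j` on `Λ = ℤⁿ`. -/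
def starForm {n : ℕ} (α β : Fin n → ℤ) : ℤ := ∑ j, ∑ i ∈ Finset.Ioi j, α i * β j

/-- The skew bicharacter `θ(α, β) = q ^ (α * β - β * α)`. -/
def skewBichar {k : Type*} [Field k] {n : ℕ} (q : k) (α β : Fin n → ℤ) : k :=
  q ^ (starForm α β - starForm β α)

/-- The standard basis vector `ε_i` of `Λ = ℤⁿ`. -/
def basisVec {n : ℕ} (i : Fin n) : Fin n → ℤ := Pi.single i 1

/-- The generators `K(ε_i)`, `K(ε_i)⁻¹`, `x_i`. -/
inductive TaftGen (n : ℕ) : Type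
  | K (i : Fin n)
  | Kinv (i : Fin n)
  | x (i : Fin n)

section Defs
variable {k : Type*} [Field k] {n : ℕ} (q : k) (ℓ : ℕ)

/-- The defining relations of the `n`-rank Taft algebra, for a family `f` of elements indexed by the
generators: the `K(ε_i)` commute, are invertible and satisfy `K(ε_i)^ℓ = 1`,
`K(ε_i) x_j K(ε_i)⁻¹ = θ(ε_i, ε_j) q^{δ_ij} x_j`, `x_i x_j = θ(ε_i, ε_j) x_j x_i`, `x_i^ℓ = 0`. -/
structure TaftRelations {B : Type*} [Semiring B] [Algebra k B] (f : TaftGen n → B) : Prop where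
  K_comm (i j : Fin n) : f (.K i) * f (.K j) = f (.K j) * f (.K i)
  K_mul_Kinv (i : Fin n) : f (.K i) * f (.Kinv i) = 1
  Kinv_mul_K (i : Fin n) : f (.Kinv i) * f (.K i) = 1
  K_pow (i : Fin n) : f (.K i) ^ ℓ = 1
  conj_x (i j : Fin n) : f (.K i) * f (.x j) * f (.Kinv i) =
    (skewBichar q (basisVec i) (basisVec j) * q ^ (if i = j then 1 else 0)) • f (.x j)
  x_comm (i j : Fin n) :
    f (.x i) * f (.x j) = skewBichar q (basisVec i) (basisVec j) • (f (.x j) * f (.x i))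
  x_pow (i : Fin n) : f (.x i) ^ ℓ = 0

variable (n) in
open FreeAlgebra in
/-- The same relations in the free algebra on the generators. -/
inductive TaftRel : FreeAlgebra k (TaftGen n) → FreeAlgebra k (TaftGen n) → Prop
  | K_comm (i j : Fin n) : TaftRel (ι k (.K i) * ι k (.K j)) (ι k (.K j) * ι k (.K i))
  | K_mul_Kinv (i : Fin n) : TaftRel (ι k (.K i) * ι k (.Kinv i)) 1
  | Kinv_mul_K (i : Fin n) : TaftRel (ι k (.Kinv i) * ι k (.K i)) 1
  | K_pow (i : Fin n) : TaftRel (ι k (.K i) ^ ℓ) 1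
  | conj_x (i j : Fin n) : TaftRel (ι k (.K i) * ι k (.x j) * ι k (.Kinv i))
      ((skewBichar q (basisVec i) (basisVec j) * q ^ (if i = j then 1 else 0)) • ι k (.x j))
  | x_comm (i j : Fin n) : TaftRel (ι k (.x i) * ι k (.x j))
      (skewBichar q (basisVec i) (basisVec j) • (ι k (.x j) * ι k (.x i)))
  | x_pow (i : Fin n) : TaftRel (ι k (.x i) ^ ℓ) 0

variable (n) in
/-- The `n`-rank Taft algebra `Ā_q(n)`. -/
def TaftAlgebra : Type _ := RingQuot (TaftRel n q ℓ)

end Defs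

namespace TaftAlgebra

variable {k : Type*} [Field k] {n : ℕ} {q : k} {ℓ : ℕ}

instance : Ring (TaftAlgebra n q ℓ) := inferInstanceAs (Ring (RingQuot (TaftRel n q ℓ)))
instance : Algebra k (TaftAlgebra n q ℓ) :=
  inferInstanceAs (Algebra k (RingQuot (TaftRel n q ℓ)))

variable (n q ℓ) in
/-- The projection from the free algebra. -/
def proj : FreeAlgebra k (TaftGen n) →ₐ[k] TaftAlgebra n q ℓ :=
  RingQuot.mkAlgHom k (TaftRel n q ℓ)

variable (q ℓ) in
/-- The generators of `Ā_q(n)`. -/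
def gen (g : TaftGen n) : TaftAlgebra n q ℓ := proj n q ℓ (FreeAlgebra.ι k g)

theorem proj_surjective : Function.Surjective (proj n q ℓ) :=
  RingQuot.mkAlgHom_surjective k (TaftRel n q ℓ)

theorem gen_relations : TaftRelations q ℓ (gen (n := n) q ℓ) := by
  have h : ∀ {a b}, TaftRel n q ℓ a b → proj n q ℓ a = proj n q ℓ b :=
    fun h => RingQuot.mkAlgHom_rel k h
  constructor <;> intros <;> simp only [gen, ← map_mul, ← map_pow, ← map_smul, ← map_one (proj n q ℓ), ← map_zero (proj n q ℓ)] <;>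
    apply h <;> constructor

variable {B : Type*} [Ring B] [Algebra k B]

/-- The universal property of `Ā_q(n)`. -/
def lift (f : TaftGen n → B) (hf : TaftRelations q ℓ f) : TaftAlgebra n q ℓ →ₐ[k] B :=
  RingQuot.liftAlgHom k ⟨FreeAlgebra.lift k f, fun a b h => by
    induction h with
    | K_comm i j => simpa using hf.K_comm i j
    | K_mul_Kinv i => simpa using hf.K_mul_Kinv i
    | Kinv_mul_K i => simpa using hf.Kinv_mul_K i
    | K_pow i => simpa using hf.K_pow i
    | conj_x i j => simpa only [map_mul, map_smul, FreeAlgebra.lift_ι_apply] using hf.conj_x i j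
    | x_comm i j => simpa only [map_mul, map_smul, FreeAlgebra.lift_ι_apply] using hf.x_comm i j
    | x_pow i => simpa using hf.x_pow i⟩

theorem lift_gen (f : TaftGen n → B) (hf : TaftRelations q ℓ f) (g : TaftGen n) :
    lift f hf (gen q ℓ g) = f g :=
  (RingQuot.liftAlgHom_mkAlgHom_apply k _ _ _).trans (FreeAlgebra.lift_ι_apply _ _)

theorem hom_ext {f g : TaftAlgebra n q ℓ →ₐ[k] B} (h : ∀ a, f (gen q ℓ a) = g (gen q ℓ a)) :
    f = g :=
  RingQuot.ringQuot_ext' k f g (FreeAlgebra.hom_ext (funext h))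

theorem induction {P : TaftAlgebra n q ℓ → Prop} (h0 : ∀ r, P (algebraMap k _ r))
    (h1 : ∀ g, P (gen q ℓ g)) (hm : ∀ a b, P a → P b → P (a * b))
    (ha : ∀ a b, P a → P b → P (a + b)) (a : TaftAlgebra n q ℓ) : P a := by
  obtain ⟨b, rfl⟩ := proj_surjective a
  induction b using FreeAlgebra.induction with
  | grade0 r => simpa using h0 r
  | grade1 x => exact h1 x
  | mul a b ha hb => rw [map_mul]; exact hm _ _ ha hb
  | add a b ha' hb => rw [map_add]; exact ha _ _ ha' hb

section Hopf

open TensorProduct Coalgebra Bialgebra HopfAlgebra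

theorem starForm_basisVec {n : ℕ} (i : Fin n) : starForm (basisVec i) (basisVec i) = 0 := by
  refine Finset.sum_eq_zero fun j _ => Finset.sum_eq_zero fun l hl => ?_
  have hlj : j < l := Finset.mem_Ioi.1 hl
  by_cases h : l = i
  · have : j ≠ i := by rintro rfl; exact absurd h hlj.ne'
    simp [basisVec, Pi.single_apply, this]
  · simp [basisVec, Pi.single_apply, h]

theorem skewBichar_self (i : Fin n) : skewBichar q (basisVec i) (basisVec i) = 1 := by
  simp [skewBichar]

theorem skewBichar_mul_swap (hq : q ≠ 0) (α β : Fin n → ℤ) :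
    skewBichar q α β * skewBichar q β α = 1 := by
  rw [skewBichar, skewBichar, ← zpow_add₀ hq]; simp

theorem K_mul_x (i j : Fin n) : gen q ℓ (.K i) * gen q ℓ (.x j) =
    (skewBichar q (basisVec i) (basisVec j) * q ^ (if i = j then 1 else 0)) •
      (gen q ℓ (.x j) * gen q ℓ (.K i)) := by
  rw [← smul_mul_assoc, ← gen_relations.conj_x, mul_assoc, mul_assoc, gen_relations.Kinv_mul_K,
    mul_one]

theorem x_mul_Kinv (i j : Fin n) : gen q ℓ (.x j) * gen q ℓ (.Kinv i) =
    (skewBichar q (basisVec i) (basisVec j) * q ^ (if i = j then 1 else 0)) •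
      (gen q ℓ (.Kinv i) * gen q ℓ (.x j)) := by
  rw [← mul_smul_comm, ← gen_relations.conj_x, ← mul_assoc, ← mul_assoc, gen_relations.Kinv_mul_K,
    one_mul]

theorem commute_K_Kinv (i j : Fin n) : Commute (gen q ℓ (.K i)) (gen q ℓ (.Kinv j)) := by
  have h : Commute (gen q ℓ (.K i)) (gen q ℓ (.K j)) := gen_relations.K_comm i j
  have hu : ∃ u : (TaftAlgebra n q ℓ)ˣ, (u : TaftAlgebra n q ℓ) = gen q ℓ (.K j) ∧
      ((u⁻¹ : (TaftAlgebra n q ℓ)ˣ) : TaftAlgebra n q ℓ) = gen q ℓ (.Kinv j) :=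
    ⟨⟨_, _, gen_relations.K_mul_Kinv j, gen_relations.Kinv_mul_K j⟩, rfl, rfl⟩
  obtain ⟨u, hu1, hu2⟩ := hu
  rw [← hu2]; rw [← hu1] at h
  exact h.units_inv_right

theorem commute_Kinv_Kinv (i j : Fin n) : Commute (gen q ℓ (.Kinv i)) (gen q ℓ (.Kinv j)) := by
  have h : Commute (gen q ℓ (.Kinv j)) (gen q ℓ (.K i)) := (commute_K_Kinv i j).symm
  have hu : ∃ u : (TaftAlgebra n q ℓ)ˣ, (u : TaftAlgebra n q ℓ) = gen q ℓ (.K i) ∧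
      ((u⁻¹ : (TaftAlgebra n q ℓ)ˣ) : TaftAlgebra n q ℓ) = gen q ℓ (.Kinv i) :=
    ⟨⟨_, _, gen_relations.K_mul_Kinv i, gen_relations.Kinv_mul_K i⟩, rfl, rfl⟩
  obtain ⟨u, hu1, hu2⟩ := hu
  rw [← hu2]; rw [← hu1] at h
  exact h.units_inv_right.symm

variable [hqℓ : Fact (IsPrimitiveRoot q ℓ)] [hℓ : NeZero ℓ]

theorem q_ne_zero (q : k) (ℓ : ℕ) [hqℓ : Fact (IsPrimitiveRoot q ℓ)] [hℓ : NeZero ℓ] : q ≠ 0 :=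
  hqℓ.out.ne_zero hℓ.out

/-- The values of the comultiplication on the generators. -/
noncomputable def comulGen (q : k) (ℓ : ℕ) :
    TaftGen n → TaftAlgebra n q ℓ ⊗[k] TaftAlgebra n q ℓ
  | .K i => gen q ℓ (.K i) ⊗ₜ gen q ℓ (.K i)
  | .Kinv i => gen q ℓ (.Kinv i) ⊗ₜ gen q ℓ (.Kinv i)
  | .x i => gen q ℓ (.x i) ⊗ₜ 1 + gen q ℓ (.K i) ⊗ₜ gen q ℓ (.x i)

theorem comulGen_relations : TaftRelations q ℓ (comulGen (n := n) q ℓ) where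
  K_comm i j := by simp [comulGen, gen_relations.K_comm i j]
  K_mul_Kinv i := by simp [comulGen, gen_relations.K_mul_Kinv, Algebra.TensorProduct.one_def]
  Kinv_mul_K i := by simp [comulGen, gen_relations.Kinv_mul_K, Algebra.TensorProduct.one_def]
  K_pow i := by simp [comulGen, gen_relations.K_pow, Algebra.TensorProduct.one_def]
  conj_x i j := by
    simp only [comulGen, mul_add, add_mul, Algebra.TensorProduct.tmul_mul_tmul,
      gen_relations.conj_x, mul_one, gen_relations.K_mul_Kinv, smul_add]
    rw [gen_relations.K_comm i j, mul_assoc (gen q ℓ (.K j)), gen_relations.K_mul_Kinv, mul_one]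
    simp only [TensorProduct.tmul_smul, ← TensorProduct.smul_tmul']
  x_comm i j := by
    by_cases hij : i = j
    · subst hij; rw [skewBichar_self, one_smul]
    · have h := skewBichar_mul_swap (q_ne_zero q ℓ) (basisVec i) (basisVec j)
      simp only [comulGen, mul_add, add_mul, Algebra.TensorProduct.tmul_mul_tmul, mul_one,
        one_mul, smul_add]
      rw [gen_relations.x_comm i j, gen_relations.K_comm i j, K_mul_x i j, K_mul_x j i]
      simp only [if_neg hij, if_neg (Ne.symm hij), pow_zero, mul_one, ← TensorProduct.smul_tmul',
        TensorProduct.tmul_smul, smul_smul, h, one_smul]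
      abel
  x_pow i := by
    rw [comulGen, add_pow_of_primitiveRoot hℓ.out hqℓ.out, Algebra.TensorProduct.tmul_pow,
      Algebra.TensorProduct.tmul_pow, gen_relations.x_pow, TensorProduct.zero_tmul,
      TensorProduct.tmul_zero, add_zero]
    rw [Algebra.TensorProduct.tmul_mul_tmul, Algebra.TensorProduct.tmul_mul_tmul, K_mul_x,
      skewBichar_self]
    simp [TensorProduct.smul_tmul']

/-- The values of the counit on the generators. -/
def counitGen (k : Type*) [Field k] : TaftGen n → k
  | .K _ => 1
  | .Kinv _ => 1
  | .x _ => 0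

theorem counitGen_relations : TaftRelations q ℓ (counitGen (n := n) k) where
  K_comm i j := by simp [counitGen]
  K_mul_Kinv i := by simp [counitGen]
  Kinv_mul_K i := by simp [counitGen]
  K_pow i := by simp [counitGen]
  conj_x i j := by simp [counitGen]
  x_comm i j := by simp [counitGen]
  x_pow i := by simp [counitGen, hℓ.out]

/-- `Δ(K(ε_i)^{±1}) = K(ε_i)^{±1} ⊗ K(ε_i)^{±1}`, `Δ(x_i) = x_i ⊗ 1 + K(ε_i) ⊗ x_i`,
`ε(K(ε_i)^{±1}) = 1`, `ε(x_i) = 0`. -/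
noncomputable instance : Bialgebra k (TaftAlgebra n q ℓ) :=
  Bialgebra.ofAlgHom (lift (comulGen q ℓ) comulGen_relations)
    (lift (counitGen k) counitGen_relations)
    (hom_ext fun a => by
      cases a <;> simp [lift_gen, comulGen, TensorProduct.add_tmul, TensorProduct.tmul_add,
        Algebra.TensorProduct.one_def, add_assoc])
    (hom_ext fun a => by
      cases a <;> simp [lift_gen, comulGen, counitGen])
    (hom_ext fun a => by
      cases a <;> simp [lift_gen, comulGen, counitGen])

theorem comul_gen (g : TaftGen n) : comul (R := k) (gen q ℓ g) = comulGen q ℓ g :=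
  lift_gen _ comulGen_relations g

theorem counit_gen (g : TaftGen n) : counit (R := k) (gen q ℓ g) = counitGen k g :=
  lift_gen _ counitGen_relations g

theorem mul_pow_of_qcomm {B : Type*} [Ring B] [Algebra k B] {r : k} {a b : B}
    (h : b * a = r • (a * b)) (m : ℕ) : ∃ c : k, (a * b) ^ m = c • (a ^ m * b ^ m) := by
  induction m with
  | zero => exact ⟨1, by simp⟩
  | succ m ih =>
    obtain ⟨c, hc⟩ := ih
    refine ⟨c * r ^ m, ?_⟩
    rw [pow_succ, hc, smul_mul_assoc, mul_assoc, ← mul_assoc (b ^ m), pow_mul_of_qcomm h,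
      smul_mul_assoc, mul_smul_comm, smul_smul, mul_assoc a, ← pow_succ, ← mul_assoc, ← pow_succ]

open MulOpposite in
/-- The values of the antipode on the generators. -/
def antipodeGen (q : k) (ℓ : ℕ) : TaftGen n → (TaftAlgebra n q ℓ)ᵐᵒᵖ
  | .K i => op (gen q ℓ (.Kinv i))
  | .Kinv i => op (gen q ℓ (.K i))
  | .x i => op (-(gen q ℓ (.Kinv i) * gen q ℓ (.x i)))

open MulOpposite in
theorem antipodeGen_relations : TaftRelations q ℓ (antipodeGen (n := n) q ℓ) where
  K_comm i j := congrArg op (commute_Kinv_Kinv j i)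
  K_mul_Kinv i := congrArg op (gen_relations.K_mul_Kinv i)
  Kinv_mul_K i := congrArg op (gen_relations.Kinv_mul_K i)
  K_pow i := by
    refine congrArg op ?_
    have h := (commute_K_Kinv (q := q) (ℓ := ℓ) i i).mul_pow ℓ
    rw [gen_relations.K_mul_Kinv, gen_relations.K_pow, one_pow, one_mul] at h
    exact h.symm
  conj_x i j := by
    refine congrArg op ?_
    change gen q ℓ (.K i) * (-(gen q ℓ (.Kinv j) * gen q ℓ (.x j)) * gen q ℓ (.Kinv i)) =
      (skewBichar q (basisVec i) (basisVec j) * q ^ (if i = j then 1 else 0)) •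
        -(gen q ℓ (.Kinv j) * gen q ℓ (.x j))
    have h := gen_relations.conj_x (q := q) (ℓ := ℓ) i j
    rw [smul_neg, ← mul_smul_comm, ← h]
    simp only [neg_mul, mul_neg, ← mul_assoc, (commute_K_Kinv i j).eq]
  x_comm i j := by
    refine congrArg op ?_
    change -(gen q ℓ (.Kinv j) * gen q ℓ (.x j)) * -(gen q ℓ (.Kinv i) * gen q ℓ (.x i)) =
      skewBichar q (basisVec i) (basisVec j) •
        (-(gen q ℓ (.Kinv i) * gen q ℓ (.x i)) * -(gen q ℓ (.Kinv j) * gen q ℓ (.x j)))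
    by_cases hij : i = j
    · subst hij; rw [skewBichar_self, one_smul]
    · have h := skewBichar_mul_swap (q_ne_zero q ℓ) (basisVec i) (basisVec j)
      have e1 := x_mul_Kinv (q := q) (ℓ := ℓ) i j
      have e2 := x_mul_Kinv (q := q) (ℓ := ℓ) j i
      rw [if_neg hij, pow_zero, mul_one] at e1
      rw [if_neg (Ne.symm hij), pow_zero, mul_one] at e2
      have e3 := gen_relations.x_comm (q := q) (ℓ := ℓ) i j
      rw [neg_mul_neg, neg_mul_neg, mul_assoc, ← mul_assoc (gen q ℓ (.x j)), e1, mul_assoc,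
        ← mul_assoc (gen q ℓ (.x i)), e2]
      simp only [smul_mul_assoc, mul_smul_comm, mul_assoc, e3, smul_smul]
      simp only [← mul_assoc, (commute_Kinv_Kinv i j).eq]
      rw [h, one_mul]
  x_pow i := by
    refine congrArg op ?_
    obtain ⟨c, hc⟩ := mul_pow_of_qcomm (x_mul_Kinv (q := q) (ℓ := ℓ) i i) ℓ
    change (-(gen q ℓ (.Kinv i) * gen q ℓ (.x i))) ^ ℓ = 0
    rw [neg_pow, hc, gen_relations.x_pow, mul_zero, smul_zero, mul_zero]

/-- The antipode, as an algebra map to the opposite algebra. -/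
noncomputable def antipodeHom : TaftAlgebra n q ℓ →ₐ[k] (TaftAlgebra n q ℓ)ᵐᵒᵖ :=
  lift (antipodeGen q ℓ) antipodeGen_relations

/-- The antipode, as a linear map. -/
noncomputable def antipodeLin : TaftAlgebra n q ℓ →ₗ[k] TaftAlgebra n q ℓ :=
  (MulOpposite.opLinearEquiv k).symm.toLinearMap ∘ₗ antipodeHom.toLinearMap

theorem antipodeLin_mul (a b : TaftAlgebra n q ℓ) :
    antipodeLin (a * b) = antipodeLin b * antipodeLin a := by
  simp [antipodeLin]

theorem antipodeLin_algebraMap (r : k) :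
    antipodeLin (algebraMap k (TaftAlgebra n q ℓ) r) = algebraMap k _ r := by
  simp [antipodeLin]

theorem antipodeLin_gen (g : TaftGen n) :
    antipodeLin (gen q ℓ g) = (antipodeGen q ℓ g).unop := by
  simp [antipodeLin, antipodeHom, lift_gen]

theorem antipodeLin_one : antipodeLin (1 : TaftAlgebra n q ℓ) = 1 := by
  simpa using antipodeLin_algebraMap (n := n) (q := q) (ℓ := ℓ) 1

theorem antipodeLin_left (a : TaftAlgebra n q ℓ) :
    LinearMap.mul' k _ (antipodeLin.rTensor _ (comul a)) = algebraMap k _ (counit a) := by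
  induction a using induction with
  | h0 r => simp [antipodeLin_one, Algebra.TensorProduct.one_def, Algebra.algebraMap_eq_smul_one]
  | h1 g =>
    rw [comul_gen, counit_gen]
    cases g <;> simp [comulGen, counitGen, antipodeLin_gen, antipodeGen, gen_relations.K_mul_Kinv,
      gen_relations.Kinv_mul_K]
  | hm a b ha hb =>
    have e : ∀ U T : TaftAlgebra n q ℓ ⊗[k] TaftAlgebra n q ℓ, ∀ r : k,
        LinearMap.mul' k _ (antipodeLin.rTensor _ U) = algebraMap k _ r →
        LinearMap.mul' k _ (antipodeLin.rTensor _ (U * T)) =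
          r • LinearMap.mul' k _ (antipodeLin.rTensor _ T) := by
      intro U T r hU
      induction T with
      | zero => simp
      | add x y hx hy => rw [mul_add, map_add, map_add, hx, hy, map_add, map_add, smul_add]
      | tmul c d =>
        have : LinearMap.mul' k _ (antipodeLin.rTensor _ (U * c ⊗ₜ[k] d)) =
            antipodeLin c * LinearMap.mul' k _ (antipodeLin.rTensor _ U) * d := by
          clear hU
          induction U with
          | zero => simp
          | add x y hx hy => simp only [add_mul, map_add, hx, hy, mul_add]
          | tmul x y => simp [antipodeLin_mul, mul_assoc]
        rw [this, hU, Algebra.algebraMap_eq_smul_one]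
        simp
    rw [Bialgebra.comul_mul, e _ _ _ ha, hb, Bialgebra.counit_mul, map_mul, Algebra.smul_def]
  | ha a b ha hb => simp only [map_add, ha, hb]

theorem antipodeLin_right (a : TaftAlgebra n q ℓ) :
    LinearMap.mul' k _ (antipodeLin.lTensor _ (comul a)) = algebraMap k _ (counit a) := by
  induction a using induction with
  | h0 r => simp [antipodeLin_one, Algebra.TensorProduct.one_def, Algebra.algebraMap_eq_smul_one]
  | h1 g =>
    rw [comul_gen, counit_gen]
    cases g <;> simp [comulGen, counitGen, antipodeLin_gen, antipodeGen, gen_relations.K_mul_Kinv,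
      gen_relations.Kinv_mul_K, antipodeLin_one, ← mul_assoc]
  | hm a b ha hb =>
    have e : ∀ T U : TaftAlgebra n q ℓ ⊗[k] TaftAlgebra n q ℓ, ∀ r : k,
        LinearMap.mul' k _ (antipodeLin.lTensor _ T) = algebraMap k _ r →
        LinearMap.mul' k _ (antipodeLin.lTensor _ (U * T)) =
          r • LinearMap.mul' k _ (antipodeLin.lTensor _ U) := by
      intro T U r hT
      induction U with
      | zero => simp
      | add x y hx hy => rw [add_mul, map_add, map_add, hx, hy, map_add, map_add, smul_add]
      | tmul c d =>
        have : LinearMap.mul' k _ (antipodeLin.lTensor _ (c ⊗ₜ[k] d * T)) =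
            c * LinearMap.mul' k _ (antipodeLin.lTensor _ T) * antipodeLin d := by
          clear hT
          induction T with
          | zero => simp
          | add x y hx hy => simp only [add_mul, map_add, hx, hy, mul_add]
          | tmul x y => simp [antipodeLin_mul, mul_assoc]
        rw [this, hT, Algebra.algebraMap_eq_smul_one]
        simp
    rw [Bialgebra.comul_mul, e _ _ _ hb, ha, Bialgebra.counit_mul, map_mul,
      Algebra.smul_def, Algebra.commutes]
  | ha a b ha hb => simp only [map_add, ha, hb]

/-- `s(K(ε_i)^{±1}) = K(ε_i)^{∓1}`, `s(x_i) = -K(ε_i)⁻¹ x_i`. -/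
noncomputable instance : HopfAlgebra k (TaftAlgebra n q ℓ) where
  antipode := antipodeLin
  mul_antipode_rTensor_comul := LinearMap.ext antipodeLin_left
  mul_antipode_lTensor_comul := LinearMap.ext antipodeLin_right

end Hopf

section Instances

open HopfAlgebra

variable [hqℓ : Fact (IsPrimitiveRoot q ℓ)] [hℓ : NeZero ℓ]

/-- The algebra map which fixes every `K(ε_i)` and multiplies every `x_i` by `c`. -/
noncomputable def scale (c : k) : TaftAlgebra n q ℓ →ₐ[k] TaftAlgebra n q ℓ :=
  lift (fun | .K i => gen q ℓ (.K i) | .Kinv i => gen q ℓ (.Kinv i) | .x i => c • gen q ℓ (.x i))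
    { K_comm := gen_relations.K_comm
      K_mul_Kinv := gen_relations.K_mul_Kinv
      Kinv_mul_K := gen_relations.Kinv_mul_K
      K_pow := gen_relations.K_pow
      conj_x := fun i j => by
        simp only [mul_smul_comm, smul_mul_assoc, gen_relations.conj_x]
        rw [smul_comm]
      x_comm := fun i j => by
        simp only [mul_smul_comm, smul_mul_assoc, gen_relations.x_comm i j, smul_smul]
        congr 1; ring
      x_pow := fun i => by simp [smul_pow, gen_relations.x_pow] }

theorem antipodeLin_antipodeLin (a : TaftAlgebra n q ℓ) :
    antipodeLin (antipodeLin a) = scale q⁻¹ a := by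
  induction a using induction with
  | h0 r => simp [antipodeLin_algebraMap]
  | h1 g =>
    rw [scale, lift_gen]
    cases g with
    | K i => simp [antipodeLin_gen, antipodeGen]
    | Kinv i => simp [antipodeLin_gen, antipodeGen]
    | x i =>
      have h := K_mul_x (q := q) (ℓ := ℓ) i i
      rw [skewBichar_self, one_mul, if_pos rfl, pow_one] at h
      have h2 : gen q ℓ (.x i) * gen q ℓ (.K i) = q⁻¹ • (gen q ℓ (.K i) * gen q ℓ (.x i)) := by
        rw [h, smul_smul, inv_mul_cancel₀ (q_ne_zero q ℓ), one_smul]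
      simp only [antipodeLin_gen, antipodeGen, MulOpposite.unop_op, map_neg, antipodeLin_mul,
        neg_mul, neg_neg]
      rw [mul_assoc, h2, mul_smul_comm, ← mul_assoc, gen_relations.Kinv_mul_K, one_mul]
  | hm a b ha hb => rw [antipodeLin_mul, antipodeLin_mul, ha, hb, map_mul]
  | ha a b ha hb => simp only [map_add, ha, hb]

theorem scale_scale (c d : k) (a : TaftAlgebra n q ℓ) : scale c (scale d a) = scale (c * d) a := by
  have : (scale c).comp (scale d) = scale (n := n) (q := q) (ℓ := ℓ) (c * d) :=
    hom_ext fun g => by cases g <;> simp [scale, lift_gen, smul_smul, mul_comm]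
  exact DFunLike.congr_fun this a

theorem scale_one (a : TaftAlgebra n q ℓ) : scale 1 a = a := by
  have : scale 1 = AlgHom.id k (TaftAlgebra n q ℓ) :=
    hom_ext fun g => by cases g <;> simp [scale, lift_gen]
  exact DFunLike.congr_fun this a

instance : HasBijectiveAntipode k (TaftAlgebra n q ℓ) where
  bijective := by
    have h : ∀ a : TaftAlgebra n q ℓ, antipode k (antipode k a) = scale q⁻¹ a :=
      antipodeLin_antipodeLin
    have hq := q_ne_zero q ℓ
    constructor
    · intro a b hab
      have := congrArg (scale q) ((h a).symm.trans ((congrArg (antipode k) hab).trans (h b)))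
      rwa [scale_scale, scale_scale, mul_inv_cancel₀ hq, scale_one, scale_one] at this
    · intro a
      exact ⟨antipode k (scale q a), by rw [h, scale_scale, inv_mul_cancel₀ hq, scale_one]⟩

theorem adjoin_prod_stable {B : Type*} [Ring B] [Algebra k B] (S : Set B)
    (hS : ∀ a ∈ S, ∀ b ∈ S, ∃ c : k, a * b = c • (b * a)) (L : List B) (hL : ∀ b ∈ L, b ∈ S)
    (a : B) (ha : a ∈ L) (y : B)
    (hy : y ∈ (L.map fun b => (Algebra.adjoin k {b}).toSubmodule).prod) :
    a * y ∈ (L.map fun b => (Algebra.adjoin k {b}).toSubmodule).prod := by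
  induction L generalizing y with
  | nil => simp at ha
  | cons b L ih =>
    simp only [List.map_cons, List.prod_cons] at hy ⊢
    rcases List.mem_cons.1 ha with rfl | ha'
    · refine Submodule.mul_induction_on hy (fun u hu v hv => ?_) (fun u v hu hv => ?_)
      · rw [← mul_assoc]
        exact Submodule.mul_mem_mul
          ((Algebra.adjoin k {a}).mul_mem (Algebra.self_mem_adjoin_singleton k a) hu) hv
      · rw [mul_add]; exact Submodule.add_mem _ hu hv
    · have hc : ∃ c : k, a * b = c • (b * a) := hS a (hL a ha) b (hL b (by simp))
      obtain ⟨c, hc⟩ := hc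
      have key : ∀ u ∈ Algebra.adjoin k {b}, ∃ u' ∈ Algebra.adjoin k {b}, a * u = u' * a := by
        intro u hu
        induction hu using Algebra.adjoin_induction with
        | mem x hx =>
          rw [Set.mem_singleton_iff.1 hx]
          exact ⟨c • b, Subalgebra.smul_mem _ (Algebra.self_mem_adjoin_singleton k b) c, by
            rw [hc, smul_mul_assoc]⟩
        | algebraMap r =>
          exact ⟨_, Subalgebra.algebraMap_mem _ r, (Algebra.commutes r a).symm⟩
        | add x y _ _ hx hy =>
          obtain ⟨x', hx', ex⟩ := hx
          obtain ⟨y', hy', ey⟩ := hy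
          exact ⟨x' + y', add_mem hx' hy', by rw [mul_add, ex, ey, add_mul]⟩
        | mul x y _ _ hx hy =>
          obtain ⟨x', hx', ex⟩ := hx
          obtain ⟨y', hy', ey⟩ := hy
          exact ⟨x' * y', mul_mem hx' hy', by rw [← mul_assoc, ex, mul_assoc, ey, mul_assoc]⟩
      refine Submodule.mul_induction_on hy (fun u hu v hv => ?_) (fun u v hu hv => ?_)
      · obtain ⟨u', hu', e⟩ := key u hu
        rw [← mul_assoc, e, mul_assoc]
        exact Submodule.mul_mem_mul hu' (ih (fun x hx => hL x (by simp [hx])) ha' v hv)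
      · rw [mul_add]; exact Submodule.add_mem _ hu hv

theorem adjoin_prod_fg {B : Type*} [Ring B] [Algebra k B] (L : List B)
    (hL : ∀ b ∈ L, IsIntegral k b) :
    (L.map fun b => (Algebra.adjoin k {b}).toSubmodule).prod.FG ∧
      (1 : B) ∈ (L.map fun b => (Algebra.adjoin k {b}).toSubmodule).prod := by
  induction L with
  | nil => exact ⟨by simpa [Submodule.one_eq_span] using Submodule.fg_span_singleton (1 : B), by simp [Submodule.one_le.1 le_rfl]⟩
  | cons b L ih =>
    obtain ⟨h1, h2⟩ := ih fun x hx => hL x (by simp [hx])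
    simp only [List.map_cons, List.prod_cons]
    refine ⟨Submodule.FG.mul (hL b (by simp)).fg_adjoin_singleton h1, ?_⟩
    rw [← mul_one (1 : B)]
    exact Submodule.mul_mem_mul (Algebra.adjoin k {b}).one_mem h2

instance : Module.Finite k (TaftAlgebra n q ℓ) := by
  let L : List (TaftAlgebra n q ℓ) := List.ofFn (fun i : Fin n => gen q ℓ (.K i)) ++
    List.ofFn (fun i : Fin n => gen q ℓ (.x i))
  have memL : ∀ b, b ∈ L ↔ (∃ i, gen q ℓ (.K i) = b) ∨ ∃ i, gen q ℓ (.x i) = b := by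
    intro b; simp [L, List.mem_ofFn]
  have hint : ∀ b ∈ L, IsIntegral k b := by
    intro b hb
    rcases (memL b).1 hb with ⟨i, rfl⟩ | ⟨i, rfl⟩
    · refine IsIntegral.of_pow (Nat.pos_of_ne_zero hℓ.out) ?_
      rw [gen_relations.K_pow]; exact isIntegral_one
    · refine IsIntegral.of_pow (Nat.pos_of_ne_zero hℓ.out) ?_
      rw [gen_relations.x_pow]; exact isIntegral_zero
  have hq : ∀ a ∈ {b | b ∈ L}, ∀ b ∈ {b | b ∈ L}, ∃ c : k, a * b = c • (b * a) := by
    intro a ha b hb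
    rcases (memL a).1 ha with ⟨i, rfl⟩ | ⟨i, rfl⟩ <;> rcases (memL b).1 hb with ⟨j, rfl⟩ | ⟨j, rfl⟩
    · exact ⟨1, by rw [gen_relations.K_comm, one_smul]⟩
    · exact ⟨_, K_mul_x i j⟩
    · refine ⟨(skewBichar q (basisVec j) (basisVec i) * q ^ (if j = i then 1 else 0))⁻¹, ?_⟩
      have hne : skewBichar q (basisVec j) (basisVec i) * q ^ (if j = i then 1 else 0) ≠ 0 :=
        mul_ne_zero (zpow_ne_zero _ (q_ne_zero q ℓ)) (pow_ne_zero _ (q_ne_zero q ℓ))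
      rw [K_mul_x j i, smul_smul, inv_mul_cancel₀ hne, one_smul]
    · exact ⟨_, gen_relations.x_comm i j⟩
  obtain ⟨hfg, h1⟩ := adjoin_prod_fg L hint
  have hst := adjoin_prod_stable {b | b ∈ L} hq L (fun b hb => hb)
  generalize (L.map fun b => (Algebra.adjoin k {b}).toSubmodule).prod = W at hfg h1 hst
  have hpow : ∀ (b : TaftAlgebra n q ℓ), (∀ y ∈ W, b * y ∈ W) → ∀ m : ℕ, ∀ y ∈ W,
      b ^ m * y ∈ W := by
    intro b hb m
    induction m with
    | zero => intro y hy; simpa using hy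
    | succ m ih => intro y hy; rw [pow_succ, mul_assoc]; exact ih _ (hb y hy)
  have hall : ∀ a : TaftAlgebra n q ℓ, ∀ y ∈ W, a * y ∈ W := by
    intro a
    induction a using induction with
    | h0 r => intro y hy; rw [← Algebra.smul_def]; exact W.smul_mem r hy
    | h1 g =>
      cases g with
      | K i => exact hst _ ((memL _).2 (Or.inl ⟨i, rfl⟩))
      | x i => exact hst _ ((memL _).2 (Or.inr ⟨i, rfl⟩))
      | Kinv i =>
        have e : gen q ℓ (.Kinv i) = gen q ℓ (.K i) ^ (ℓ - 1) := by
          have h := gen_relations.K_pow (q := q) (ℓ := ℓ) i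
          calc gen q ℓ (.Kinv i) =
              gen q ℓ (.K i) ^ (ℓ - 1) * gen q ℓ (.K i) * gen q ℓ (.Kinv i) := by
                rw [← pow_succ, Nat.sub_add_cancel (Nat.pos_of_ne_zero hℓ.out), h, one_mul]
            _ = _ := by rw [mul_assoc, gen_relations.K_mul_Kinv, mul_one]
        rw [e]
        exact hpow _ (hst _ ((memL _).2 (Or.inl ⟨i, rfl⟩))) _
    | hm a b ha hb => intro y hy; rw [mul_assoc]; exact ha _ (hb y hy)
    | ha a b ha hb => intro y hy; rw [add_mul]; exact W.add_mem (ha y hy) (hb y hy)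
  have hW : W = ⊤ := Submodule.eq_top_iff'.2 fun a => by simpa using hall a 1 h1
  exact ⟨hW ▸ hfg⟩

end Instances

section GroupLike

/-- The generator `K(ε_i)` as an invertible element. -/
def KUnit (q : k) (ℓ : ℕ) (i : Fin n) : (TaftAlgebra n q ℓ)ˣ where
  val := gen q ℓ (.K i)
  inv := gen q ℓ (.Kinv i)
  val_inv := gen_relations.K_mul_Kinv i
  inv_val := gen_relations.Kinv_mul_K i

/-- The (commuting) product `K(α) = K(ε_1) ^ α_1 ⋯ K(ε_n) ^ α_n`, for `α ∈ Λ = ℤⁿ`. -/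
def K (q : k) (ℓ : ℕ) (α : Fin n → ℤ) : (TaftAlgebra n q ℓ)ˣ :=
  (List.ofFn fun i => KUnit q ℓ i ^ α i).prod

/-- The monomial `x ^ γ = x_1 ^ γ_1 ⋯ x_n ^ γ_n`. -/
def xMonomial (q : k) (ℓ : ℕ) (γ : Fin n → ℕ) : TaftAlgebra n q ℓ :=
  (List.ofFn fun i => gen q ℓ (.x i) ^ γ i).prod

variable [hqℓ : Fact (IsPrimitiveRoot q ℓ)] [hℓ : NeZero ℓ]

/-- The value `θ(ε_i, β) q ^ ⟨ε_i, β⟩` of `𝔎̃(β)` on `K(ε_i)`. -/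
def ktildeVal (q : k) (β : Fin n → ℤ) (i : Fin n) : k := skewBichar q (basisVec i) β * q ^ β i

theorem zpow_pow_order (m : ℤ) : (q ^ m) ^ ℓ = 1 := by
  rw [← zpow_natCast, zpow_comm, zpow_natCast, hqℓ.out.pow_eq_one, one_zpow]

theorem ktildeVal_ne_zero (β : Fin n → ℤ) (i : Fin n) (ℓ : ℕ) [hqℓ : Fact (IsPrimitiveRoot q ℓ)]
    [hℓ : NeZero ℓ] : ktildeVal q β i ≠ 0 :=
  mul_ne_zero (zpow_ne_zero _ (q_ne_zero q ℓ)) (zpow_ne_zero _ (q_ne_zero q ℓ))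

/-- The values of the character `𝔎̃(β)` on the generators. -/
def ktildeGen (q : k) (β : Fin n → ℤ) : TaftGen n → k
  | .K i => ktildeVal q β i
  | .Kinv i => (ktildeVal q β i)⁻¹
  | .x _ => 0

theorem ktildeGen_relations (β : Fin n → ℤ) : TaftRelations q ℓ (ktildeGen q β) where
  K_comm i j := mul_comm _ _
  K_mul_Kinv i := mul_inv_cancel₀ (ktildeVal_ne_zero β i ℓ)
  Kinv_mul_K i := inv_mul_cancel₀ (ktildeVal_ne_zero β i ℓ)
  K_pow i := by simp [ktildeGen, ktildeVal, skewBichar, mul_pow, zpow_pow_order]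
  conj_x i j := by simp [ktildeGen]
  x_comm i j := by simp [ktildeGen]
  x_pow i := by simp [ktildeGen, hℓ.out]

/-- The character `𝔎̃(β)` of the Taft algebra. -/
noncomputable def ktildeHom (q : k) (ℓ : ℕ) [hqℓ : Fact (IsPrimitiveRoot q ℓ)] [hℓ : NeZero ℓ]
    (β : Fin n → ℤ) : TaftAlgebra n q ℓ →ₐ[k] k :=
  lift (ktildeGen q β) (ktildeGen_relations β)

theorem ktildeVal_mul_neg (β : Fin n → ℤ) (i : Fin n) (ℓ : ℕ) [hqℓ : Fact (IsPrimitiveRoot q ℓ)]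
    [hℓ : NeZero ℓ] : ktildeVal q β i * ktildeVal q (-β) i = 1 := by
  have hq := q_ne_zero q ℓ
  have e : ∀ α : Fin n → ℤ, starForm α (-β) = - starForm α β ∧
      starForm (-β) α = - starForm β α := by
    intro α; simp [starForm]
  simp only [ktildeVal, skewBichar, ← zpow_add₀ hq, e, Pi.neg_apply]
  rw [← zpow_zero q]
  congr 1
  ring

theorem ktilde_mul_neg (β : Fin n → ℤ) :
    (DualCop.toDual k (TaftAlgebra n q ℓ)).symm (ktildeHom q ℓ β).toLinearMap *
      (DualCop.toDual k (TaftAlgebra n q ℓ)).symm (ktildeHom q ℓ (-β)).toLinearMap = 1 := by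
  have h : ((Algebra.TensorProduct.lmul' k (S := k)).comp
      (Algebra.TensorProduct.map (ktildeHom q ℓ β) (ktildeHom q ℓ (-β)))).comp
      (Bialgebra.comulAlgHom k (TaftAlgebra n q ℓ)) =
      Bialgebra.counitAlgHom k (TaftAlgebra n q ℓ) := by
    refine hom_ext fun g => ?_
    simp only [AlgHom.comp_apply, Bialgebra.comulAlgHom_apply, Bialgebra.counitAlgHom_apply,
      comul_gen, counit_gen]
    cases g with
    | K i => simpa [comulGen, counitGen, ktildeHom, lift_gen, ktildeGen] using
        ktildeVal_mul_neg β i ℓ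
    | Kinv i =>
      simp only [comulGen, counitGen, ktildeHom, lift_gen, ktildeGen,
        Algebra.TensorProduct.map_tmul, Algebra.TensorProduct.lmul'_apply_tmul]
      rw [← mul_inv, ktildeVal_mul_neg β i ℓ, inv_one]
    | x i => simp [comulGen, counitGen, ktildeHom, lift_gen, ktildeGen]
  refine DualCop.ext fun x => ?_
  exact DFunLike.congr_fun h x

/-- The group-like element `𝔎̃(β)` of the dual, as an invertible element of the convolution
algebra: the character with `𝔎̃(β)(K(ε_i)) = θ(ε_i, β) q ^ ⟨ε_i, β⟩` and `𝔎̃(β)(x_i) = 0`. -/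
noncomputable def ktilde (q : k) (ℓ : ℕ) [hqℓ : Fact (IsPrimitiveRoot q ℓ)] [hℓ : NeZero ℓ]
    (β : Fin n → ℤ) : (DualCop k (TaftAlgebra n q ℓ))ˣ where
  val := (DualCop.toDual k _).symm (ktildeHom q ℓ β).toLinearMap
  inv := (DualCop.toDual k _).symm (ktildeHom q ℓ (-β)).toLinearMap
  val_inv := ktilde_mul_neg β
  inv_val := by simpa using ktilde_mul_neg (-β)

theorem ktildeHom_K (α β : Fin n → ℤ) : ktildeHom q ℓ β (K q ℓ α : TaftAlgebra n q ℓ) =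
    skewBichar q α β * q ^ (∑ i, α i * β i) := by
  have hq := q_ne_zero q ℓ
  have hu : ∀ i, Units.map (ktildeHom q ℓ β).toMonoidHom (KUnit q ℓ i) =
      Units.mk0 (ktildeVal q β i) (ktildeVal_ne_zero β i ℓ) := by
    intro i; ext; simp [KUnit, ktildeHom, lift_gen, ktildeGen]
  have h1 : Units.map (ktildeHom q ℓ β).toMonoidHom (K q ℓ α) =
      ∏ i, Units.mk0 (ktildeVal q β i) (ktildeVal_ne_zero β i ℓ) ^ α i := by
    rw [K, map_list_prod, List.map_ofFn, List.prod_ofFn]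
    refine Finset.prod_congr rfl fun i _ => ?_
    rw [Function.comp_apply, map_zpow, hu]
  have h2 : ktildeHom q ℓ β (K q ℓ α : TaftAlgebra n q ℓ) = ∏ i, ktildeVal q β i ^ α i := by
    have := congrArg (Units.val) h1
    simpa using this
  have hs : starForm α β - starForm β α =
      ∑ i, (starForm (basisVec i) β - starForm β (basisVec i)) * α i := by
    simp only [sub_mul, Finset.sum_sub_distrib]
    congr 1
    · simp only [starForm, Finset.sum_mul]
      rw [Finset.sum_comm]
      refine Finset.sum_congr rfl fun j _ => ?_
      rw [Finset.sum_comm]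
      refine Finset.sum_congr rfl fun i _ => ?_
      rw [Finset.sum_eq_single i]
      · simp [basisVec, mul_comm]
      · intro b _ hb; simp [basisVec, hb.symm]
      · simp
    · simp only [starForm, Finset.sum_mul]
      rw [Finset.sum_comm]
      refine Finset.sum_congr rfl fun j _ => ?_
      rw [Finset.sum_comm]
      refine Finset.sum_congr rfl fun i _ => ?_
      rw [Finset.sum_eq_single j]
      · simp [basisVec]
      · intro b _ hb; simp [basisVec, hb.symm]
      · simp
  have hp : ∀ f : Fin n → ℤ, ∏ i, q ^ f i = q ^ ∑ i, f i := by
    intro f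
    have h : ∀ s : Finset (Fin n), ∏ i ∈ s, q ^ f i = q ^ ∑ i ∈ s, f i := by
      intro s
      induction s using Finset.induction_on with
      | empty => simp
      | insert a s ha ih => rw [Finset.prod_insert ha, Finset.sum_insert ha, ih, zpow_add₀ hq]
    exact h _
  rw [h2, skewBichar, hs, ← zpow_add₀ hq, ← Finset.sum_add_distrib, ← hp]
  refine Finset.prod_congr rfl fun i _ => ?_
  rw [ktildeVal, skewBichar, ← zpow_add₀ hq, ← zpow_mul]
  congr 1; ring

/-- The values of `𝔎̃(β)` on the basis of ordered monomials. -/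
theorem ktilde_apply (β α : Fin n → ℤ) (γ : Fin n → ℕ) :
    (ktilde q ℓ β : DualCop k (TaftAlgebra n q ℓ)) (xMonomial q ℓ γ * K q ℓ α) =
      (if γ = 0 then 1 else 0) * (skewBichar q α β * q ^ (∑ i, α i * β i)) := by
  have h0 : ktildeHom q ℓ β (xMonomial q ℓ γ) = if γ = 0 then 1 else 0 := by
    rw [xMonomial, map_list_prod, List.map_ofFn, List.prod_ofFn]
    split_ifs with h
    · simp [h]
    · obtain ⟨i, hi⟩ := Function.ne_iff.1 h
      refine Finset.prod_eq_zero (Finset.mem_univ i) ?_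
      have hi' : γ i ≠ 0 := hi
      simp [ktildeHom, lift_gen, ktildeGen, hi']
  change ktildeHom q ℓ β (_ * _) = _
  rw [map_mul, h0, ktildeHom_K]

end GroupLike

end TaftAlgebra
end Taft

section Ribbon

open TensorProduct

variable (k : Type*) {H : Type*} [Field k] [Ring H] [HopfAlgebra k H]

/-- `R ↦ R²¹ = τ(R)`, the flip. -/
noncomputable def tensorFlip (R : H ⊗[k] H) : H ⊗[k] H := TensorProduct.comm k H H R

/-- `R ↦ R¹² = ∑ aᵢ ⊗ bᵢ ⊗ 1`. -/
noncomputable def leg12 (R : H ⊗[k] H) : H ⊗[k] (H ⊗[k] H) :=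
  TensorProduct.assoc k H H H (R ⊗ₜ[k] 1)

/-- `R ↦ R²³ = ∑ 1 ⊗ aᵢ ⊗ bᵢ`. -/
noncomputable def leg23 (R : H ⊗[k] H) : H ⊗[k] (H ⊗[k] H) := 1 ⊗ₜ[k] R

/-- `R ↦ R¹³ = ∑ aᵢ ⊗ 1 ⊗ bᵢ`. -/
noncomputable def leg13 (R : H ⊗[k] H) : H ⊗[k] (H ⊗[k] H) :=
  LinearMap.lTensor H (TensorProduct.mk k H H 1) R

/-- `R` is a universal `R`-matrix of the Hopf algebra `H`, i.e. `(H, R)` is quasitriangular. -/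
structure IsUniversalRMatrix (R : H ⊗[k] H) : Prop where
  isUnit : IsUnit R
  flip_comul (h : H) : tensorFlip k (Coalgebra.comul h) = R * Coalgebra.comul h * Ring.inverse R
  comul_left : TensorProduct.assoc k H H H (LinearMap.rTensor H Coalgebra.comul R) =
    leg13 k R * leg23 k R
  comul_right : LinearMap.lTensor H Coalgebra.comul R = leg13 k R * leg12 k R

/-- The Drinfeld element `u = ∑ s(bᵢ) aᵢ` of `R = ∑ aᵢ ⊗ bᵢ`. -/
noncomputable def drinfeldElement (R : H ⊗[k] H) : H :=
  LinearMap.mul' k H (LinearMap.rTensor H (HopfAlgebra.antipode k) (tensorFlip k R))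

/-- Quasi-ribbon elements of `(H, R)`. -/
structure IsQuasiRibbonElement (R : H ⊗[k] H) (v : H) : Prop where
  sq_eq : v ^ 2 = drinfeldElement k R * HopfAlgebra.antipode k (drinfeldElement k R)
  antipode_eq : HopfAlgebra.antipode k v = v
  counit_eq : Coalgebra.counit (R := k) v = 1
  comul_eq : Coalgebra.comul v = Ring.inverse (tensorFlip k R * R) * (v ⊗ₜ[k] v)

/-- Ribbon elements of `(H, R)`: central quasi-ribbon elements. -/
structure IsRibbonElement (R : H ⊗[k] H) (v : H) : Prop extends IsQuasiRibbonElement k R v where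
  central : v ∈ Subalgebra.center k H

/-- `(H, R, v)` is a ribbon Hopf algebra. -/
structure IsRibbonHopfAlgebra (R : H ⊗[k] H) (v : H) : Prop where
  universal : IsUniversalRMatrix k R
  ribbon : IsRibbonElement k R v

end Ribbon

section CanonicalRMatrix

open TensorProduct

variable (k H : Type*) [Field k] [Ring H] [HopfAlgebra k H]

/-- The canonical element `∑ᵢ (ε ⊗ hᵢ) ⊗ (hⁱ ⊗ 1)` of `D(H) ⊗ D(H)` written in a basis `b = (hᵢ)`
of `H` with dual basis `(hⁱ)`. -/
noncomputable def DrinfeldDouble.rMatrixOfBasis {ι : Type*} [Fintype ι] (b : Module.Basis ι k H) :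
    DrinfeldDouble k H ⊗[k] DrinfeldDouble k H :=
  ∑ i, DrinfeldDouble.tmul (1 : DualCop k H) (b i) ⊗ₜ[k]
    DrinfeldDouble.tmul ((DualCop.toDual k H).symm (b.coord i)) (1 : H)

/-- The canonical universal `R`-matrix of `D(H)`. It does not depend on the basis, see
`DrinfeldDouble.rMatrixOfBasis_eq`. -/
noncomputable def DrinfeldDouble.rMatrix [Module.Finite k H] :
    DrinfeldDouble k H ⊗[k] DrinfeldDouble k H :=
  DrinfeldDouble.rMatrixOfBasis k H (Module.finBasis k H)

theorem DrinfeldDouble.rMatrixOfBasis_eq [Module.Finite k H] {ι : Type*} [Fintype ι]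
    (b : Module.Basis ι k H) :
    DrinfeldDouble.rMatrixOfBasis k H b = DrinfeldDouble.rMatrix k H := by
  classical
  let c := Module.finBasis k H
  let f : H →ₗ[k] DrinfeldDouble k H := DrinfeldDouble.mk k H 1
  let g : (H →ₗ[k] k) →ₗ[k] DrinfeldDouble k H :=
    (DrinfeldDouble.mk k H).flip 1 ∘ₗ (DualCop.toDual k H).symm.toLinearMap
  change ∑ i, f (b i) ⊗ₜ[k] g (b.coord i) = ∑ j, f (c j) ⊗ₜ[k] g (c.coord j)
  have h1 : ∀ i, f (b i) = ∑ j, c.coord j (b i) • f (c j) := by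
    intro i
    conv_lhs => rw [← c.sum_repr (b i), map_sum]
    simp
  have h2 : ∀ j, g (c.coord j) = ∑ i, c.coord j (b i) • g (b.coord i) := by
    intro j
    have : c.coord j = ∑ i, c.coord j (b i) • b.coord i :=
      b.ext fun i => by simp [Finsupp.single_apply]
    conv_lhs => rw [this]
    simp
  simp only [h1, h2, TensorProduct.sum_tmul, TensorProduct.tmul_sum]
  rw [Finset.sum_comm]
  simp only [TensorProduct.smul_tmul]

end CanonicalRMatrix

/-!
# Ribbon elements of the Drinfeld double of the `n`-rank Taft algebra

Let `H` be a finite-dimensional Hopf algebra with universal `R`-matrix `R` and Drinfeld element `u`.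
Then `R²¹R Δ(u) = u ⊗ u` and `u h = s²(h) u`, so that `z = u⁻¹ s(u)` is group-like and implements
`s⁴`, that is, `z s⁴(x) = x z`. Writing `v = u w`, an element `v` is a ribbon element exactly when `w` is group-like,
`w s²(x) = x w` for all `x`, and `w² = z` (`IsUniversalRMatrix.isRibbonElement_iff`). The canonical
element of the Drinfeld double is a universal `R`-matrix
(`DrinfeldDouble.isUniversalRMatrix_rMatrix`), so the ribbon elements of the double of the Taft
algebra `A` are the square roots of `z` among the group-likes which implement `S²`.

The group-likes of a double are the `χ ⊗ g` with a character `χ` and a group-like `g`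
(`DrinfeldDouble.exists_eq_tmul_charDual`). For the Taft algebra `g` is some `K(β)`
(`TaftAlgebra.exists_eq_K`). This uses the basis of ordered monomials `TaftAlgebra.pbwBasis`, whose
linear independence is proved with a representation on functions.

To find `z = χ ⊗ K(β)`, the functional `p ⊗ h ↦ p(1) ψ(h)` is applied to `S(u) = u z` for a
character `ψ` of `A`. On `u z` it gives `ψ(K(β))`. On `S(u)` it gives the trace of the endomorphism
`s⁻² ∘ (h ↦ h₍₁₎ ψ(s(h₍₂₎)) s(h₍₃₎))` of `A`. This endomorphism maps `x ^ γ K(α)` to an explicit multiple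
of `x ^ γ`, and its trace is a product of telescoping `q`-sums with value `∏ ψ(K(ε_i))`. Therefore `β = (1, …, 1)`, and
then `χ(K(ε_i))` is determined by `z S⁴(x_i) = x_i z`
(`TaftAlgebra.exists_antipode_drinfeldElement_eq`).

A square root `χ' ⊗ K(β')` of `z` satisfies `2 β'_i ≡ 1` modulo `ℓ`, so it exists only for odd `ℓ`.
For odd `ℓ` it is unique because all the values of characters on the `K(ε_i)` are `ℓ`-th roots of
unity. The explicit element of the theorem is a square root of `z`, and it implements `S²` because it
does so on the generators.
-/

/-! ### The Drinfeld element and ribbon elements of a quasitriangular Hopf algebra -/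

section Quasitriangular

open TensorProduct Coalgebra HopfAlgebra

variable {k H : Type*} [Field k] [Ring H] [HopfAlgebra k H]

theorem TensorProduct.exists_sum_fin (R : H ⊗[k] H) :
    ∃ (m : ℕ) (a b : Fin m → H), R = ∑ i, a i ⊗ₜ[k] b i := by
  induction R with
  | zero => exact ⟨0, Fin.elim0, Fin.elim0, by simp⟩
  | tmul x y => exact ⟨1, fun _ => x, fun _ => y, by simp⟩
  | add x y hx hy =>
    obtain ⟨m, a, b, rfl⟩ := hx
    obtain ⟨m', a', b', rfl⟩ := hy
    exact ⟨m + m', Fin.append a a', Fin.append b b', by simp [Fin.sum_univ_add]⟩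

/-- `s ⊗ s` is anti-multiplicative. -/
theorem map_antipode_mul (x y : H ⊗[k] H) :
    TensorProduct.map (antipode k) (antipode k) (x * y) =
      TensorProduct.map (antipode k) (antipode k) y *
        TensorProduct.map (antipode k : H →ₗ[k] H) (antipode k : H →ₗ[k] H) x := by
  induction x with
  | zero => simp
  | add x x' hx hx' => simp only [add_mul, map_add, mul_add, hx, hx']
  | tmul a b =>
    induction y with
    | zero => simp
    | add x x' hx hx' => simp only [add_mul, map_add, mul_add, hx, hx']
    | tmul c d => simp [antipode_mul_antidistrib]

theorem tensorFlip_mul (x y : H ⊗[k] H) :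
    tensorFlip k (x * y) = tensorFlip k x * tensorFlip k y :=
  map_mul (Algebra.TensorProduct.comm k H H) x y

theorem tensorFlip_tensorFlip (x : H ⊗[k] H) : tensorFlip k (tensorFlip k x) = x :=
  (TensorProduct.comm k H H).symm_apply_apply x

theorem tensorFlip_one : tensorFlip k (1 : H ⊗[k] H) = 1 :=
  map_one (Algebra.TensorProduct.comm k H H)

theorem map_antipode_tensorFlip (x : H ⊗[k] H) :
    TensorProduct.map (antipode k) (antipode k) (tensorFlip k x) =
      tensorFlip k (TensorProduct.map (antipode k : H →ₗ[k] H) (antipode k : H →ₗ[k] H) x) :=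
  TensorProduct.map_comm _ _ _

namespace IsUniversalRMatrix

section Components

variable {ι : Type*} [Fintype ι] {a b : ι → H}

section Basic
variable (hR : IsUniversalRMatrix k (∑ i, a i ⊗ₜ[k] b i))
include hR

theorem sum_comul_left : ∑ i, comul (R := k) (a i) ⊗ₜ[k] b i =
    ∑ i, ∑ j, (a i ⊗ₜ[k] a j) ⊗ₜ[k] (b i * b j) := by
  apply (TensorProduct.assoc k H H H).injective
  have h := hR.comul_left
  simp only [leg13, leg23, map_sum, LinearMap.rTensor_tmul, LinearMap.lTensor_tmul,
    TensorProduct.tmul_sum, Finset.sum_mul_sum] at h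
  simpa using h

theorem sum_comul_right : ∑ i, a i ⊗ₜ[k] comul (R := k) (b i) =
    ∑ i, ∑ j, (a i * a j) ⊗ₜ[k] (b j ⊗ₜ[k] b i) := by
  have h := hR.comul_right
  simp only [leg13, leg12, map_sum, LinearMap.lTensor_tmul,
    TensorProduct.sum_tmul, Finset.sum_mul_sum] at h
  simpa using h

/-- `(id ⊗ ε)(R) = 1`: applying `ε` to the middle leg of `(id ⊗ Δ)R = R¹³R¹²` gives
`R = R ((id ⊗ ε)(R) ⊗ 1)`, and `R` is invertible. -/
theorem sum_counit_right : ∑ i, counit (R := k) (b i) • a i = 1 := by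
  have h := congrArg (LinearMap.lTensor H ((TensorProduct.lid k H).toLinearMap ∘ₗ
    LinearMap.rTensor H (counit (R := k)))) hR.sum_comul_right
  simp only [map_sum, LinearMap.lTensor_tmul, LinearMap.comp_apply, rTensor_counit_comul,
    LinearEquiv.coe_coe, lid_tmul, one_smul, LinearMap.rTensor_tmul] at h
  have h2 : (∑ i, a i ⊗ₜ[k] b i) * ((∑ j, counit (R := k) (b j) • a j) ⊗ₜ[k] 1) =
      (∑ i, a i ⊗ₜ[k] b i) * 1 := by
    rw [mul_one]
    conv_rhs => rw [h]
    simp [TensorProduct.sum_tmul, Finset.sum_mul_sum, TensorProduct.smul_tmul']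
  have h3 := congrArg (fun t => TensorProduct.rid k H (LinearMap.lTensor H (counit (R := k)) t))
    (hR.isUnit.mul_left_cancel h2)
  simpa [Algebra.TensorProduct.one_def] using h3

theorem sum_counit_left : ∑ i, counit (R := k) (a i) • b i = 1 := by
  have h := congrArg (LinearMap.rTensor H ((TensorProduct.rid k H).toLinearMap ∘ₗ
    LinearMap.lTensor H (counit (R := k)))) hR.sum_comul_left
  simp only [map_sum, LinearMap.rTensor_tmul, LinearMap.comp_apply, lTensor_counit_comul,
    LinearEquiv.coe_coe, rid_tmul, one_smul, LinearMap.lTensor_tmul] at h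
  have h2 : (∑ i, a i ⊗ₜ[k] b i) * (1 ⊗ₜ[k] (∑ j, counit (R := k) (a j) • b j)) =
      (∑ i, a i ⊗ₜ[k] b i) * 1 := by
    rw [mul_one]
    conv_rhs => rw [h]
    simp [TensorProduct.tmul_sum, Finset.sum_mul_sum, TensorProduct.smul_tmul']
  have h3 := congrArg (fun t => TensorProduct.lid k H (LinearMap.rTensor H (counit (R := k)) t))
    (hR.isUnit.mul_left_cancel h2)
  simpa [Algebra.TensorProduct.one_def] using h3

/-- The identity `∑ aᵢ aⱼ ⊗ s(bⱼ) bᵢ = 1`, obtained from `(id ⊗ Δ)R = R¹³R¹²`. -/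
theorem sum_antipode_right_left : ∑ i, ∑ j, (a i * a j) ⊗ₜ[k] (antipode k (b j) * b i) = 1 := by
  have h := congrArg (LinearMap.lTensor H (LinearMap.mul' k H ∘ₗ
    LinearMap.rTensor H (antipode k))) hR.sum_comul_right
  simp only [map_sum, LinearMap.lTensor_tmul, LinearMap.comp_apply,
    mul_antipode_rTensor_comul_apply, LinearMap.rTensor_tmul, LinearMap.mul'_apply] at h
  rw [← h]
  simp only [Algebra.algebraMap_eq_smul_one, TensorProduct.tmul_smul, TensorProduct.smul_tmul']
  rw [← TensorProduct.sum_tmul, hR.sum_counit_right, Algebra.TensorProduct.one_def]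

/-- The identity `∑ aᵢ aⱼ ⊗ bⱼ s(bᵢ) = 1`, obtained from `(id ⊗ Δ)R = R¹³R¹²`. -/
theorem sum_antipode_right_right :
    ∑ i, ∑ j, (a i * a j) ⊗ₜ[k] (b j * antipode k (b i)) = 1 := by
  have h := congrArg (LinearMap.lTensor H (LinearMap.mul' k H ∘ₗ
    LinearMap.lTensor H (antipode k))) hR.sum_comul_right
  simp only [map_sum, LinearMap.lTensor_tmul, LinearMap.comp_apply,
    mul_antipode_lTensor_comul_apply, LinearMap.mul'_apply] at h
  rw [← h]
  simp only [Algebra.algebraMap_eq_smul_one, TensorProduct.tmul_smul, TensorProduct.smul_tmul']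
  rw [← TensorProduct.sum_tmul, hR.sum_counit_right, Algebra.TensorProduct.one_def]

/-- `(s ⊗ id)(R)` is a left inverse of `R`. -/
theorem sum_antipode_left : (∑ i, antipode k (a i) ⊗ₜ[k] b i) * ∑ i, a i ⊗ₜ[k] b i = 1 := by
  have h := congrArg (LinearMap.rTensor H (LinearMap.mul' k H ∘ₗ
    LinearMap.rTensor H (antipode k))) hR.sum_comul_left
  simp only [map_sum, LinearMap.rTensor_tmul, LinearMap.comp_apply,
    mul_antipode_rTensor_comul_apply, LinearMap.mul'_apply] at h
  rw [Finset.sum_mul_sum]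
  simp only [Algebra.TensorProduct.tmul_mul_tmul]
  rw [← h]
  simp only [Algebra.algebraMap_eq_smul_one, ← TensorProduct.smul_tmul',
    ← TensorProduct.tmul_smul]
  rw [← TensorProduct.tmul_sum, hR.sum_counit_left, Algebra.TensorProduct.one_def]

theorem mul_sum_antipode_left : (∑ i, a i ⊗ₜ[k] b i) * (∑ i, antipode k (a i) ⊗ₜ[k] b i) = 1 := by
  have h := hR.sum_antipode_left
  obtain ⟨w, hw⟩ := hR.isUnit.exists_right_inv
  rwa [left_inv_eq_right_inv h hw]

/-- `(s ⊗ s)(R) = R`. -/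
theorem sum_antipode_antipode : ∑ i, antipode k (a i) ⊗ₜ[k] antipode k (b i) =
    ∑ i, a i ⊗ₜ[k] b i := by
  have h1 : (∑ i, antipode k (a i) ⊗ₜ[k] b i) *
      (∑ i, antipode k (a i) ⊗ₜ[k] antipode k (b i)) = 1 := by
    have h := congrArg (LinearMap.rTensor H (antipode k)) hR.sum_antipode_right_right
    rw [Algebra.TensorProduct.one_def, LinearMap.rTensor_tmul, antipode_one] at h
    rw [Finset.sum_mul_sum, Finset.sum_comm, Algebra.TensorProduct.one_def, ← h]
    simp [antipode_mul_antidistrib]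
  calc _ = (∑ i, a i ⊗ₜ[k] b i) * ((∑ i, antipode k (a i) ⊗ₜ[k] b i) *
      (∑ i, antipode k (a i) ⊗ₜ[k] antipode k (b i))) := by
        rw [← mul_assoc, hR.mul_sum_antipode_left, one_mul]
    _ = _ := by rw [h1, mul_one]

end Basic

end Components

variable {R : H ⊗[k] H}

theorem map_antipode_antipode (hR : IsUniversalRMatrix k R) :
    TensorProduct.map (antipode k) (antipode k) R = R := by
  obtain ⟨m, a, b, rfl⟩ := TensorProduct.exists_sum_fin R
  simpa using hR.sum_antipode_antipode

theorem flip_comul_mul (hR : IsUniversalRMatrix k R) (h : H) :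
    tensorFlip k (comul h) * R = R * comul h := by
  rw [hR.flip_comul, mul_assoc, Ring.inverse_mul_cancel _ hR.isUnit, mul_one]

theorem isUnit_flip_mul (hR : IsUniversalRMatrix k R) : IsUnit (tensorFlip k R * R) :=
  (hR.isUnit.map (Algebra.TensorProduct.comm k H H)).mul hR.isUnit

/-- `R²¹R` commutes with the image of the comultiplication. -/
theorem flip_mul_comul (hR : IsUniversalRMatrix k R) (h : H) :
    tensorFlip k R * R * comul h = comul h * (tensorFlip k R * R) := by
  have h1 := congrArg (tensorFlip k) (hR.flip_comul_mul h)
  rw [tensorFlip_mul, tensorFlip_mul, tensorFlip_tensorFlip] at h1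
  rw [mul_assoc, ← hR.flip_comul_mul, ← mul_assoc, ← h1, mul_assoc]

theorem drinfeldElement_sum {ι : Type*} [Fintype ι] (a b : ι → H) :
    drinfeldElement k (∑ i, a i ⊗ₜ[k] b i) = ∑ i, antipode k (b i) * a i := by
  simp [drinfeldElement, tensorFlip]

theorem counit_drinfeldElement (hR : IsUniversalRMatrix k R) :
    counit (R := k) (drinfeldElement k R) = 1 := by
  obtain ⟨m, a, b, rfl⟩ := TensorProduct.exists_sum_fin R
  have h := congrArg (counit (R := k)) hR.sum_counit_right
  rw [drinfeldElement_sum]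
  simpa using h

/-- Conjugation by the Drinfeld element is `s²`. -/
theorem drinfeldElement_mul (hR : IsUniversalRMatrix k R) (h : H) :
    drinfeldElement k R * h = antipode k (antipode k h) * drinfeldElement k R := by
  obtain ⟨m, a, b, hab⟩ := TensorProduct.exists_sum_fin R
  -- apply `x ⊗ y ⊗ z ↦ s²(z) s(y) x` to `R Δ(h₁) ⊗ h₂ = Δᵒᵖ(h₁) R ⊗ h₂`
  let G : (H ⊗[k] H) ⊗[k] H →ₗ[k] H := LinearMap.mul' k H ∘ₗ
    (TensorProduct.comm k H H).toLinearMap ∘ₗ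
    TensorProduct.map (LinearMap.mul' k H ∘ₗ (TensorProduct.comm k H H).toLinearMap ∘ₗ
      LinearMap.lTensor H (antipode k)) (antipode k ∘ₗ antipode k)
  have hG : ∀ x y z : H, G ((x ⊗ₜ y) ⊗ₜ z) = antipode k (antipode k z) * (antipode k y * x) :=
    fun _ _ _ => rfl
  have e1 : LinearMap.mulLeft k R ∘ₗ comul = LinearMap.mulRight k R ∘ₗ
      (TensorProduct.comm k H H).toLinearMap ∘ₗ comul :=
    LinearMap.ext fun x => (hR.flip_comul_mul x).symm
  have e2 : ∀ t : (H ⊗[k] H) ⊗[k] H, G (LinearMap.rTensor H (LinearMap.mulLeft k R) t) =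
      LinearMap.mul' k H (TensorProduct.comm k H H (TensorProduct.map
        (LinearMap.mulLeft k (drinfeldElement k R)) (antipode k ∘ₗ LinearMap.mul' k H ∘ₗ
          LinearMap.lTensor H (antipode k)) (TensorProduct.assoc k H H H t))) := by
    intro t
    induction t with
    | zero => simp
    | add x y hx hy => simp only [map_add, hx, hy]
    | tmul d z =>
      induction d with
      | zero => simp
      | add x y hx hy => simp only [TensorProduct.add_tmul, map_add, hx, hy]
      | tmul x y =>
        rw [hab, drinfeldElement_sum]
        simp [Finset.sum_mul, TensorProduct.sum_tmul, hG, antipode_mul_antidistrib, mul_assoc]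
  have e3 : ∀ t : (H ⊗[k] H) ⊗[k] H, G (LinearMap.rTensor H (LinearMap.mulRight k R ∘ₗ
      (TensorProduct.comm k H H).toLinearMap) t) = LinearMap.mul' k H
        (TensorProduct.comm k H H (TensorProduct.map
        (LinearMap.mulLeft k 1) (antipode k ∘ₗ antipode k) (TensorProduct.map
        (∑ i, LinearMap.mulRight k (a i) ∘ₗ LinearMap.mulLeft k (antipode k (b i)) ∘ₗ
          LinearMap.mul' k H ∘ₗ LinearMap.rTensor H (antipode k)) LinearMap.id t))) := by
    intro t
    induction t with
    | zero => simp
    | add x y hx hy => simp only [map_add, hx, hy]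
    | tmul d z =>
      induction d with
      | zero => simp
      | add x y hx hy => simp only [TensorProduct.add_tmul, map_add, hx, hy]
      | tmul x y =>
        rw [hab]
        simp [Finset.mul_sum, TensorProduct.sum_tmul, hG, antipode_mul_antidistrib, mul_assoc]
  have l1 : G (LinearMap.rTensor H (LinearMap.mulLeft k R ∘ₗ comul) (comul h)) =
      drinfeldElement k R * h := by
    rw [LinearMap.rTensor_comp_apply, e2, coassoc_apply]
    have : ∀ t : H ⊗[k] H, LinearMap.mul' k H (TensorProduct.comm k H H (TensorProduct.map
        (LinearMap.mulLeft k (drinfeldElement k R)) (antipode k ∘ₗ LinearMap.mul' k H ∘ₗ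
          LinearMap.lTensor H (antipode k)) (LinearMap.lTensor H comul t))) =
        drinfeldElement k R * TensorProduct.rid k H (LinearMap.lTensor H counit t) := by
      intro t
      induction t with
      | zero => simp
      | add x y hx hy => simp only [map_add, hx, hy, mul_add]
      | tmul x y => simp [mul_antipode_lTensor_comul_apply, Algebra.algebraMap_eq_smul_one,
          antipode_one]
    rw [this, lTensor_counit_comul]; simp
  have l2 : G (LinearMap.rTensor H (LinearMap.mulRight k R ∘ₗ
        (TensorProduct.comm k H H).toLinearMap ∘ₗ comul) (comul h)) =
      antipode k (antipode k h) * drinfeldElement k R := by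
    rw [← LinearMap.comp_assoc, LinearMap.rTensor_comp_apply, e3]
    have : ∀ t : H ⊗[k] H, LinearMap.mul' k H (TensorProduct.comm k H H (TensorProduct.map
        (LinearMap.mulLeft k 1) (antipode k ∘ₗ antipode k) (TensorProduct.map
        (∑ i, LinearMap.mulRight k (a i) ∘ₗ LinearMap.mulLeft k (antipode k (b i)) ∘ₗ
          LinearMap.mul' k H ∘ₗ LinearMap.rTensor H (antipode k)) LinearMap.id
          (LinearMap.rTensor H comul t)))) =
        antipode k (antipode k (TensorProduct.lid k H (LinearMap.rTensor H counit t))) *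
          drinfeldElement k R := by
      intro t
      induction t with
      | zero => simp
      | add x y hx hy => simp only [map_add, hx, hy, add_mul]
      | tmul x y =>
        rw [hab, drinfeldElement_sum]
        simp [mul_antipode_rTensor_comul_apply, Algebra.algebraMap_eq_smul_one, ← Finset.smul_sum]
    rw [this, rTensor_counit_comul]; simp
  rw [← l1, ← l2, e1]

/-- The right inverse is `∑ bᵢ s²(aᵢ)`. -/
theorem exists_drinfeldElement_mul_eq_one (hR : IsUniversalRMatrix k R) :
    ∃ w, drinfeldElement k R * w = 1 := by
  obtain ⟨m, a, b, rfl⟩ := TensorProduct.exists_sum_fin R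
  refine ⟨∑ i, b i * antipode k (antipode k (a i)), ?_⟩
  -- `R` times `(s ⊗ id)(R) = (s² ⊗ s)(R)` is `1`
  have h1 : ∑ j, ∑ i, (a j * antipode k (antipode k (a i))) ⊗ₜ[k] (b j * antipode k (b i)) =
      1 := by
    have h := congrArg (LinearMap.rTensor H (antipode k)) hR.sum_antipode_antipode
    simp only [map_sum, LinearMap.rTensor_tmul] at h
    have h' := hR.mul_sum_antipode_left
    rw [← h, Finset.sum_mul_sum] at h'
    simpa using h'
  have h2 := congrArg (fun t => LinearMap.mul' k H (TensorProduct.comm k H H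
    (LinearMap.lTensor H (antipode k) t))) h1
  simp only [map_sum, LinearMap.lTensor_tmul, comm_tmul, LinearMap.mul'_apply,
    Algebra.TensorProduct.one_def, antipode_one, mul_one, antipode_mul_antidistrib] at h2
  rw [← h2, Finset.mul_sum, Finset.sum_comm]
  refine Finset.sum_congr rfl fun i _ => ?_
  rw [← mul_assoc, hR.drinfeldElement_mul, drinfeldElement_sum, Finset.mul_sum, Finset.sum_mul]
  simp only [mul_assoc]

theorem isUnit_drinfeldElement [Module.Finite k H] (hR : IsUniversalRMatrix k R) :
    IsUnit (drinfeldElement k R) := by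
  obtain ⟨w, hw⟩ := hR.exists_drinfeldElement_mul_eq_one
  have hs : Function.Surjective (LinearMap.mulLeft k (drinfeldElement k R)) :=
    fun x => ⟨w * x, by rw [LinearMap.mulLeft_apply, ← mul_assoc, hw, one_mul]⟩
  have hi := LinearMap.injective_iff_surjective.2 hs
  refine ⟨⟨_, w, hw, hi ?_⟩, rfl⟩
  rw [LinearMap.mulLeft_apply, LinearMap.mulLeft_apply, ← mul_assoc, hw, one_mul, mul_one]

/-- `R²¹R Δ(u) = u ⊗ u`. -/
theorem flip_mul_comul_drinfeldElement (hR : IsUniversalRMatrix k R) :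
    tensorFlip k R * R * comul (drinfeldElement k R) =
      drinfeldElement k R ⊗ₜ[k] drinfeldElement k R := by
  obtain ⟨m, a, b, hab⟩ := TensorProduct.exists_sum_fin R
  have hR' := hab ▸ hR
  let G : (H ⊗[k] H) →ₗ[k] (H ⊗[k] H) →ₗ[k] (H ⊗[k] H) := LinearMap.mk₂ k
    (fun X Y => TensorProduct.map (antipode k) (antipode k) (tensorFlip k Y) *
      (tensorFlip k R * tensorFlip k X))
    (fun _ _ _ => by simp [tensorFlip, mul_add]) (fun _ _ _ => by simp [tensorFlip])
    (fun _ _ _ => by simp [tensorFlip, add_mul]) (fun _ _ _ => by simp [tensorFlip])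
  have hG : ∀ X Y, G X Y = TensorProduct.map (antipode k) (antipode k) (tensorFlip k Y) *
      (tensorFlip k R * tensorFlip k X) := fun _ _ => rfl
  have h0 : tensorFlip k R * R * comul (drinfeldElement k R) =
      (∑ i, G (comul (a i)) (comul (b i))) * R := by
    conv_lhs => rw [hab, drinfeldElement_sum, ← hab]
    simp only [map_sum, Finset.mul_sum, Finset.sum_mul]
    refine Finset.sum_congr rfl fun i _ => ?_
    rw [Bialgebra.comul_mul, ← mul_assoc, hR.flip_mul_comul, hG, mul_assoc, mul_assoc,
      ← hR.flip_comul_mul, comul_antipode]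
    simp only [tensorFlip, mul_assoc]
  -- `(Δ ⊗ Δ)(R) = R¹⁴ R¹³ R²⁴ R²³`
  have h1 : ∑ i, comul (R := k) (a i) ⊗ₜ[k] comul (R := k) (b i) =
      ∑ p, ∑ q, ∑ i, ∑ j, ((a i * a p) ⊗ₜ[k] (a j * a q)) ⊗ₜ[k]
        ((b p * b q) ⊗ₜ[k] (b i * b j)) := by
    have h := congrArg (LinearMap.rTensor (H ⊗[k] H) (comul (R := k))) hR'.sum_comul_right
    simp only [map_sum, LinearMap.rTensor_tmul, Bialgebra.comul_mul] at h
    rw [h]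
    let F : ((H ⊗[k] H) ⊗[k] H) →ₗ[k] ((H ⊗[k] H) ⊗[k] H) →ₗ[k]
        ((H ⊗[k] H) ⊗[k] (H ⊗[k] H)) :=
      TensorProduct.curry (TensorProduct.map (LinearMap.mul' k _)
        (TensorProduct.comm k H H).toLinearMap ∘ₗ
        (TensorProduct.tensorTensorTensorComm k (H ⊗[k] H) H (H ⊗[k] H) H).toLinearMap)
    have hF : ∀ X x Y y, F (X ⊗ₜ x) (Y ⊗ₜ y) = (X * Y) ⊗ₜ (y ⊗ₜ x) := fun _ _ _ _ => rfl
    have h2 := congrArg (fun t => F t t) hR'.sum_comul_left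
    simp only [map_sum, LinearMap.sum_apply, hF, Algebra.TensorProduct.tmul_mul_tmul] at h2
    rw [Finset.sum_comm, h2]
  have h2 : (∑ i, G (comul (a i)) (comul (b i))) = ∑ l, (drinfeldElement k R * a l) ⊗ₜ[k]
      (antipode k (b l) * drinfeldElement k R) := by
    have h3 := congrArg (TensorProduct.lift G) h1
    simp only [map_sum, TensorProduct.lift.tmul] at h3
    rw [h3]
    clear h0 h1 h3
    -- the pairs `R¹⁴` and `R²¹` cancel
    have hN : ∑ i, (antipode k (b i) ⊗ₜ[k] (1 : H)) * tensorFlip k R * (1 ⊗ₜ[k] a i) = 1 := by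
      have h := congrArg (tensorFlip k) hR'.sum_antipode_right_left
      rw [tensorFlip_one] at h
      rw [← h, hab]
      simp only [tensorFlip, map_sum, comm_tmul, Finset.mul_sum, Finset.sum_mul,
        Algebra.TensorProduct.tmul_mul_tmul, one_mul, mul_one]
      exact Finset.sum_comm
    calc _ = ∑ p, ∑ q, ∑ j, (antipode k (b j) ⊗ₜ[k] (antipode k (b q) * antipode k (b p))) *
          (∑ i, (antipode k (b i) ⊗ₜ[k] (1 : H)) * tensorFlip k R * (1 ⊗ₜ[k] a i)) *
          ((a j * a q) ⊗ₜ[k] a p) := by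
          refine Finset.sum_congr rfl fun p _ => Finset.sum_congr rfl fun q _ => ?_
          rw [Finset.sum_comm]
          refine Finset.sum_congr rfl fun j _ => ?_
          rw [Finset.mul_sum, Finset.sum_mul]
          refine Finset.sum_congr rfl fun i _ => ?_
          rw [hG]
          have e1 : TensorProduct.map (antipode k) (antipode k)
              (tensorFlip k ((b p * b q) ⊗ₜ[k] (b i * b j))) =
              (antipode k (b j) ⊗ₜ[k] (antipode k (b q) * antipode k (b p))) *
                (antipode k (b i) ⊗ₜ[k] (1 : H)) := by
            simp [tensorFlip, antipode_mul_antidistrib]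
          have e2 : tensorFlip k ((a i * a p) ⊗ₜ[k] (a j * a q)) =
              ((1 : H) ⊗ₜ[k] a i) * ((a j * a q) ⊗ₜ[k] a p) := by
            simp [tensorFlip]
          rw [e1, e2]
          simp only [mul_assoc]
      _ = ∑ p, ∑ q, ∑ j, (antipode k (b j) * a j * a q) ⊗ₜ[k]
            (antipode k (b q) * (antipode k (b p) * a p)) := by
          rw [hN]
          simp only [mul_one, Algebra.TensorProduct.tmul_mul_tmul, mul_assoc]
      _ = _ := by
          rw [Finset.sum_comm]
          refine Finset.sum_congr rfl fun q _ => ?_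
          conv_rhs => rw [hab, drinfeldElement_sum]
          simp only [Finset.sum_mul, Finset.mul_sum, TensorProduct.sum_tmul, TensorProduct.tmul_sum]
  -- the remaining factors `R²³` and `R` cancel after `u` has been moved past `R`
  rw [h0, h2]
  have h3 := congrArg (LinearMap.lTensor H (antipode k)) hR'.sum_antipode_right_left
  simp only [map_sum, LinearMap.lTensor_tmul, Algebra.TensorProduct.one_def, antipode_one,
    antipode_mul_antidistrib] at h3
  have h4 : drinfeldElement k R ⊗ₜ[k] drinfeldElement k R =
      (drinfeldElement k R ⊗ₜ[k] 1) * (1 ⊗ₜ[k] 1) * (1 ⊗ₜ[k] drinfeldElement k R) := by simp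
  rw [h4, ← h3]
  conv_lhs => enter [2]; rw [hab]
  simp only [Finset.sum_mul, Finset.mul_sum, Algebra.TensorProduct.tmul_mul_tmul, one_mul, mul_one]
  rw [Finset.sum_comm]
  refine Finset.sum_congr rfl fun l _ => Finset.sum_congr rfl fun m _ => ?_
  rw [mul_assoc, mul_assoc, hR.drinfeldElement_mul (b m), mul_assoc]

section FiniteDimensional

variable [Module.Finite k H] (hR : IsUniversalRMatrix k R)
include hR

theorem antipode_antipode_surjective :
    Function.Surjective fun x : H => antipode k (antipode k x) := by
  intro x
  obtain ⟨w, hw⟩ := hR.isUnit_drinfeldElement.exists_left_inv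
  obtain ⟨w', hw'⟩ := hR.isUnit_drinfeldElement.exists_right_inv
  have e : w = w' := left_inv_eq_right_inv hw hw'
  subst e
  refine ⟨w * x * drinfeldElement k R, hR.isUnit_drinfeldElement.mul_right_cancel ?_⟩
  rw [← hR.drinfeldElement_mul, ← mul_assoc, ← mul_assoc, hw', one_mul]

theorem antipode_antipode_drinfeldElement :
    antipode k (antipode k (drinfeldElement k R)) = drinfeldElement k R :=
  hR.isUnit_drinfeldElement.mul_right_cancel (hR.drinfeldElement_mul _).symm

/-- Conjugation by `s(u)` is inverse to `s²`, as follows by applying `s` to `u h = s²(h) u`. -/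
theorem antipode_drinfeldElement_mul (h : H) :
    antipode k (drinfeldElement k R) * antipode k (antipode k h) =
      h * antipode k (drinfeldElement k R) := by
  obtain ⟨y, rfl⟩ := hR.antipode_antipode_surjective h
  have := congrArg (antipode k) (hR.drinfeldElement_mul (antipode k y))
  simpa only [antipode_mul_antidistrib] using this.symm

/-- The image of `R²¹R Δ(u) = u ⊗ u` under `s ⊗ s`, which fixes `R`. -/
theorem comul_antipode_drinfeldElement_mul :
    comul (antipode k (drinfeldElement k R)) * (tensorFlip k R * R) =
      antipode k (drinfeldElement k R) ⊗ₜ[k] antipode k (drinfeldElement k R) := by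
  have h := congrArg (fun t => TensorProduct.map (antipode k) (antipode k) (tensorFlip k t))
    hR.flip_mul_comul_drinfeldElement
  simp only [tensorFlip_mul, map_antipode_mul, tensorFlip_tensorFlip, map_antipode_tensorFlip,
    hR.map_antipode_antipode] at h
  rw [comul_antipode]
  change TensorProduct.map _ _ (tensorFlip k _) * _ = _
  rw [map_antipode_tensorFlip, h]
  simp [tensorFlip]

/-- The element `z` with `s(u) = u z` is group-like, and conjugation by its inverse is `s⁴`. -/
theorem exists_antipode_drinfeldElement_eq : ∃ z : H,
    antipode k (drinfeldElement k R) = drinfeldElement k R * z ∧ comul z = z ⊗ₜ[k] z ∧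
      counit (R := k) z = 1 ∧
      ∀ x, z * antipode k (antipode k (antipode k (antipode k x))) = x * z := by
  obtain ⟨U, hU⟩ := hR.isUnit_drinfeldElement
  have hz : antipode k (drinfeldElement k R) =
      drinfeldElement k R * (↑U⁻¹ * antipode k (drinfeldElement k R)) := by
    rw [← mul_assoc, ← hU, Units.mul_inv, one_mul]
  refine ⟨↑U⁻¹ * antipode k (drinfeldElement k R), hz, ?_, ?_, fun x => ?_⟩
  · have hQ : IsUnit (tensorFlip k R * R * comul (drinfeldElement k R)) :=
      hR.isUnit_flip_mul.mul (hR.isUnit_drinfeldElement.map (Bialgebra.comulAlgHom k H))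
    refine hQ.mul_left_cancel ?_
    rw [mul_assoc, ← Bialgebra.comul_mul, ← hz, hR.flip_mul_comul,
      hR.comul_antipode_drinfeldElement_mul, hR.flip_mul_comul_drinfeldElement,
      Algebra.TensorProduct.tmul_mul_tmul, ← hz]
  · have h := congrArg (counit (R := k)) hz
    rwa [counit_antipode, Bialgebra.counit_mul, hR.counit_drinfeldElement, one_mul, eq_comm] at h
  · refine hR.isUnit_drinfeldElement.mul_left_cancel ?_
    rw [← mul_assoc, ← hz, hR.antipode_drinfeldElement_mul, ← mul_assoc, hR.drinfeldElement_mul,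
      mul_assoc, ← hz]

/-- The ribbon elements are the products `u w` where `w` is group-like, `w s²(x) = x w` for all
`x`, and `s(u) = u w²`. -/
theorem isRibbonElement_iff (v : H) : IsRibbonElement k R v ↔
    ∃ w : H, v = drinfeldElement k R * w ∧ comul w = w ⊗ₜ[k] w ∧ counit (R := k) w = 1 ∧
      (∀ x, w * antipode k (antipode k x) = x * w) ∧
      antipode k (drinfeldElement k R) = drinfeldElement k R * (w * w) := by
  have hu := hR.isUnit_drinfeldElement
  have hcomm : ∀ w : H, (∀ x, w * antipode k (antipode k x) = x * w) →
      w * drinfeldElement k R = drinfeldElement k R * w := fun w hw => by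
    have := hw (drinfeldElement k R)
    rwa [hR.antipode_antipode_drinfeldElement] at this
  constructor
  · intro hv
    obtain ⟨U, hU⟩ := hu
    have hw : v = drinfeldElement k R * (↑U⁻¹ * v) := by
      rw [← mul_assoc, ← hU, Units.mul_inv, one_mul]
    generalize (↑U⁻¹ * v : H) = w at hw
    have hu := hR.isUnit_drinfeldElement
    have h1 : comul w = w ⊗ₜ[k] w := by
      have hQ : IsUnit (tensorFlip k R * R * comul (drinfeldElement k R)) :=
        hR.isUnit_flip_mul.mul (hu.map (Bialgebra.comulAlgHom k H))
      refine hQ.mul_left_cancel ?_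
      rw [mul_assoc, ← Bialgebra.comul_mul, ← hw, hR.flip_mul_comul_drinfeldElement,
        Algebra.TensorProduct.tmul_mul_tmul, ← hw, hv.comul_eq, ← mul_assoc,
        Ring.mul_inverse_cancel _ hR.isUnit_flip_mul, one_mul]
    have h2 : counit (R := k) w = 1 := by
      have h := hv.counit_eq
      rwa [hw, Bialgebra.counit_mul, hR.counit_drinfeldElement, one_mul] at h
    have h3 : ∀ x, w * antipode k (antipode k x) = x * w := fun x => by
      refine hu.mul_left_cancel ?_
      rw [← mul_assoc, ← hw, ← mul_assoc, hR.drinfeldElement_mul, mul_assoc, ← hw]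
      exact (Subalgebra.mem_center_iff.1 hv.central _).symm
    refine ⟨w, hw, h1, h2, h3, ?_⟩
    have h4 : w * antipode k w = 1 := by
      have := mul_antipode_lTensor_comul_apply (R := k) w
      rwa [h1, LinearMap.lTensor_tmul, LinearMap.mul'_apply, h2, map_one] at this
    have h5 := hv.antipode_eq
    rw [hw, antipode_mul_antidistrib] at h5
    rw [← mul_assoc, ← hcomm w h3, mul_assoc, ← h5, ← mul_assoc, h4, one_mul]
  · rintro ⟨w, rfl, h1, h2, h3, h4⟩
    have h5 : antipode k w * w = 1 := by
      have := mul_antipode_rTensor_comul_apply (R := k) w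
      rwa [h1, LinearMap.rTensor_tmul, LinearMap.mul'_apply, h2, map_one] at this
    refine ⟨⟨?_, ?_, ?_, ?_⟩, ?_⟩
    · rw [h4, pow_two, mul_assoc, ← mul_assoc w, hcomm w h3, mul_assoc]
    · rw [antipode_mul_antidistrib, h4, ← mul_assoc (drinfeldElement k R), ← hcomm w h3,
        mul_assoc, ← mul_assoc, h5, one_mul, hcomm w h3]
    · rw [Bialgebra.counit_mul, hR.counit_drinfeldElement, h2, one_mul]
    · refine hR.isUnit_flip_mul.mul_left_cancel ?_
      rw [← mul_assoc, Ring.mul_inverse_cancel _ hR.isUnit_flip_mul, one_mul, Bialgebra.comul_mul,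
        ← mul_assoc, hR.flip_mul_comul_drinfeldElement, h1, Algebra.TensorProduct.tmul_mul_tmul]
    · rw [Subalgebra.mem_center_iff]
      intro x
      obtain ⟨y, rfl⟩ := hR.antipode_antipode_surjective x
      change antipode k (antipode k y) * _ = _ * antipode k (antipode k y)
      rw [mul_assoc, h3, ← mul_assoc, ← hR.drinfeldElement_mul, mul_assoc]

end FiniteDimensional

end IsUniversalRMatrix
end Quasitriangular

/-! ### The canonical `R`-matrix of the Drinfeld double -/

section Double

open TensorProduct Coalgebra HopfAlgebra

namespace DrinfeldDouble

variable {k H : Type*} [Field k] [Ring H] [HopfAlgebra k H]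

section Relation

variable [HasBijectiveAntipode k H]

variable (k H) in
/-- The embedding `h ↦ ε ⊗ h` of `H` into `D(H)`. -/
noncomputable def inH : H →ₗ[k] DrinfeldDouble k H := mk k H 1

variable (k H) in
/-- The embedding `p ↦ p ⊗ 1` of `(H^*)^cop` into `D(H)`. -/
noncomputable def inDual : DualCop k H →ₗ[k] DrinfeldDouble k H := (mk k H).flip 1

theorem inH_apply (h : H) : inH k H h = tmul 1 h := rfl
theorem inDual_apply (p : DualCop k H) : inDual k H p = tmul p 1 := rfl

theorem inH_mul (h l : H) : inH k H (h * l) = inH k H h * inH k H l :=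
  (mul_one_tmul 1 h l).symm

theorem inDual_mul (p q : DualCop k H) : inDual k H (p * q) = inDual k H p * inDual k H q :=
  (tmul_one_mul p q 1).symm

theorem inDual_mul_inH (p : DualCop k H) (h : H) : inDual k H p * inH k H h = tmul p h := by
  rw [inDual_apply, inH_apply, mul_one_tmul, one_mul]

theorem inH_one : inH k H 1 = 1 := rfl
theorem inDual_one : inDual k H 1 = 1 := rfl

/-- `x ⊗ y ↦ (ε ⊗ x) ((q ↼ y) ⊗ 1)` -/
noncomputable def leftStraight (q : DualCop k H) : H ⊗[k] H →ₗ[k] DrinfeldDouble k H :=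
  LinearMap.mul' k _ ∘ₗ TensorProduct.map (inH k H) (inDual k H ∘ₗ ract.flip q)

/-- `x ⊗ y ↦ (x ⇀ q) ⊗ y` -/
noncomputable def rightStraight (q : DualCop k H) : H ⊗[k] H →ₗ[k] DrinfeldDouble k H :=
  LinearMap.mul' k _ ∘ₗ TensorProduct.map (inDual k H ∘ₗ lact.flip q) (inH k H)

theorem leftStraight_tmul (q : DualCop k H) (x y : H) :
    leftStraight q (x ⊗ₜ y) = inH k H x * inDual k H (ract y q) := rfl

theorem rightStraight_tmul (q : DualCop k H) (x y : H) :
    rightStraight q (x ⊗ₜ y) = inDual k H (lact x q) * inH k H y := rfl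

/-- The straightening rule `(ε ⊗ h₍₁₎) ((q ↼ h₍₂₎) ⊗ 1) = (h₍₁₎ ⇀ q) ⊗ h₍₂₎` of `D(H)`. It is the
form of the multiplication of `D(H)` that does not involve `s⁻¹`. -/
theorem leftStraight_comul (q : DualCop k H) (h : H) :
    leftStraight q (comul h) = rightStraight q (comul h) := by
  -- `N (a ⊗ b ⊗ d) = (a ⇀ q ↼ d) ⊗ b`
  let N : H ⊗[k] (H ⊗[k] H) →ₗ[k] DrinfeldDouble k H :=
    TensorProduct.lift
    ((TensorProduct.lift.equiv (.id k) H H (DrinfeldDouble k H)).toLinearMap ∘ₗ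
      LinearMap.mk₂ k (fun a b => (mk k H).flip b ∘ₗ (ract.flip (lact a q)))
        (fun a a' b => by ext c; simp)
        (fun r a b => by ext c; simp)
        (fun a b b' => by ext c; simp)
        (fun r a b => by ext c; simp))
  have hN : ∀ a b d, N (a ⊗ₜ (b ⊗ₜ d)) = tmul (ract d (lact a q)) b := fun _ _ _ => rfl
  let W : H ⊗[k] H →ₗ[k] H := LinearMap.mul' k H ∘ₗ
    TensorProduct.map LinearMap.id (antipodeInv k H) ∘ₗ (TensorProduct.comm k H H).toLinearMap
  let V : (H ⊗[k] (H ⊗[k] H)) ⊗[k] H →ₗ[k] H ⊗[k] (H ⊗[k] (H ⊗[k] H)) :=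
    TensorProduct.map LinearMap.id (TensorProduct.assoc k H H H).toLinearMap ∘ₗ
      (TensorProduct.assoc k H (H ⊗[k] H) H).toLinearMap
  have hV : V ∘ₗ TensorProduct.map comul3 LinearMap.id ∘ₗ (comul (R := k) : H →ₗ[k] H ⊗[k] H) =
      TensorProduct.map LinearMap.id (TensorProduct.map LinearMap.id comul) ∘ₗ comul3 := by
    simp only [V, comul3, coassoc_simps]
  have e1 : ∀ t : H ⊗[k] H, leftStraight q t = N (TensorProduct.map LinearMap.id
      (TensorProduct.map LinearMap.id W) (V (TensorProduct.map comul3 LinearMap.id t))) := by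
    intro t
    induction t with
    | zero => simp
    | add x y hx hy => simp only [map_add, hx, hy]
    | tmul x y =>
      rw [leftStraight_tmul, inH_apply, inDual_apply, one_tmul_mul, TensorProduct.map_tmul]
      generalize comul3 (k := k) x = t
      induction t with
      | zero => simp
      | add x y hx hy => simp only [map_add, TensorProduct.add_tmul, hx, hy]
      | tmul a t =>
        induction t with
        | zero => simp
        | add x y hx hy => simp only [map_add, TensorProduct.add_tmul, TensorProduct.tmul_add, hx,
            hy]
        | tmul b c =>
          rw [crossAux_tmul]
          change _ = N (a ⊗ₜ (b ⊗ₜ (y * antipodeInv k H c)))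
          rw [hN]
          congr 1
          apply DualCop.ext
          intro x
          simp only [ract_apply, lact_apply, mul_assoc]
  have e2 : TensorProduct.map LinearMap.id (TensorProduct.map LinearMap.id W)
      (V (TensorProduct.map comul3 LinearMap.id (comul h))) = TensorProduct.map LinearMap.id
        (TensorProduct.map LinearMap.id (W ∘ₗ comul)) (comul3 h) := by
    have h3 := congrArg (fun f => TensorProduct.map LinearMap.id
      (TensorProduct.map LinearMap.id W) (f h)) hV
    refine Eq.trans h3 ?_
    simp only [LinearMap.comp_apply]
    generalize comul3 (k := k) h = t
    induction t with
    | zero => simp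
    | add x y hx hy => simp only [map_add, hx, hy]
    | tmul a t =>
      induction t with
      | zero => simp
      | add x y hx hy => simp only [map_add, TensorProduct.tmul_add, hx, hy]
      | tmul b c => simp
  have e3 : (W ∘ₗ comul : H →ₗ[k] H) = (LinearMap.toSpanSingleton k H 1) ∘ₗ counit := by
    refine LinearMap.ext fun x => ?_
    refine (mul_antipodeInv_comul x).trans ?_
    simp [Algebra.algebraMap_eq_smul_one]
  rw [e1, e2, e3, comul3]
  simp only [LinearMap.comp_apply]
  generalize (comul (R := k) h : H ⊗[k] H) = t
  induction t with
  | zero => simp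
  | add x y hx hy => simp only [map_add, hx, hy]
  | tmul x y =>
    rw [TensorProduct.map_tmul, rightStraight_tmul, inDual_mul_inH]
    have e4 : ∀ s : H ⊗[k] H, N (TensorProduct.map LinearMap.id (TensorProduct.map LinearMap.id
        (LinearMap.toSpanSingleton k H 1 ∘ₗ counit)) (x ⊗ₜ s)) =
        tmul (lact x q) (TensorProduct.rid k H (LinearMap.lTensor H counit s)) := by
      intro s
      induction s with
      | zero => simp [← mk_apply]
      | add x y hx hy => simp only [map_add, TensorProduct.tmul_add, hx, hy, tmul_add]
      | tmul b c =>
        have : ract (1 : H) (lact x q) = lact x q := DualCop.ext fun y => by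
          rw [ract_apply, one_mul]
        simp [hN, this, tmul_smul]
    rw [LinearMap.id_apply, e4, lTensor_counit_comul]
    simp

end Relation

section Canonical

variable [Module.Finite k H]

/-- The functional dual to the `i`-th vector of a basis. -/
noncomputable def dualVec {ι : Type*} (b : Module.Basis ι k H) (i : ι) : DualCop k H :=
  (DualCop.toDual k H).symm (b.coord i)

section Basis
variable {ι : Type*} [Fintype ι] (b : Module.Basis ι k H)

theorem dualVec_apply (i : ι) (x : H) : dualVec b i x = b.coord i x := rfl

theorem sum_dualVec_smul {V : Type*} [AddCommGroup V] [Module k V] (f : H →ₗ[k] V) (x : H) :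
    ∑ i, dualVec b i x • f (b i) = f x := by
  conv_rhs => rw [← b.sum_repr x, map_sum]
  simp [dualVec_apply]

theorem sum_smul_dualVec {V : Type*} [AddCommGroup V] [Module k V] (f : DualCop k H →ₗ[k] V)
    (p : DualCop k H) : ∑ i, p (b i) • f (dualVec b i) = f p := by
  have : p = ∑ i, p (b i) • dualVec b i := by
    apply (DualCop.toDual k H).injective
    refine b.ext fun j => ?_
    classical
    simp only [map_sum, map_smul, LinearMap.sum_apply, LinearMap.smul_apply]
    rw [Finset.sum_eq_single j]
    · simp [dualVec]
    · intro i _ hij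
      simp [dualVec, hij.symm]
    · simp
  conv_rhs => rw [this, map_sum]
  simp

/-- An endomorphism of `H` may be moved across the canonical element `∑ hᵢ ⊗ hⁱ`, where it turns
into its transpose. -/
theorem sum_transpose {V W : Type*} [AddCommGroup V] [Module k V] [AddCommGroup W] [Module k W]
    (F : H →ₗ[k] V) (G : DualCop k H →ₗ[k] W) (T : H →ₗ[k] H) (T' : DualCop k H → DualCop k H)
    (hT : ∀ p x, T' p x = p (T x)) :
    ∑ i, F (T (b i)) ⊗ₜ[k] G (dualVec b i) = ∑ i, F (b i) ⊗ₜ[k] G (T' (dualVec b i)) := by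
  have h1 : ∀ i, F (T (b i)) = ∑ j, dualVec b j (T (b i)) • F (b j) := fun i =>
    (sum_dualVec_smul b F _).symm
  have h2 : ∀ j, G (T' (dualVec b j)) = ∑ i, dualVec b j (T (b i)) • G (dualVec b i) := fun j => by
    rw [← sum_smul_dualVec b G]
    simp only [hT]
  simp only [h1, h2, TensorProduct.sum_tmul, TensorProduct.tmul_sum]
  rw [Finset.sum_comm]
  simp only [TensorProduct.smul_tmul]

/-- The comultiplication of `(H^*)^cop` pairs with `x ⊗ y` to `p(y x)`, so its second leg may be
expanded in the dual basis. -/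
theorem comul_eq_sum_ract (p : DualCop k H) :
    comul (R := k) p = ∑ i, ract (b i) p ⊗ₜ[k] dualVec b i := by
  apply (DualCop.pair_bijective k H).1
  ext x y
  change DualCop.pair k H _ (x ⊗ₜ y) = DualCop.pair k H _ (x ⊗ₜ y)
  rw [DualCop.pair_comul, map_sum, LinearMap.sum_apply]
  simp only [DualCop.pair_tmul, ract_apply]
  exact (sum_dualVec_smul b (DualCop.toDual k H p ∘ₗ LinearMap.mulRight k x) y).symm.trans
    (Finset.sum_congr rfl fun i _ => mul_comm _ _)

theorem comul_eq_sum_lact (p : DualCop k H) :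
    comul (R := k) p = ∑ i, dualVec b i ⊗ₜ[k] lact (b i) p := by
  apply (DualCop.pair_bijective k H).1
  ext x y
  change DualCop.pair k H _ (x ⊗ₜ y) = DualCop.pair k H _ (x ⊗ₜ y)
  rw [DualCop.pair_comul, map_sum, LinearMap.sum_apply]
  simp only [DualCop.pair_tmul, lact_apply]
  exact (sum_dualVec_smul b (DualCop.toDual k H p ∘ₗ LinearMap.mulLeft k y) x).symm

variable [HasBijectiveAntipode k H]

/-- `f ↦ ∑ f(hᵢ) ⊗ (hⁱ ⊗ 1)`, the identification of `Hom(H, B)` with `B ⊗ H^*`. -/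
noncomputable def homTensor {B : Type*} [Ring B] [Algebra k B] (f : H →ₗ[k] B) :
    B ⊗[k] DrinfeldDouble k H := ∑ i, f (b i) ⊗ₜ[k] inDual k H (dualVec b i)

/-- `homTensor` turns the convolution product into the product of `B ⊗ D(H)`. -/
theorem homTensor_mul {B : Type*} [Ring B] [Algebra k B] (f g : H →ₗ[k] B) :
    homTensor b f * homTensor b g =
      homTensor b (LinearMap.mul' k B ∘ₗ TensorProduct.map f g ∘ₗ comul) := by
  have h1 : ∀ t : H ⊗[k] H, ∑ i, ∑ j, LinearMap.mul' k k (TensorProduct.map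
      (DualCop.toDual k H (dualVec b i)) (DualCop.toDual k H (dualVec b j)) t) •
        (f (b i) * g (b j)) = LinearMap.mul' k B (TensorProduct.map f g t) := by
    intro t
    induction t with
    | zero => simp
    | add x y hx hy => simp only [map_add, add_smul, Finset.sum_add_distrib, hx, hy]
    | tmul x y =>
      rw [TensorProduct.map_tmul, LinearMap.mul'_apply, ← sum_dualVec_smul b f x,
        ← sum_dualVec_smul b g y, Finset.sum_mul_sum]
      refine Finset.sum_congr rfl fun i _ => Finset.sum_congr rfl fun j _ => ?_
      rw [smul_mul_smul_comm]
      rfl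
  simp only [homTensor, Finset.sum_mul_sum, Algebra.TensorProduct.tmul_mul_tmul, ← inDual_mul,
    LinearMap.comp_apply, ← h1, TensorProduct.sum_tmul]
  conv_rhs => rw [Finset.sum_comm]; enter [2, i]; rw [Finset.sum_comm]
  refine Finset.sum_congr rfl fun i _ => Finset.sum_congr rfl fun j _ => ?_
  rw [← sum_smul_dualVec b (inDual k H) (dualVec b i * dualVec b j), TensorProduct.tmul_sum]
  refine Finset.sum_congr rfl fun m _ => ?_
  rw [DualCop.mul_apply, TensorProduct.tmul_smul, TensorProduct.smul_tmul']

theorem homTensor_counit {B : Type*} [Ring B] [Algebra k B] :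
    homTensor b (Algebra.linearMap k B ∘ₗ counit) = 1 := by
  have h := sum_smul_dualVec b (inDual k H) 1
  simp only [DualCop.one_apply, inDual_one] at h
  rw [homTensor, Algebra.TensorProduct.one_def, ← h, TensorProduct.tmul_sum]
  refine Finset.sum_congr rfl fun i _ => ?_
  simp [Algebra.algebraMap_eq_smul_one, TensorProduct.smul_tmul]

theorem rMatrix_eq_homTensor : rMatrix k H = homTensor b (inH k H) :=
  (rMatrixOfBasis_eq k H b).symm

theorem isUnit_rMatrix : IsUnit (rMatrix k H) := by
  let b := Module.finBasis k H
  have h1 : rMatrix k H * homTensor b (inH k H ∘ₗ antipode k) = 1 := by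
    rw [rMatrix_eq_homTensor b, homTensor_mul, ← homTensor_counit b]
    congr 1
    refine LinearMap.ext fun x => ?_
    have h : ∀ t : H ⊗[k] H, LinearMap.mul' k (DrinfeldDouble k H) (TensorProduct.map (inH k H)
        (inH k H ∘ₗ antipode k) t) =
        inH k H (LinearMap.mul' k H (LinearMap.lTensor H (antipode k) t)) := by
      intro t
      induction t with
      | zero => simp
      | add x y hx hy => simp only [map_add, hx, hy]
      | tmul x y => simp [inH_mul]
    simp [h, mul_antipode_lTensor_comul_apply, Algebra.algebraMap_eq_smul_one, inH_one]
  have h2 : homTensor b (inH k H ∘ₗ antipode k) * rMatrix k H = 1 := by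
    rw [rMatrix_eq_homTensor b, homTensor_mul, ← homTensor_counit b]
    congr 1
    refine LinearMap.ext fun x => ?_
    have h : ∀ t : H ⊗[k] H, LinearMap.mul' k (DrinfeldDouble k H)
        (TensorProduct.map (inH k H ∘ₗ antipode k) (inH k H) t) =
        inH k H (LinearMap.mul' k H (LinearMap.rTensor H (antipode k) t)) := by
      intro t
      induction t with
      | zero => simp
      | add x y hx hy => simp only [map_add, hx, hy]
      | tmul x y => simp [inH_mul]
    simp [h, mul_antipode_rTensor_comul_apply, Algebra.algebraMap_eq_smul_one, inH_one]
  exact ⟨⟨_, _, h1, h2⟩, rfl⟩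

theorem comul_inH (h : H) : comul (R := k) (inH k H h) =
    TensorProduct.map (inH k H) (inH k H) (comul h) := by
  rw [inH_apply, comul_tmul, comul_dual_one]
  generalize (comul (R := k) h : H ⊗[k] H) = t
  induction t with
  | zero => simp
  | add x y hx hy => simp only [map_add, TensorProduct.tmul_add, hx, hy]
  | tmul x y => rfl

theorem comul_inDual (p : DualCop k H) : comul (R := k) (inDual k H p) =
    TensorProduct.map (inDual k H) (inDual k H) (comul p) := by
  rw [inDual_apply, comul_tmul, Bialgebra.comul_one, Algebra.TensorProduct.one_def]
  generalize (comul (R := k) p : DualCop k H ⊗[k] DualCop k H) = t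
  induction t with
  | zero => simp
  | add x y hx hy => simp only [map_add, TensorProduct.add_tmul, hx, hy]
  | tmul x y => rfl

/-- On `H` the quasi-cocommutativity is the straightening rule, once `R` is written in dual bases
and multiplications on `H` are transposed to the dual. -/
theorem flip_comul_inH_mul (h : H) :
    tensorFlip k (comul (inH k H h)) * rMatrix k H = rMatrix k H * comul (inH k H h) := by
  let b := Module.finBasis k H
  have e1 : ∀ t : H ⊗[k] H, tensorFlip k (TensorProduct.map (inH k H) (inH k H) t) *
      rMatrix k H = ∑ i, inH k H (b i) ⊗ₜ[k] leftStraight (dualVec b i) t := by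
    intro t
    induction t with
    | zero => simp [tensorFlip]
    | add x y hx hy =>
      simp only [tensorFlip, map_add, add_mul, TensorProduct.tmul_add,
        Finset.sum_add_distrib] at hx hy ⊢
      rw [hx, hy]
    | tmul x y =>
      simp only [leftStraight_tmul]
      rw [rMatrix_eq_homTensor b, homTensor]
      refine Eq.trans ?_ (sum_transpose b (inH k H)
        (LinearMap.mulLeft k (inH k H x) ∘ₗ inDual k H) (LinearMap.mulLeft k y) (ract y)
        (fun _ _ => rfl))
      simp [tensorFlip, Finset.mul_sum, inH_mul]
  have e2 : ∀ t : H ⊗[k] H, rMatrix k H * TensorProduct.map (inH k H) (inH k H) t =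
      ∑ i, inH k H (b i) ⊗ₜ[k] rightStraight (dualVec b i) t := by
    intro t
    induction t with
    | zero => simp
    | add x y hx hy =>
      simp only [map_add, mul_add, TensorProduct.tmul_add, Finset.sum_add_distrib, hx, hy]
    | tmul x y =>
      simp only [rightStraight_tmul]
      rw [rMatrix_eq_homTensor b, homTensor]
      refine Eq.trans ?_ (sum_transpose b (inH k H)
        (LinearMap.mulRight k (inH k H y) ∘ₗ inDual k H) (LinearMap.mulRight k x) (lact x)
        (fun _ _ => rfl))
      simp [Finset.sum_mul, inH_mul]
  rw [comul_inH, e1, e2]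
  simp only [leftStraight_comul]

/-- On the dual the quasi-cocommutativity is the straightening rule, read through `homTensor`. -/
theorem flip_comul_inDual_mul (p : DualCop k H) :
    tensorFlip k (comul (inDual k H p)) * rMatrix k H = rMatrix k H * comul (inDual k H p) := by
  let b := Module.finBasis k H
  have e1 : comul (R := k) (inDual k H p) = homTensor b (inDual k H ∘ₗ ract.flip p) := by
    rw [comul_inDual, comul_eq_sum_ract b, map_sum]
    rfl
  have e2 : tensorFlip k (comul (inDual k H p)) = homTensor b (inDual k H ∘ₗ lact.flip p) := by
    rw [comul_inDual, comul_eq_sum_lact b, map_sum, tensorFlip, map_sum]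
    rfl
  rw [e1, e1.symm, e2, e1, rMatrix_eq_homTensor b, homTensor_mul, homTensor_mul]
  congr 1
  exact LinearMap.ext fun x => (leftStraight_comul p x).symm

variable (k H) in
/-- The canonical element of `D(H) ⊗ D(H)` is a universal `R`-matrix. -/
theorem isUniversalRMatrix_rMatrix : IsUniversalRMatrix k (rMatrix k H) where
  isUnit := isUnit_rMatrix
  flip_comul X := by
    have key : tensorFlip k (comul X) * rMatrix k H = rMatrix k H * comul X := by
      induction X using induction_on with
      | zero => simp [tensorFlip]
      | add X Y hX hY =>
        simp only [tensorFlip, map_add, add_mul, mul_add] at hX hY ⊢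
        rw [hX, hY]
      | tm p h =>
        rw [← inDual_mul_inH, Bialgebra.comul_mul, tensorFlip_mul, mul_assoc, flip_comul_inH_mul,
          ← mul_assoc, flip_comul_inDual_mul, mul_assoc]
    rw [← key, mul_assoc, Ring.mul_inverse_cancel _ isUnit_rMatrix, mul_one]
  comul_left := by
    let b := Module.finBasis k H
    let iL : DrinfeldDouble k H →ₐ[k] DrinfeldDouble k H ⊗[k] DrinfeldDouble k H :=
      Algebra.TensorProduct.includeLeft
    let iR : DrinfeldDouble k H →ₐ[k] DrinfeldDouble k H ⊗[k] DrinfeldDouble k H :=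
      Algebra.TensorProduct.includeRight
    have h1 := homTensor_mul b (iL.toLinearMap ∘ₗ inH k H) (iR.toLinearMap ∘ₗ inH k H)
    have h2 : LinearMap.mul' k _ ∘ₗ TensorProduct.map (iL.toLinearMap ∘ₗ inH k H)
        (iR.toLinearMap ∘ₗ inH k H) ∘ₗ comul = comul ∘ₗ inH k H := by
      refine LinearMap.ext fun x => ?_
      simp only [LinearMap.comp_apply, comul_inH]
      generalize (comul (R := k) x : H ⊗[k] H) = t
      induction t with
      | zero => simp
      | add x y hx hy => simp only [map_add, hx, hy]
      | tmul x y => simp [iL, iR]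
    rw [h2] at h1
    have h3 := congrArg (Algebra.TensorProduct.assoc k k k (DrinfeldDouble k H)
      (DrinfeldDouble k H) (DrinfeldDouble k H)) h1
    rw [map_mul] at h3
    rw [rMatrix_eq_homTensor b]
    simp only [homTensor, map_sum, leg13, leg23, LinearMap.rTensor_tmul, LinearMap.lTensor_tmul,
      LinearMap.comp_apply, TensorProduct.tmul_sum] at h3 ⊢
    exact h3.symm
  comul_right := by
    let b := Module.finBasis k H
    rw [rMatrix_eq_homTensor b]
    simp only [homTensor, map_sum, leg13, leg12, LinearMap.lTensor_tmul, TensorProduct.sum_tmul,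
      Finset.sum_mul_sum]
    have h1 : ∀ i, comul (R := k) (inDual k H (dualVec b i)) =
        ∑ j, inDual k H (ract (b j) (dualVec b i)) ⊗ₜ[k] inDual k H (dualVec b j) := fun i => by
      rw [comul_inDual, comul_eq_sum_ract b, map_sum]; rfl
    simp only [h1, TensorProduct.tmul_sum]
    rw [Finset.sum_comm]
    refine Finset.sum_congr rfl fun j _ => ?_
    have h2 := sum_transpose b (inH k H)
      ((TensorProduct.mk k (DrinfeldDouble k H) (DrinfeldDouble k H)).flip
        (inDual k H (dualVec b j)) ∘ₗ inDual k H) (LinearMap.mulLeft k (b j)) (ract (b j))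
        (fun _ _ => rfl)
    refine h2.symm.trans (Finset.sum_congr rfl fun i _ => ?_)
    simp [inH_mul]

end Basis
end Canonical
end DrinfeldDouble
end Double

/-! ### Characters, group-like elements and traces on the Drinfeld double -/

section Double

open TensorProduct Coalgebra HopfAlgebra

section Translations

variable {k H : Type*} [Field k] [Ring H] [HopfAlgebra k H]

/-- A character of `H`, as an element of `(H^*)^cop`. -/
noncomputable def charDual (χ : H →ₐ[k] k) : DualCop k H := (DualCop.toDual k H).symm χ.toLinearMap

theorem charDual_apply (χ : H →ₐ[k] k) (x : H) : charDual χ x = χ x := rfl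

/-- The algebra map `h ↦ h₍₁₎ χ(h₍₂₎)`. -/
noncomputable def rightTrans (χ : H →ₐ[k] k) : H →ₐ[k] H :=
  ((Algebra.TensorProduct.rid k k H).toAlgHom.comp
    (Algebra.TensorProduct.map (AlgHom.id k H) χ)).comp (Bialgebra.comulAlgHom k H)

/-- The algebra map `h ↦ χ(h₍₁₎) h₍₂₎`. -/
noncomputable def leftTrans (χ : H →ₐ[k] k) : H →ₐ[k] H :=
  ((Algebra.TensorProduct.lid k H).toAlgHom.comp
    (Algebra.TensorProduct.map χ (AlgHom.id k H))).comp (Bialgebra.comulAlgHom k H)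

theorem rightTrans_eq (χ : H →ₐ[k] k) (x : H) :
    rightTrans χ x = TensorProduct.rid k H (χ.toLinearMap.lTensor H (comul x)) := rfl

theorem leftTrans_eq (χ : H →ₐ[k] k) (x : H) :
    leftTrans χ x = TensorProduct.lid k H (χ.toLinearMap.rTensor H (comul x)) := rfl

theorem rightTrans_of_comul_eq (χ : H →ₐ[k] k) {g : H} (hg : comul (R := k) g = g ⊗ₜ[k] g) :
    rightTrans χ g = χ g • g := by simp [rightTrans_eq, hg]

theorem leftTrans_of_comul_eq (χ : H →ₐ[k] k) {g : H} (hg : comul (R := k) g = g ⊗ₜ[k] g) :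
    leftTrans χ g = χ g • g := by simp [leftTrans_eq, hg]

theorem mul_charDual_apply (p : DualCop k H) (χ : H →ₐ[k] k) (x : H) :
    (p * charDual χ) x = p (rightTrans χ x) := by
  rw [DualCop.mul_apply, rightTrans_eq]
  generalize (comul (R := k) x : H ⊗[k] H) = t
  induction t with
  | zero => simp
  | add x y hx hy => simp only [map_add, hx, hy]
  | tmul x y => simp [charDual, mul_comm]

theorem charDual_mul_apply (p : DualCop k H) (χ : H →ₐ[k] k) (x : H) :
    (charDual χ * p) x = p (leftTrans χ x) := by
  rw [DualCop.mul_apply, leftTrans_eq]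
  generalize (comul (R := k) x : H ⊗[k] H) = t
  induction t with
  | zero => simp
  | add x y hx hy => simp only [map_add, hx, hy]
  | tmul x y => simp [charDual]

theorem isUnit_of_comul_eq {g : H} (hg : comul (R := k) g = g ⊗ₜ[k] g)
    (hε : counit (R := k) g = 1) : IsUnit g := by
  have h1 := mul_antipode_lTensor_comul_apply (R := k) g
  have h2 := mul_antipode_rTensor_comul_apply (R := k) g
  rw [hg, hε, map_one] at h1 h2
  exact ⟨⟨g, antipode k g, h1, h2⟩, rfl⟩

end Translations

namespace DrinfeldDouble

variable {k H : Type*} [Field k] [Ring H] [HopfAlgebra k H] [HasBijectiveAntipode k H]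

theorem ract_charDual (χ : H →ₐ[k] k) (y : H) : ract y (charDual χ) = χ y • charDual χ :=
  DualCop.ext fun x => map_mul χ y x

theorem lact_charDual (χ : H →ₐ[k] k) (y : H) : lact y (charDual χ) = χ y • charDual χ :=
  DualCop.ext fun x => (map_mul χ x y).trans (mul_comm _ _)

/-- The straightening rule for a character. -/
theorem inH_rightTrans_mul (χ : H →ₐ[k] k) (h : H) :
    inH k H (rightTrans χ h) * inDual k H (charDual χ) =
      inDual k H (charDual χ) * inH k H (leftTrans χ h) := by
  have e1 : ∀ t : H ⊗[k] H, leftStraight (charDual χ) t =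
      inH k H (TensorProduct.rid k H (χ.toLinearMap.lTensor H t)) * inDual k H (charDual χ) := by
    intro t
    induction t with
    | zero => simp
    | add x y hx hy => simp only [map_add, hx, hy, add_mul]
    | tmul x y => simp [leftStraight_tmul, ract_charDual]
  have e2 : ∀ t : H ⊗[k] H, rightStraight (charDual χ) t =
      inDual k H (charDual χ) * inH k H (TensorProduct.lid k H (χ.toLinearMap.rTensor H t)) := by
    intro t
    induction t with
    | zero => simp
    | add x y hx hy => simp only [map_add, hx, hy, mul_add]
    | tmul x y => simp [rightStraight_tmul, lact_charDual]
  have := leftStraight_comul (charDual χ) h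
  rwa [e1, e2] at this

/-- The straightening rule for a group-like element. -/
theorem inH_mul_inDual_ract (p : DualCop k H) {g : H} (hg : comul (R := k) g = g ⊗ₜ[k] g) :
    inH k H g * inDual k H (ract g p) = inDual k H (lact g p) * inH k H g := by
  have := leftStraight_comul p g
  rwa [hg, leftStraight_tmul, rightStraight_tmul] at this

theorem inH_mul_inDual_charDual (χ : H →ₐ[k] k) {g : H} (hg : comul (R := k) g = g ⊗ₜ[k] g)
    (hε : counit (R := k) g = 1) :
    inH k H g * inDual k H (charDual χ) = inDual k H (charDual χ) * inH k H g := by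
  have h := inH_rightTrans_mul χ g
  rw [rightTrans_of_comul_eq χ hg, leftTrans_of_comul_eq χ hg, map_smul, smul_mul_assoc,
    mul_smul_comm] at h
  exact smul_right_injective _ ((isUnit_of_comul_eq hg hε).map χ).ne_zero h

theorem tmul_charDual_mul_tmul (χ χ' : H →ₐ[k] k) {g g' : H} (hg : comul (R := k) g = g ⊗ₜ[k] g)
    (hε : counit (R := k) g = 1) : tmul (charDual χ) g * tmul (charDual χ') g' =
      tmul (charDual χ * charDual χ') (g * g') := by
  rw [← inDual_mul_inH, ← inDual_mul_inH, ← inDual_mul_inH, inDual_mul, inH_mul, mul_assoc,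
    ← mul_assoc (inH k H g), inH_mul_inDual_charDual χ' hg hε]
  simp only [mul_assoc]

variable [Module.Finite k H]

theorem antipode_inH (h : H) : antipode k (inH k H h) = inH k H (antipode k h) := by
  have h1 : dualAntipodeInv (1 : DualCop k H) = 1 := DualCop.ext fun x => by
    rw [dualAntipodeInv_apply, DualCop.one_apply, DualCop.one_apply, counit_antipodeInv]
  change antipodeMap (tmul 1 h) = _
  rw [antipodeMap_tmul, h1, ← one_def, mul_one]
  rfl

theorem antipode_inDual (p : DualCop k H) :
    antipode k (inDual k H p) = inDual k H (dualAntipodeInv p) := by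
  change antipodeMap (tmul p 1) = _
  rw [antipodeMap_tmul, antipode_one, ← one_def, one_mul]
  rfl

theorem comul_charDual (χ : H →ₐ[k] k) :
    comul (R := k) (charDual χ) = charDual χ ⊗ₜ[k] charDual χ := by
  let b := Module.finBasis k H
  rw [comul_eq_sum_ract b]
  simp only [ract_charDual, TensorProduct.smul_tmul]
  rw [← TensorProduct.tmul_sum]
  congr 1
  exact sum_smul_dualVec b LinearMap.id (charDual χ)

theorem comul_tmul_charDual (χ : H →ₐ[k] k) {g : H} (hg : comul (R := k) g = g ⊗ₜ[k] g) :
    comul (R := k) (tmul (charDual χ) g) = tmul (charDual χ) g ⊗ₜ[k] tmul (charDual χ) g := by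
  rw [comul_tmul, comul_charDual, hg, shuffle_tmul]

theorem counit_tmul_charDual (χ : H →ₐ[k] k) {g : H} (hε : counit (R := k) g = 1) :
    counit (R := k) (tmul (charDual χ) g) = 1 := by
  rw [counit_tmul, hε, charDual_apply, map_one, mul_one]

/-- Every group-like element of `D(H)` is `χ ⊗ g` with a character `χ` and a group-like `g`. -/
theorem exists_eq_tmul_charDual {w : DrinfeldDouble k H} (hw : comul (R := k) w = w ⊗ₜ[k] w)
    (hε : counit (R := k) w = 1) : ∃ (χ : H →ₐ[k] k) (g : H), comul (R := k) g = g ⊗ₜ[k] g ∧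
      counit (R := k) g = 1 ∧ w = tmul (charDual χ) g := by
  -- the coalgebra maps `id ⊗ ε` and `ε ⊗ id`
  let P : DrinfeldDouble k H →ₗ[k] DualCop k H := tlift
    ((LinearMap.lsmul k (DualCop k H)).flip.compl₂ (counit (R := k) (A := H)))
  let G : DrinfeldDouble k H →ₗ[k] H := tlift
    ((LinearMap.lsmul k H).comp (counit (R := k) (A := DualCop k H)))
  have hP : ∀ p h, P (tmul p h) = counit (R := k) h • p := fun _ _ => rfl
  have hG : ∀ p h, G (tmul p h) = p 1 • h := fun _ _ => rfl
  let E : H → DrinfeldDouble k H →ₗ[k] k := fun x =>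
    LinearMap.applyₗ x ∘ₗ (DualCop.toDual k H).toLinearMap ∘ₗ P
  have hPG : ∀ X : DrinfeldDouble k H, LinearMap.mul' k _
      (TensorProduct.map (inDual k H ∘ₗ P) (inH k H ∘ₗ G) (comul X)) = X := by
    intro X
    induction X using induction_on with
    | zero => simp
    | add X Y hX hY => simp only [map_add, hX, hY]
    | tm p h =>
      have : ∀ (s : DualCop k H ⊗[k] DualCop k H) (t : H ⊗[k] H), LinearMap.mul' k _
          (TensorProduct.map (inDual k H ∘ₗ P) (inH k H ∘ₗ G) (shuffle k H (s ⊗ₜ t))) =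
          tmul (TensorProduct.rid k _ (LinearMap.lTensor _ counit s))
            (TensorProduct.lid k _ (LinearMap.rTensor _ counit t)) := by
        intro s t
        induction s with
        | zero => simp [← mk_apply]
        | add x y hx hy => simp only [map_add, TensorProduct.add_tmul, hx, hy, add_tmul]
        | tmul p q =>
          induction t with
          | zero => simp [← mk_apply]
          | add x y hx hy => simp only [map_add, TensorProduct.tmul_add, hx, hy, tmul_add]
          | tmul x y =>
            simp [shuffle_tmul, hP, hG, inDual_mul_inH, DualCop.counit_apply, tmul_smul,
              smul_tmul, smul_comm (q 1)]
      rw [comul_tmul, this, lTensor_counit_comul, rTensor_counit_comul]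
      simp
  have hGG : ∀ X : DrinfeldDouble k H, comul (R := k) (G X) =
      TensorProduct.map G G (comul X) := by
    intro X
    induction X using induction_on with
    | zero => simp
    | add X Y hX hY => simp only [map_add, hX, hY]
    | tm p h =>
      have : ∀ (s : DualCop k H ⊗[k] DualCop k H) (t : H ⊗[k] H),
          TensorProduct.map G G (shuffle k H (s ⊗ₜ t)) = DualCop.pair k H s (1 ⊗ₜ 1) • t := by
        intro s t
        induction s with
        | zero => simp
        | add x y hx hy => simp only [map_add, TensorProduct.add_tmul, hx, hy,
            LinearMap.add_apply, add_smul]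
        | tmul p q =>
          induction t with
          | zero => simp
          | add x y hx hy => simp only [map_add, TensorProduct.tmul_add, hx, hy, smul_add]
          | tmul x y =>
            simp [shuffle_tmul, hG, DualCop.pair_tmul, ← TensorProduct.smul_tmul', smul_smul,
              mul_comm]
      rw [comul_tmul, this, DualCop.pair_comul, hG, map_smul, mul_one]
  have hE : ∀ (X : DrinfeldDouble k H) (x y : H), E (y * x) X =
      LinearMap.mul' k k (TensorProduct.map (E x) (E y) (comul X)) := by
    intro X x y
    induction X using induction_on with
    | zero => simp
    | add X Y hX hY => simp only [map_add, hX, hY]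
    | tm p h =>
      have : ∀ (s : DualCop k H ⊗[k] DualCop k H) (t : H ⊗[k] H),
          LinearMap.mul' k k (TensorProduct.map (E x) (E y) (shuffle k H (s ⊗ₜ t))) =
            DualCop.pair k H s (x ⊗ₜ y) * counit (R := k)
              (TensorProduct.lid k H (LinearMap.rTensor H counit t)) := by
        intro s t
        induction s with
        | zero => simp
        | add x y hx hy => simp only [map_add, TensorProduct.add_tmul, hx, hy,
            LinearMap.add_apply, add_mul]
        | tmul p q =>
          induction t with
          | zero => simp
          | add x y hx hy => simp only [map_add, TensorProduct.tmul_add, hx, hy, mul_add]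
          | tmul a c =>
            rw [shuffle_tmul, TensorProduct.map_tmul, LinearMap.mul'_apply, DualCop.pair_tmul]
            change counit (R := k) a * p x * (counit (R := k) c * q y) = _
            simp
            ring
      rw [comul_tmul, this, DualCop.pair_comul, rTensor_counit_comul]
      change counit (R := k) h * p (y * x) = _
      simp [mul_comm]
  have hεE : ∀ X : DrinfeldDouble k H, E 1 X = counit (R := k) X := by
    intro X
    induction X using induction_on with
    | zero => simp
    | add X Y hX hY => simp only [map_add, hX, hY]
    | tm p h =>
      rw [counit_tmul]
      exact mul_comm _ _
  have hεG : ∀ X : DrinfeldDouble k H, counit (R := k) (G X) = counit (R := k) X := by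
    intro X
    induction X using induction_on with
    | zero => simp
    | add X Y hX hY => simp only [map_add, hX, hY]
    | tm p h => rw [counit_tmul, hG]; simp
  have hmul : ∀ x y, E (y * x) w = E y w * E x w := fun x y => by
    rw [hE, hw]; simp [mul_comm]
  let χ : H →ₐ[k] k := AlgHom.ofLinearMap (DualCop.toDual k H (P w))
    ((hεE w).trans hε) (fun x y => hmul y x)
  refine ⟨χ, G w, ?_, ?_, ?_⟩
  · rw [hGG, hw, TensorProduct.map_tmul]
  · rw [hεG, hε]
  · have h := hPG w
    rw [hw, TensorProduct.map_tmul, LinearMap.mul'_apply, LinearMap.comp_apply,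
      LinearMap.comp_apply, inDual_mul_inH] at h
    exact h.symm

/-- A criterion for a group-like `w = χ ⊗ g` to satisfy `w S²(X) = X w` on all of `D(H)`. -/
theorem tmul_charDual_mul_antipode_antipode (χ : H →ₐ[k] k) {g : H}
    (hg : comul (R := k) g = g ⊗ₜ[k] g) (hε : counit (R := k) g = 1)
    (hsurj : Function.Surjective (rightTrans χ))
    (h : ∀ x, leftTrans χ x * g = g * antipode k (antipode k (rightTrans χ x)))
    (X : DrinfeldDouble k H) :
    tmul (charDual χ) g * antipode k (antipode k X) = X * tmul (charDual χ) g := by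
  induction X using induction_on with
  | zero => simp
  | add X Y hX hY => simp only [map_add, mul_add, add_mul, hX, hY]
  | tm p y =>
  have h1 : ∀ y, tmul (charDual χ) g * inH k H (antipode k (antipode k y)) =
      inH k H y * tmul (charDual χ) g := by
    intro y
    obtain ⟨y, rfl⟩ := hsurj y
    rw [← inDual_mul_inH, mul_assoc, ← inH_mul, ← h, inH_mul, ← mul_assoc, ← inH_rightTrans_mul,
      mul_assoc]
  have h2 : tmul (charDual χ) g * inDual k H (dualAntipodeInv (dualAntipodeInv p)) =
      inDual k H p * tmul (charDual χ) g := by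
    obtain ⟨g', hg'⟩ := (isUnit_of_comul_eq hg hε).exists_left_inv
    have e : dualAntipodeInv (dualAntipodeInv p) =
        ract g (ract g' (dualAntipodeInv (dualAntipodeInv p))) := DualCop.ext fun x => by
      rw [ract_apply, ract_apply, ← mul_assoc, hg', one_mul]
    rw [e, ← inDual_mul_inH, mul_assoc, inH_mul_inDual_ract _ hg, ← mul_assoc, ← mul_assoc,
      ← inDual_mul, ← inDual_mul]
    congr 2
    apply DualCop.ext
    intro x
    rw [charDual_mul_apply, mul_charDual_apply, lact_apply, ract_apply, h, ← mul_assoc, hg',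
      one_mul, dualAntipodeInv_apply, dualAntipodeInv_apply, antipodeInv_antipode,
      antipodeInv_antipode]
  rw [← inDual_mul_inH p y, antipode_mul_antidistrib, antipode_mul_antidistrib, antipode_inDual,
    antipode_inDual, antipode_inH, antipode_inH, ← mul_assoc, h2, mul_assoc, h1, mul_assoc]

instance : Module.Finite k (DrinfeldDouble k H) :=
  have : Module.Finite k (DualCop k H) := Module.Finite.equiv (DualCop.toDual k H).symm
  inferInstanceAs (Module.Finite k (DualCop k H ⊗[k] H))

/-- The second factor of `p ⊗ g` is recovered by evaluating `p` at `1`. -/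
theorem right_eq_of_tmul_eq_tmul {p p' : DualCop k H} {g g' : H} (hp : p 1 = 1) (hp' : p' 1 = 1)
    (h : tmul p g = tmul p' g') : g = g' := by
  let G : DrinfeldDouble k H →ₗ[k] H := tlift
    ((LinearMap.lsmul k H).comp (counit (R := k) (A := DualCop k H)))
  have hG : ∀ p h, G (tmul p h) = p 1 • h := fun _ _ => rfl
  have := congrArg G h
  rwa [hG, hG, hp, hp', one_smul, one_smul] at this

/-- The first factor of `p ⊗ g` is recovered by applying the counit to `g`. -/
theorem left_eq_of_tmul_eq_tmul {p p' : DualCop k H} {g g' : H} (hg : counit (R := k) g = 1)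
    (hg' : counit (R := k) g' = 1) (h : tmul p g = tmul p' g') : p = p' := by
  let P : DrinfeldDouble k H →ₗ[k] DualCop k H := tlift
    ((LinearMap.lsmul k (DualCop k H)).flip.compl₂ (counit (R := k) (A := H)))
  have hP : ∀ p h, P (tmul p h) = counit (R := k) h • p := fun _ _ => rfl
  have := congrArg P h
  rwa [hP, hP, hg, hg', one_smul, one_smul] at this

section Trace

variable (ψ : H →ₐ[k] k)

/-- The functional `p ⊗ h ↦ p(1) ψ(h)` on `D(H)`. -/
noncomputable def evalChar : DrinfeldDouble k H →ₗ[k] k :=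
  tlift ((LinearMap.mul k k).compl₁₂ (counit (R := k) (A := DualCop k H)) ψ.toLinearMap)

theorem evalChar_tmul (p : DualCop k H) (h : H) : evalChar ψ (tmul p h) = p 1 * ψ h := rfl

theorem evalChar_inDual_mul (p : DualCop k H) (X : DrinfeldDouble k H) :
    evalChar ψ (inDual k H p * X) = p 1 * evalChar ψ X := by
  induction X using induction_on with
  | zero => simp
  | add X Y hX hY => simp only [map_add, mul_add, hX, hY]
  | tm q h =>
    rw [inDual_apply, tmul_one_mul, evalChar_tmul, evalChar_tmul, ← mul_assoc]
    congr 1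
    rw [DualCop.mul_apply, Bialgebra.comul_one, Algebra.TensorProduct.one_def]
    rfl

/-- `a ⊗ b ⊗ c ↦ ψ(b) s⁻¹(c) y a` -/
noncomputable def adAux (y : H) : H ⊗[k] (H ⊗[k] H) →ₗ[k] H :=
  LinearMap.mul' k H ∘ₗ (TensorProduct.comm k H H).toLinearMap ∘ₗ
    TensorProduct.map (LinearMap.mulLeft k y) ((TensorProduct.lid k H).toLinearMap ∘ₗ
      TensorProduct.map ψ.toLinearMap (antipodeInv k H))

theorem adAux_tmul (y a b c : H) :
    adAux ψ y (a ⊗ₜ (b ⊗ₜ c)) = ψ b • (antipodeInv k H c * (y * a)) := by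
  simp [adAux]

/-- The twisted adjoint action `h ↦ h₍₁₎ ψ(s(h₍₂₎)) s(h₍₃₎)` on the unit of `H`. -/
noncomputable def adChar : H →ₗ[k] H := adAux ψ 1 ∘ₗ comul3 ∘ₗ antipode k

theorem adChar_apply (h : H) : adChar ψ h = adAux ψ 1 (comul3 (antipode k h)) := rfl

/-- `adChar` is multiplicative as an action: `a h` acts on the unit by `a` acting on the result of `h`. -/
theorem adChar_mul (a h : H) :
    adChar ψ (a * h) = adAux ψ (adChar ψ h) (comul3 (antipode k a)) := by
  rw [adChar_apply, adChar_apply, antipode_mul_antidistrib, comul3_mul]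
  generalize comul3 (k := k) (antipode k a) = t
  generalize comul3 (k := k) (antipode k h) = t'
  induction t with
  | zero => simp
  | add x y hx hy => simp only [map_add, mul_add, hx, hy]
  | tmul a t =>
  induction t with
  | zero => simp
  | add x y hx hy => simp only [map_add, TensorProduct.tmul_add, mul_add, hx, hy]
  | tmul b c =>
  rw [adAux_tmul]
  induction t' with
  | zero => simp
  | add x y hx hy => simp only [map_add, mul_add, add_mul, smul_add, hx, hy]
  | tmul a' t =>
  induction t with
  | zero => simp
  | add x y hx hy =>
    simp only [map_add, TensorProduct.tmul_add, mul_add, add_mul, smul_add, hx, hy]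
  | tmul b' c' =>
    rw [Algebra.TensorProduct.tmul_mul_tmul, Algebra.TensorProduct.tmul_mul_tmul, adAux_tmul,
      adAux_tmul, antipodeInv_mul, map_mul, mul_comm, mul_smul]
    simp only [mul_assoc, one_mul, mul_smul_comm, smul_mul_assoc]

theorem evalChar_inH_mul_inDual (x : H) (q : DualCop k H) :
    evalChar ψ (inH k H x * inDual k H q) = q (adAux ψ 1 (comul3 x)) := by
  rw [inH_apply, inDual_apply, one_tmul_mul]
  generalize comul3 (k := k) x = t
  induction t with
  | zero => simp
  | add x y hx hy => simp only [map_add, hx, hy]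
  | tmul a t =>
  induction t with
  | zero => simp
  | add x y hx hy => simp only [map_add, TensorProduct.tmul_add, hx, hy]
  | tmul b c =>
    rw [crossAux_tmul, evalChar_tmul, ract_apply, lact_apply, adAux_tmul, map_smul, mul_comm,
      mul_one, one_mul]
    rfl

variable {ι : Type*} [Fintype ι] (b : Module.Basis ι k H)

theorem drinfeldElement_rMatrix : drinfeldElement k (rMatrix k H) =
    ∑ i, inDual k H (dualAntipodeInv (dualVec b i)) * inH k H (b i) := by
  rw [rMatrix_eq_homTensor b, homTensor, IsUniversalRMatrix.drinfeldElement_sum]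
  simp only [antipode_inDual]

/-- `u = ∑ (S(hⁱ) ⊗ 1)(1 ⊗ hᵢ)` and evaluating the left factor at `1` leaves `∑ hⁱ(1) hᵢ = 1`. -/
theorem evalChar_drinfeldElement_mul (X : DrinfeldDouble k H) :
    evalChar ψ (drinfeldElement k (rMatrix k H) * X) = evalChar ψ X := by
  let b := Module.finBasis k H
  rw [drinfeldElement_rMatrix b, Finset.sum_mul, map_sum]
  simp only [mul_assoc, evalChar_inDual_mul, dualAntipodeInv_apply, antipodeInv_one]
  have h := sum_dualVec_smul b (evalChar ψ ∘ₗ (LinearMap.mul k _).flip X ∘ₗ inH k H) 1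
  refine Eq.trans h ?_
  simp [inH_one]

/-- The value of `evalChar ψ` on `S(u)` is the trace of `s⁻² ∘ adChar ψ`. -/
theorem evalChar_antipode_drinfeldElement :
    evalChar ψ (antipode k (drinfeldElement k (rMatrix k H))) =
      ∑ i, b.coord i (antipodeInv k H (antipodeInv k H (adChar ψ (b i)))) := by
  rw [drinfeldElement_rMatrix b, map_sum, map_sum]
  simp only [antipode_mul_antidistrib, antipode_inH, antipode_inDual, evalChar_inH_mul_inDual]
  rfl

end Trace
end DrinfeldDouble
end Double

/-! ### A representation of the Taft algebra on functions -/

section Taft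

theorem starForm_add_left {n : ℕ} (α α' β : Fin n → ℤ) :
    starForm (α + α') β = starForm α β + starForm α' β := by
  simp [starForm, add_mul, Finset.sum_add_distrib]

theorem starForm_add_right {n : ℕ} (α β β' : Fin n → ℤ) :
    starForm α (β + β') = starForm α β + starForm α β' := by
  simp [starForm, mul_add, Finset.sum_add_distrib]

theorem starForm_neg_left {n : ℕ} (α β : Fin n → ℤ) : starForm (-α) β = -starForm α β := by
  simp [starForm]

theorem starForm_neg_right {n : ℕ} (α β : Fin n → ℤ) : starForm α (-β) = -starForm α β := by
  simp [starForm]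

theorem starForm_sub_left {n : ℕ} (α α' β : Fin n → ℤ) :
    starForm (α - α') β = starForm α β - starForm α' β := by
  rw [sub_eq_add_neg, starForm_add_left, starForm_neg_left, sub_eq_add_neg]

theorem starForm_sub_right {n : ℕ} (α β β' : Fin n → ℤ) :
    starForm α (β - β') = starForm α β - starForm α β' := by
  rw [sub_eq_add_neg, starForm_add_right, starForm_neg_right, sub_eq_add_neg]

theorem starForm_const_left {n : ℕ} (β : Fin n → ℤ) (m : ℤ) :
    starForm (fun _ => m) β = m * starForm (fun _ => 1) β := by
  simp only [starForm, Finset.mul_sum]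
  refine Finset.sum_congr rfl fun i _ => Finset.sum_congr rfl fun j _ => ?_
  ring

theorem starForm_const_right {n : ℕ} (α : Fin n → ℤ) (m : ℤ) :
    starForm α (fun _ => m) = m * starForm α (fun _ => 1) := by
  simp only [starForm, Finset.mul_sum]
  refine Finset.sum_congr rfl fun i _ => Finset.sum_congr rfl fun j _ => ?_
  ring

namespace TaftAlgebra

variable {k : Type*} [Field k] {n : ℕ} {q : k} {ℓ : ℕ}

section Model

variable (q ℓ)

/-- The space on which the Taft algebra is represented: the functions `F` of a weight
`γ ∈ ℤⁿ` and a residue `α ∈ (ℤ/ℓ)ⁿ`. -/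
abbrev ModelSpace (k : Type*) (n ℓ : ℕ) : Type _ := (Fin n → ℤ) → (Fin n → ZMod ℓ) → k

/-- The exponent by which `K(ε_i)` acts in weight `γ`. -/
def weightExp (i : Fin n) (γ : Fin n → ℤ) : ℤ :=
  starForm (basisVec i) γ - starForm γ (basisVec i) + γ i

/-- The operators by which the generators act. The operator of `x_i` shifts `γ_i` by one, and its
`ℓ`-th power vanishes because it annihilates values at multiples of `ℓ`. -/
def modelGen : TaftGen n → Module.End k (ModelSpace k n ℓ)
  | .K i =>
    { toFun F γ α := q ^ weightExp i γ * F γ (α - Pi.single i 1)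
      map_add' F G := by ext γ α; exact mul_add _ _ _
      map_smul' c F := by ext γ α; exact mul_left_comm _ _ _ }
  | .Kinv i =>
    { toFun F γ α := q ^ (-weightExp i γ) * F γ (α + Pi.single i 1)
      map_add' F G := by ext γ α; exact mul_add _ _ _
      map_smul' c F := by ext γ α; exact mul_left_comm _ _ _ }
  | .x i =>
    { toFun F γ α := if (ℓ : ℤ) ∣ γ i then 0 else
        q ^ starForm (basisVec i) γ * F (γ - basisVec i) α
      map_add' F G := by ext γ α; simp only [Pi.add_apply]; split_ifs <;> simp [mul_add]
      map_smul' c F := by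
        ext γ α
        simp only [Pi.smul_apply, smul_eq_mul, RingHom.id_apply]
        split_ifs
        · simp
        · ring }

theorem modelGen_K (i : Fin n) (F : ModelSpace k n ℓ) (γ α) :
    modelGen q ℓ (.K i) F γ α = q ^ weightExp i γ * F γ (α - Pi.single i 1) := rfl
theorem modelGen_Kinv (i : Fin n) (F : ModelSpace k n ℓ) (γ α) :
    modelGen q ℓ (.Kinv i) F γ α = q ^ (-weightExp i γ) * F γ (α + Pi.single i 1) := rfl
theorem modelGen_x (i : Fin n) (F : ModelSpace k n ℓ) (γ α) :
    modelGen q ℓ (.x i) F γ α = if (ℓ : ℤ) ∣ γ i then 0 else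
        q ^ starForm (basisVec i) γ * F (γ - basisVec i) α := rfl

theorem weightExp_sub (i j : Fin n) (γ : Fin n → ℤ) : weightExp i γ - weightExp i (γ - basisVec j) =
    starForm (basisVec i) (basisVec j) - starForm (basisVec j) (basisVec i) +
      (if i = j then 1 else 0 : ℕ) := by
  simp only [weightExp, starForm_sub_left, starForm_sub_right, Pi.sub_apply]
  have : (basisVec j : Fin n → ℤ) i = (if i = j then 1 else 0 : ℕ) := by
    simp [basisVec, Pi.single_apply]
  rw [this]
  ring

variable [hqℓ : Fact (IsPrimitiveRoot q ℓ)] [hℓ : NeZero ℓ]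

theorem modelGen_relations : TaftRelations q ℓ (modelGen (n := n) q ℓ) where
  K_comm i j := by
    ext F γ α
    simp only [Module.End.mul_apply, modelGen_K]
    rw [sub_right_comm]
    ring
  K_mul_Kinv i := by
    ext F γ α
    simp only [Module.End.mul_apply, modelGen_K, modelGen_Kinv, Module.End.one_apply]
    rw [← mul_assoc, ← zpow_add₀ (q_ne_zero q ℓ), add_neg_cancel, zpow_zero, one_mul,
      sub_add_cancel]
  Kinv_mul_K i := by
    ext F γ α
    simp only [Module.End.mul_apply, modelGen_K, modelGen_Kinv, Module.End.one_apply]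
    rw [← mul_assoc, ← zpow_add₀ (q_ne_zero q ℓ), neg_add_cancel, zpow_zero, one_mul,
      add_sub_cancel_right]
  K_pow i := by
    have h : ∀ (m : ℕ) (F : ModelSpace k n ℓ) γ α, ((modelGen q ℓ (.K i)) ^ m) F γ α =
        (q ^ weightExp i γ) ^ m * F γ (α - m • Pi.single i 1) := by
      intro m
      induction m with
      | zero => intro F γ α; simp
      | succ m ih =>
        intro F γ α
        rw [pow_succ', Module.End.mul_apply, modelGen_K, ih, ← mul_assoc, ← pow_succ', succ_nsmul',
          sub_sub]
    ext F γ α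
    rw [h, zpow_pow_order, one_mul, Module.End.one_apply]
    congr 1
    ext j
    simp
  conj_x i j := by
    ext F γ α
    simp only [Module.End.mul_apply, modelGen_K, modelGen_Kinv, modelGen_x, LinearMap.smul_apply,
      Pi.smul_apply, smul_eq_mul]
    split_ifs with h h'
    · simp
    · simp
    all_goals
      have hq := q_ne_zero q ℓ
      have e := weightExp_sub i j γ
      rw [sub_add_cancel, mul_left_comm, ← mul_assoc, ← mul_assoc, ← mul_assoc]
      congr 1
      rw [mul_assoc, ← zpow_add₀ hq, ← sub_eq_add_neg, e, skewBichar, mul_comm, zpow_add₀ hq]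
      simp_all
  x_comm i j := by
    by_cases hij : i = j
    · subst hij; rw [skewBichar_self, one_smul]
    ext F γ α
    have hq := q_ne_zero q ℓ
    have h1 : (γ - basisVec i) j = γ j := by simp [basisVec, Ne.symm hij]
    have h2 : (γ - basisVec j) i = γ i := by simp [basisVec, hij]
    simp only [Module.End.mul_apply, modelGen_x, LinearMap.smul_apply, Pi.smul_apply, smul_eq_mul,
      h1, h2]
    split_ifs
    · simp
    · simp
    · simp
    · rw [sub_right_comm, ← mul_assoc, ← mul_assoc, ← mul_assoc]
      congr 1
      rw [skewBichar, ← zpow_add₀ hq, ← zpow_add₀ hq, ← zpow_add₀ hq]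
      congr 1
      simp only [starForm_sub_right]
      ring
  x_pow i := by
    have h : ∀ (m : ℕ) (F : ModelSpace k n ℓ) (γ : Fin n → ℤ) α (t : ℕ), t < m →
        (ℓ : ℤ) ∣ γ i - t → ((modelGen q ℓ (.x i)) ^ m) F γ α = 0 := by
      intro m
      induction m with
      | zero => intro F γ α t ht; omega
      | succ m ih =>
        intro F γ α t ht hd
        rw [pow_succ', Module.End.mul_apply, modelGen_x]
        split_ifs with h0
        · rfl
        · rcases t with _ | t
          · simp at hd; exact absurd hd h0
          · rw [ih F (γ - basisVec i) α t (by omega), mul_zero]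
            convert hd using 1
            simp [basisVec]
            ring
    ext F γ α
    have hpos : (0 : ℤ) < ℓ := by exact_mod_cast Nat.pos_of_ne_zero hℓ.out
    have h1 := Int.emod_nonneg (γ i) hpos.ne'
    have h2 := Int.emod_lt_of_pos (γ i) hpos
    rw [h ℓ F γ α (γ i % ℓ).toNat (by omega)]
    · rfl
    · rw [Int.toNat_of_nonneg h1]
      exact Int.dvd_self_sub_emod

end Model

end TaftAlgebra
end Taft

/-! ### The basis of ordered monomials -/

section Taft

namespace TaftAlgebra

variable {k : Type*} [Field k] {n : ℕ} {q : k} {ℓ : ℕ}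

section GroupPart

theorem commute_KUnit (i j : Fin n) : Commute (KUnit q ℓ i) (KUnit q ℓ j) :=
  Units.ext (gen_relations.K_comm i j)

theorem KUnit_pow (i : Fin n) : KUnit q ℓ i ^ ℓ = 1 :=
  Units.ext (by rw [Units.val_pow_eq_pow_val]; exact gen_relations.K_pow i)

theorem K_eq_prod (α : Fin n → ℤ) :
    K q ℓ α = ((List.finRange n).map fun i => KUnit q ℓ i ^ α i).prod := by
  rw [K, List.ofFn_eq_map]

theorem K_add (α β : Fin n → ℤ) : K q ℓ (α + β) = K q ℓ α * K q ℓ β := by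
  simp only [K_eq_prod]
  induction List.finRange n with
  | nil => simp
  | cons i L ih =>
    have h : Commute (KUnit q ℓ i ^ β i) (L.map fun i => KUnit q ℓ i ^ α i).prod := by
      refine Commute.list_prod_right _ _ fun x hx => ?_
      obtain ⟨j, -, rfl⟩ := List.mem_map.1 hx
      exact ((commute_KUnit i j).zpow_left _).zpow_right _
    rw [List.map_cons, List.prod_cons, ih, List.map_cons, List.prod_cons, List.map_cons,
      List.prod_cons, Pi.add_apply, zpow_add, mul_assoc, mul_assoc,
      ← mul_assoc (KUnit q ℓ i ^ β i), h.eq, mul_assoc]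

theorem K_zero : K q ℓ (0 : Fin n → ℤ) = 1 := by
  have := K_add (q := q) (ℓ := ℓ) (0 : Fin n → ℤ) 0
  rw [add_zero] at this
  exact (mul_eq_left.1 this.symm)

theorem K_neg (α : Fin n → ℤ) : K q ℓ (-α) = (K q ℓ α)⁻¹ := by
  rw [eq_inv_iff_mul_eq_one, ← K_add, neg_add_cancel, K_zero]

theorem K_basisVec (i : Fin n) : K q ℓ (basisVec i) = KUnit q ℓ i := by
  rw [K_eq_prod, List.prod_map_eq_pow_single i]
  · simp [basisVec]
  · intro j hj _
    simp [basisVec, hj]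

theorem K_congr {α β : Fin n → ℤ} (h : ∀ i, (α i : ZMod ℓ) = β i) : K q ℓ α = K q ℓ β := by
  rw [K_eq_prod, K_eq_prod]
  congr 2
  funext i
  have h1 : (((α i - β i : ℤ)) : ZMod ℓ) = 0 := by rw [Int.cast_sub, h, sub_self]
  obtain ⟨m, hm⟩ := (ZMod.intCast_zmod_eq_zero_iff_dvd _ _).1 h1
  rw [show α i = β i + ℓ * m by rw [← hm]; ring, zpow_add, zpow_mul, zpow_natCast, KUnit_pow,
    one_zpow, mul_one]

variable (q ℓ) in
/-- `K(α)` for a residue class `α`. -/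
def KMod (α : Fin n → ZMod ℓ) : TaftAlgebra n q ℓ := K q ℓ (fun i => (α i).cast)

theorem K_eq_KMod (α : Fin n → ℤ) : (K q ℓ α : TaftAlgebra n q ℓ) = KMod q ℓ (fun i => α i) := by
  rw [KMod]
  congr 1
  exact K_congr fun i => by simp

theorem KMod_add (α β : Fin n → ZMod ℓ) : KMod q ℓ (α + β) = KMod q ℓ α * KMod q ℓ β := by
  have : (K q ℓ ((fun i => (α i).cast) + fun i => (β i).cast) : TaftAlgebra n q ℓ) =
      KMod q ℓ (α + β) := by
    rw [K_eq_KMod]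
    congr 1
    ext i
    simp
  rw [← this, K_add, Units.val_mul, KMod, KMod]

theorem KMod_zero : KMod q ℓ (0 : Fin n → ZMod ℓ) = 1 := by
  have : KMod q ℓ (0 : Fin n → ZMod ℓ) = (K q ℓ (0 : Fin n → ℤ) : TaftAlgebra n q ℓ) := by
    rw [K_eq_KMod]
    congr 1
    ext i
    simp
  rw [this, K_zero, Units.val_one]

theorem KMod_single (i : Fin n) :
    KMod q ℓ (Pi.single i 1 : Fin n → ZMod ℓ) = gen q ℓ (.K i) := by
  have : (K q ℓ (basisVec i) : TaftAlgebra n q ℓ) = gen q ℓ (.K i) := by rw [K_basisVec]; rfl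
  rw [← this, K_eq_KMod]
  congr 1
  ext j
  by_cases h : j = i <;> simp [basisVec, h]

end GroupPart

section Monomials

variable (q ℓ) in
/-- The product `∏ x_i ^ γ_i` over a list of indices, in the order of the list. -/
def xProd (L : List (Fin n)) (γ : Fin n → ℕ) : TaftAlgebra n q ℓ :=
  (L.map fun i => gen q ℓ (.x i) ^ γ i).prod

theorem xProd_cons (i : Fin n) (L : List (Fin n)) (γ : Fin n → ℕ) :
    xProd q ℓ (i :: L) γ = gen q ℓ (.x i) ^ γ i * xProd q ℓ L γ := by
  simp [xProd]

theorem xProd_nil (γ : Fin n → ℕ) : xProd q ℓ [] γ = 1 := rfl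

theorem xMonomial_eq_xProd (γ : Fin n → ℕ) : xMonomial q ℓ γ = xProd q ℓ (List.finRange n) γ := by
  rw [xMonomial, xProd, List.ofFn_eq_map]

theorem xProd_congr {L : List (Fin n)} {γ γ' : Fin n → ℕ} (h : ∀ i ∈ L, γ i = γ' i) :
    xProd q ℓ L γ = xProd q ℓ L γ' := by
  rw [xProd, xProd]
  congr 1
  exact List.map_congr_left fun i hi => by rw [h i hi]

theorem xMonomial_zero : xMonomial q ℓ (0 : Fin n → ℕ) = 1 := by
  rw [xMonomial_eq_xProd, xProd]
  exact List.prod_eq_one (by simp)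

variable [hqℓ : Fact (IsPrimitiveRoot q ℓ)] [hℓ : NeZero ℓ]

theorem x_mul_x_pow (i j : Fin n) (m : ℕ) : gen q ℓ (.x i) * gen q ℓ (.x j) ^ m =
    skewBichar q (basisVec i) (basisVec j) ^ m • (gen q ℓ (.x j) ^ m * gen q ℓ (.x i)) := by
  induction m with
  | zero => simp
  | succ m ih =>
    rw [pow_succ, ← mul_assoc, ih, smul_mul_assoc, mul_assoc, gen_relations.x_comm i j,
      mul_smul_comm, smul_smul, ← mul_assoc, ← pow_succ, ← pow_succ]

theorem K_mul_x_pow (i j : Fin n) (m : ℕ) : gen q ℓ (.K i) * gen q ℓ (.x j) ^ m =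
    (skewBichar q (basisVec i) (basisVec j) * q ^ (if i = j then 1 else 0)) ^ m •
      (gen q ℓ (.x j) ^ m * gen q ℓ (.K i)) := by
  induction m with
  | zero => simp
  | succ m ih =>
    rw [pow_succ (gen q ℓ (.x j)), ← mul_assoc, ih, smul_mul_assoc, mul_assoc, K_mul_x i j,
      mul_smul_comm, smul_smul, ← mul_assoc (gen q ℓ (.x j) ^ m),
      ← pow_succ (skewBichar q _ _ * _)]

theorem exists_x_mul_xProd (i : Fin n) (γ : Fin n → ℕ) (L : List (Fin n)) (hL : L.Nodup)
    (hi : i ∈ L) : ∃ c : k, gen q ℓ (.x i) * xProd q ℓ L γ =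
      c • xProd q ℓ L (Function.update γ i (γ i + 1)) := by
  induction L with
  | nil => simp at hi
  | cons j L ih =>
    rw [List.nodup_cons] at hL
    simp only [xProd_cons]
    by_cases hij : i = j
    · subst hij
      refine ⟨1, ?_⟩
      rw [one_smul, Function.update_self, ← mul_assoc, ← pow_succ']
      congr 1
      refine xProd_congr fun j hj => ?_
      rw [Function.update_of_ne]
      rintro rfl
      exact hL.1 hj
    · obtain ⟨c, hc⟩ := ih hL.2 ((List.mem_cons.1 hi).resolve_left hij)
      refine ⟨skewBichar q (basisVec i) (basisVec j) ^ γ j * c, ?_⟩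
      rw [← mul_assoc, x_mul_x_pow, smul_mul_assoc, mul_assoc, hc, mul_smul_comm, smul_smul,
        Function.update_of_ne (Ne.symm hij)]

theorem exists_K_mul_xProd (i : Fin n) (γ : Fin n → ℕ) (L : List (Fin n)) : ∃ c : k,
    gen q ℓ (.K i) * xProd q ℓ L γ = c • (xProd q ℓ L γ * gen q ℓ (.K i)) := by
  induction L with
  | nil => exact ⟨1, by simp [xProd_nil]⟩
  | cons j L ih =>
    obtain ⟨c, hc⟩ := ih
    refine ⟨(skewBichar q (basisVec i) (basisVec j) * q ^ (if i = j then 1 else 0)) ^ γ j * c, ?_⟩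
    rw [xProd_cons, ← mul_assoc, K_mul_x_pow, smul_mul_assoc, mul_assoc, hc, mul_smul_comm,
      smul_smul, mul_assoc]

theorem xProd_eq_zero (γ : Fin n → ℕ) (L : List (Fin n)) {i : Fin n} (hi : i ∈ L) (h : ℓ ≤ γ i) :
    xProd q ℓ L γ = 0 := by
  refine List.prod_eq_zero (List.mem_map.2 ⟨i, hi, ?_⟩)
  rw [← Nat.sub_add_cancel h, pow_add, gen_relations.x_pow, mul_zero]

variable (n q ℓ) in
/-- The ordered monomials `x ^ γ K(α)` with exponents `0 ≤ γ_i < ℓ` and `α ∈ (ℤ/ℓ)ⁿ`. -/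
def pbw (p : (Fin n → Fin ℓ) × (Fin n → ZMod ℓ)) : TaftAlgebra n q ℓ :=
  xMonomial q ℓ (fun i => p.1 i) * KMod q ℓ p.2

/-- The span contains `1` and is stable under left multiplication by the generators. -/
theorem span_pbw : Submodule.span k (Set.range (pbw n q ℓ)) = ⊤ := by
  set W := Submodule.span k (Set.range (pbw n q ℓ)) with hW
  have hx : ∀ i, ∀ y ∈ W, gen q ℓ (.x i) * y ∈ W := by
    intro i y hy
    induction hy using Submodule.span_induction with
    | zero => simp
    | add x y _ _ hx hy => rw [mul_add]; exact W.add_mem hx hy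
    | smul c x _ hx => rw [mul_smul_comm]; exact W.smul_mem c hx
    | mem x hx =>
      obtain ⟨⟨γ, α⟩, rfl⟩ := hx
      obtain ⟨c, hc⟩ := exists_x_mul_xProd (q := q) (ℓ := ℓ) i (fun j => γ j) (List.finRange n)
        (List.nodup_finRange n) (List.mem_finRange i)
      rw [pbw, xMonomial_eq_xProd, ← mul_assoc, hc, smul_mul_assoc]
      refine W.smul_mem _ ?_
      by_cases h : (γ i : ℕ) + 1 < ℓ
      · refine Submodule.subset_span ⟨(Function.update γ i ⟨_, h⟩, α), ?_⟩
        rw [pbw, xMonomial_eq_xProd]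
        congr 2
        ext j
        by_cases hj : j = i
        · subst hj; simp
        · simp [hj]
      · rw [xProd_eq_zero _ _ (List.mem_finRange i) (by simpa using h), zero_mul]
        exact W.zero_mem
  have hK : ∀ i, ∀ y ∈ W, gen q ℓ (.K i) * y ∈ W := by
    intro i y hy
    induction hy using Submodule.span_induction with
    | zero => simp
    | add x y _ _ hx hy => rw [mul_add]; exact W.add_mem hx hy
    | smul c x _ hx => rw [mul_smul_comm]; exact W.smul_mem c hx
    | mem x hx =>
      obtain ⟨⟨γ, α⟩, rfl⟩ := hx
      obtain ⟨c, hc⟩ := exists_K_mul_xProd (q := q) (ℓ := ℓ) i (fun j => γ j) (List.finRange n)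
      rw [pbw, xMonomial_eq_xProd, ← mul_assoc, hc, smul_mul_assoc, mul_assoc, ← KMod_single,
        ← KMod_add]
      refine W.smul_mem _ (Submodule.subset_span ⟨(γ, Pi.single i 1 + α), ?_⟩)
      rw [pbw, xMonomial_eq_xProd]
  have hKpow : ∀ i (m : ℕ), ∀ y ∈ W, gen q ℓ (.K i) ^ m * y ∈ W := by
    intro i m
    induction m with
    | zero => intro y hy; simpa using hy
    | succ m ih => intro y hy; rw [pow_succ, mul_assoc]; exact ih _ (hK i y hy)
  have hall : ∀ a : TaftAlgebra n q ℓ, ∀ y ∈ W, a * y ∈ W := by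
    intro a
    induction a using induction with
    | h0 r => intro y hy; rw [← Algebra.smul_def]; exact W.smul_mem r hy
    | h1 g =>
      cases g with
      | K i => exact hK i
      | x i => exact hx i
      | Kinv i =>
        have e : gen q ℓ (.Kinv i) = gen q ℓ (.K i) ^ (ℓ - 1) := by
          have h := gen_relations.K_pow (q := q) (ℓ := ℓ) i
          calc gen q ℓ (.Kinv i) =
              gen q ℓ (.K i) ^ (ℓ - 1) * gen q ℓ (.K i) * gen q ℓ (.Kinv i) := by
                rw [← pow_succ, Nat.sub_add_cancel (Nat.pos_of_ne_zero hℓ.out), h, one_mul]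
            _ = _ := by rw [mul_assoc, gen_relations.K_mul_Kinv, mul_one]
        rw [e]
        exact hKpow i _
    | hm a b ha hb => intro y hy; rw [mul_assoc]; exact ha _ (hb y hy)
    | ha a b ha hb => intro y hy; rw [add_mul]; exact W.add_mem (ha y hy) (hb y hy)
  have h1 : (1 : TaftAlgebra n q ℓ) ∈ W := by
    refine Submodule.subset_span ⟨(fun _ => ⟨0, Nat.pos_of_ne_zero hℓ.out⟩, 0), ?_⟩
    rw [pbw, KMod_zero, mul_one]
    exact xMonomial_zero
  exact Submodule.eq_top_iff'.2 fun a => by simpa using hall a 1 h1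

/-- `F` is supported at the single point `(γ, α)`. -/
def IsPeak (γ : Fin n → ℤ) (α : Fin n → ZMod ℓ) (F : ModelSpace k n ℓ) : Prop :=
  F γ α ≠ 0 ∧ ∀ γ' α', (γ', α') ≠ (γ, α) → F γ' α' = 0

theorem IsPeak.K {γ : Fin n → ℤ} {α : Fin n → ZMod ℓ} {F : ModelSpace k n ℓ} (h : IsPeak γ α F)
    (i : Fin n) : IsPeak γ (α + Pi.single i 1) (modelGen q ℓ (.K i) F) := by
  have hq := q_ne_zero q ℓ
  refine ⟨?_, fun γ' α' hne => ?_⟩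
  · rw [modelGen_K, add_sub_cancel_right]
    exact mul_ne_zero (zpow_ne_zero _ hq) h.1
  · rw [modelGen_K, h.2, mul_zero]
    rintro heq
    rw [Prod.mk.injEq] at heq
    exact hne (by rw [heq.1, ← heq.2, sub_add_cancel])

theorem IsPeak.x {γ : Fin n → ℤ} {α : Fin n → ZMod ℓ} {F : ModelSpace k n ℓ} (h : IsPeak γ α F)
    (i : Fin n) (hi : ¬ (ℓ : ℤ) ∣ γ i + 1) :
    IsPeak (γ + basisVec i) α (modelGen q ℓ (.x i) F) := by
  have hq := q_ne_zero q ℓ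
  have e : (γ + basisVec i) i = γ i + 1 := by simp [basisVec]
  refine ⟨?_, fun γ' α' hne => ?_⟩
  · rw [modelGen_x, e, if_neg hi, add_sub_cancel_right]
    exact mul_ne_zero (zpow_ne_zero _ hq) h.1
  · rw [modelGen_x, h.2, mul_zero, ite_self]
    rintro heq
    rw [Prod.mk.injEq] at heq
    exact hne (by rw [heq.2, ← heq.1, sub_add_cancel])

theorem IsPeak.x_pow {γ : Fin n → ℤ} {α : Fin n → ZMod ℓ} {F : ModelSpace k n ℓ}
    (h : IsPeak γ α F) (i : Fin n) (hi : γ i = 0) {m : ℕ} (hm : m < ℓ) :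
    IsPeak (γ + (m : ℤ) • basisVec i) α ((modelGen q ℓ (.x i) ^ m) F) := by
  induction m with
  | zero => simpa using h
  | succ m ih =>
    rw [pow_succ', Module.End.mul_apply]
    have := (ih (by omega)).x (q := q) i (by
      have : (γ + (m : ℤ) • basisVec i) i = m := by simp [basisVec, hi]
      rw [this]
      intro hd
      have := Int.le_of_dvd (by omega) hd
      omega)
    convert this using 1
    push_cast
    rw [add_smul, one_smul, add_assoc]

variable (n q ℓ) in
/-- The representation of the Taft algebra on `ModelSpace`. -/
noncomputable def model : TaftAlgebra n q ℓ →ₐ[k] Module.End k (ModelSpace k n ℓ) :=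
  lift (modelGen q ℓ) (modelGen_relations q ℓ)

theorem model_gen (g : TaftGen n) : model n q ℓ (gen q ℓ g) = modelGen q ℓ g :=
  lift_gen _ _ _

theorem IsPeak.xProd {γ : Fin n → ℤ} {α : Fin n → ZMod ℓ} {F : ModelSpace k n ℓ}
    (h : IsPeak γ α F) (L : List (Fin n)) (hL : L.Nodup) (hγ : ∀ i ∈ L, γ i = 0) (δ : Fin n → ℕ)
    (hδ : ∀ i, δ i < ℓ) :
    IsPeak (fun i => if i ∈ L then (δ i : ℤ) else γ i) α (model n q ℓ (xProd q ℓ L δ) F) := by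
  induction L with
  | nil => simpa [xProd_nil] using h
  | cons j L ih =>
    rw [List.nodup_cons] at hL
    have := (ih hL.2 fun i hi => hγ i (by simp [hi])).x_pow (q := q) j
      (by simp [hL.1, hγ j (by simp)]) (hδ j)
    rw [xProd_cons, map_mul, map_pow, model_gen, Module.End.mul_apply]
    convert this using 1
    ext i
    by_cases hij : i = j
    · subst hij
      simp [hL.1, basisVec, hγ i (by simp)]
    · simp [hij, basisVec]

theorem IsPeak.KMod {γ : Fin n → ℤ} {α : Fin n → ZMod ℓ} {F : ModelSpace k n ℓ}
    (h : IsPeak γ α F) (β : Fin n → ZMod ℓ) :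
    IsPeak γ (α + β) (model n q ℓ (KMod q ℓ β) F) := by
  have key : ∀ S : Finset (Fin n), ∀ m : Fin n → ℕ, IsPeak γ (α + ∑ i ∈ S, m i • Pi.single i 1)
      (model n q ℓ (TaftAlgebra.KMod q ℓ (∑ i ∈ S, m i • Pi.single i 1)) F) := by
    intro S m
    induction S using Finset.induction_on with
    | empty => simpa [KMod_zero] using h
    | insert i S hi ih =>
      rw [Finset.sum_insert hi]
      generalize ∑ i ∈ S, m i • Pi.single i (1 : ZMod ℓ) = β at ih
      induction m i with
      | zero => simpa using ih
      | succ t iht =>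
        have e : (t + 1) • (Pi.single i 1 : Fin n → ZMod ℓ) + β =
            Pi.single i 1 + (t • Pi.single i 1 + β) := by rw [succ_nsmul']; abel
        have := iht.K (q := q) i
        rw [e, KMod_add, map_mul, KMod_single, model_gen, Module.End.mul_apply]
        convert this using 1
        abel
  have := key Finset.univ fun i => (β i).val
  have e : ∑ i, (β i).val • (Pi.single i 1 : Fin n → ZMod ℓ) = β := by
    ext j
    rw [Finset.sum_apply, Finset.sum_eq_single j]
    · rw [Pi.smul_apply, Pi.single_eq_same, nsmul_one, ZMod.natCast_zmod_val]
    · intro i _ hij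
      rw [Pi.smul_apply, Pi.single_eq_of_ne hij.symm, smul_zero]
    · simp
  rwa [e] at this

/-- The monomial `x ^ γ K(α)` takes the indicator of the origin to a function supported at `(γ, α)`,
so different monomials are told apart by their values there. -/
theorem linearIndependent_pbw : LinearIndependent k (pbw n q ℓ) := by
  classical
  let F : ModelSpace k n ℓ := fun γ α => if γ = 0 ∧ α = 0 then 1 else 0
  have hF : IsPeak 0 0 F := ⟨by simp [F], fun γ α h => by
    simp only [F]
    rw [if_neg]
    rintro ⟨rfl, rfl⟩
    exact h rfl⟩
  have hp : ∀ p : (Fin n → Fin ℓ) × (Fin n → ZMod ℓ),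
      IsPeak (fun i => ((p.1 i : ℕ) : ℤ)) p.2 (model n q ℓ (pbw n q ℓ p) F) := by
    intro p
    have := (hF.KMod (q := q) p.2).xProd (q := q) (List.finRange n) (List.nodup_finRange n)
      (fun i _ => rfl) (fun i => p.1 i) (fun i => (p.1 i).2)
    rw [pbw, map_mul, Module.End.mul_apply, xMonomial_eq_xProd]
    simpa using this
  rw [Fintype.linearIndependent_iff]
  intro g hg p
  have h0 := congrArg (fun a => model n q ℓ a F (fun i => ((p.1 i : ℕ) : ℤ)) p.2) hg
  simp only [map_sum, map_smul, map_zero, LinearMap.zero_apply, Pi.zero_apply,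
    LinearMap.sum_apply, Finset.sum_apply, LinearMap.smul_apply, Pi.smul_apply] at h0
  rw [Finset.sum_eq_single p] at h0
  · exact (smul_eq_zero.1 h0).resolve_right (hp p).1
  · intro p' _ hne
    rw [(hp p').2, smul_zero]
    intro heq
    rw [Prod.mk.injEq] at heq
    refine hne (Prod.ext ?_ heq.2.symm)
    ext i
    have := congrFun heq.1 i
    exact_mod_cast this.symm
  · simp

variable (n q ℓ) in
/-- The basis of ordered monomials of the Taft algebra. -/
noncomputable def pbwBasis :
    Module.Basis ((Fin n → Fin ℓ) × (Fin n → ZMod ℓ)) k (TaftAlgebra n q ℓ) :=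
  Module.Basis.mk linearIndependent_pbw span_pbw.ge

theorem pbwBasis_apply (p : (Fin n → Fin ℓ) × (Fin n → ZMod ℓ)) :
    pbwBasis n q ℓ p = xMonomial q ℓ (fun i => p.1 i) * KMod q ℓ p.2 := by
  rw [pbwBasis, Module.Basis.mk_apply, pbw]

end Monomials

end TaftAlgebra
end Taft

/-! ### Characters and group-like elements of the Taft algebra -/

section Taft

open TensorProduct Coalgebra HopfAlgebra

namespace TaftAlgebra

variable {k : Type*} [Field k] {n : ℕ} {q : k} {ℓ : ℕ}

section Characters

variable [hqℓ : Fact (IsPrimitiveRoot q ℓ)] [hℓ : NeZero ℓ] (χ : TaftAlgebra n q ℓ →ₐ[k] k)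

theorem char_x (i : Fin n) : χ (gen q ℓ (.x i)) = 0 := by
  have := congrArg χ (gen_relations.x_pow (q := q) (ℓ := ℓ) i)
  rw [map_pow, map_zero] at this
  exact pow_eq_zero_iff hℓ.out |>.1 this

theorem char_K_pow (i : Fin n) : χ (gen q ℓ (.K i)) ^ ℓ = 1 := by
  rw [← map_pow, gen_relations.K_pow, map_one]

theorem char_K_mul_Kinv (i : Fin n) : χ (gen q ℓ (.K i)) * χ (gen q ℓ (.Kinv i)) = 1 := by
  rw [← map_mul, gen_relations.K_mul_Kinv, map_one]

theorem char_K_ne_zero (i : Fin n) : χ (gen q ℓ (.K i)) ≠ 0 :=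
  left_ne_zero_of_mul_eq_one (char_K_mul_Kinv χ i)

theorem char_ext {χ χ' : TaftAlgebra n q ℓ →ₐ[k] k}
    (h : ∀ i, χ (gen q ℓ (.K i)) = χ' (gen q ℓ (.K i))) : χ = χ' := by
  refine hom_ext fun g => ?_
  cases g with
  | K i => exact h i
  | x i => rw [char_x, char_x]
  | Kinv i => rw [eq_inv_of_mul_eq_one_right (char_K_mul_Kinv χ i),
      eq_inv_of_mul_eq_one_right (char_K_mul_Kinv χ' i), h]

theorem char_K (α : Fin n → ℤ) :
    χ (K q ℓ α : TaftAlgebra n q ℓ) = ∏ i, χ (gen q ℓ (.K i)) ^ α i := by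
  have hu : ∀ i, Units.map χ.toMonoidHom (KUnit q ℓ i) =
      Units.mk0 _ (char_K_ne_zero χ i) := fun i => Units.ext rfl
  have h1 : Units.map χ.toMonoidHom (K q ℓ α) =
      ∏ i, Units.mk0 _ (char_K_ne_zero χ i) ^ α i := by
    rw [K, map_list_prod, List.map_ofFn, List.prod_ofFn]
    refine Finset.prod_congr rfl fun i _ => ?_
    rw [Function.comp_apply, map_zpow, hu]
  simpa using congrArg Units.val h1

/-- The values on the generators of the character with `K(ε_i) ↦ c_i`. -/
def charGen (c : Fin n → k) : TaftGen n → k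
  | .K i => c i
  | .Kinv i => (c i)⁻¹
  | .x _ => 0

theorem charGen_relations (c : Fin n → k) (hc : ∀ i, c i ^ ℓ = 1) :
    TaftRelations q ℓ (charGen c) :=
  have hc0 : ∀ i, c i ≠ 0 := fun i h => by simpa [h, hℓ.out] using hc i
  { K_comm := fun i j => mul_comm _ _
    K_mul_Kinv := fun i => mul_inv_cancel₀ (hc0 i)
    Kinv_mul_K := fun i => inv_mul_cancel₀ (hc0 i)
    K_pow := hc
    conj_x := fun i j => by simp [charGen]
    x_comm := fun i j => by simp [charGen]
    x_pow := fun i => by simp [charGen, hℓ.out] }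

/-- There is a character with value `q` on `K(ε_i)` and value `1` on the others. -/
theorem exists_char_single (i : Fin n) : ∃ χ : TaftAlgebra n q ℓ →ₐ[k] k,
    ∀ α : Fin n → ℤ, χ (K q ℓ α : TaftAlgebra n q ℓ) = q ^ α i := by
  refine ⟨lift (charGen (Function.update 1 i q)) (charGen_relations _ fun j => ?_), fun α => ?_⟩
  · by_cases h : j = i
    · subst h; simp [hqℓ.out.pow_eq_one]
    · simp [h]
  · rw [char_K, Finset.prod_eq_single i]
    · rw [lift_gen, charGen, Function.update_self]
    · intro j _ hj
      rw [lift_gen, charGen, Function.update_of_ne hj, Pi.one_apply, one_zpow]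
    · simp

theorem zpow_eq_zpow_of_dvd {a b : ℤ} (h : (ℓ : ℤ) ∣ a - b) : q ^ a = q ^ b := by
  have := (hqℓ.out.zpow_eq_one_iff_dvd (a - b)).2 h
  rw [zpow_sub₀ (q_ne_zero q ℓ)] at this
  exact eq_of_div_eq_one this

theorem dvd_of_zpow_eq_zpow {a b : ℤ} (h : q ^ a = q ^ b) : (ℓ : ℤ) ∣ a - b := by
  rw [← hqℓ.out.zpow_eq_one_iff_dvd, zpow_sub₀ (q_ne_zero q ℓ), h,
    div_self (zpow_ne_zero _ (q_ne_zero q ℓ))]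

/-- Characters separate the classes `K(α)`. -/
theorem dvd_sub_of_char_eq {α β : Fin n → ℤ} (h : ∀ χ : TaftAlgebra n q ℓ →ₐ[k] k,
    χ (K q ℓ α : TaftAlgebra n q ℓ) = χ (K q ℓ β : TaftAlgebra n q ℓ)) (i : Fin n) :
    (ℓ : ℤ) ∣ α i - β i := by
  obtain ⟨χ, hχ⟩ := exists_char_single (q := q) (ℓ := ℓ) i
  have := h χ
  rw [hχ, hχ] at this
  exact dvd_of_zpow_eq_zpow this

theorem K_congr_of_dvd {α β : Fin n → ℤ} (h : ∀ i, (ℓ : ℤ) ∣ α i - β i) :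
    K q ℓ α = K q ℓ β :=
  K_congr fun i => by
    rw [← sub_eq_zero, ← Int.cast_sub]
    exact (ZMod.intCast_zmod_eq_zero_iff_dvd _ _).2 (h i)

theorem comul_K (α : Fin n → ℤ) : comul (R := k) (K q ℓ α : TaftAlgebra n q ℓ) =
    (K q ℓ α : TaftAlgebra n q ℓ) ⊗ₜ[k] (K q ℓ α : TaftAlgebra n q ℓ) ∧
      counit (R := k) (K q ℓ α : TaftAlgebra n q ℓ) = 1 := by
  let S : Subgroup (TaftAlgebra n q ℓ)ˣ :=
    { carrier := {u | IsGroupLikeElem k (u : TaftAlgebra n q ℓ)}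
      one_mem' := IsGroupLikeElem.one
      mul_mem' := fun ha hb => IsGroupLikeElem.mul ha hb
      inv_mem' := fun ha => isGroupLikeElem_unitsInv.2 ha }
  have h : K q ℓ α ∈ S := by
    rw [K_eq_prod]
    refine list_prod_mem fun u hu => ?_
    obtain ⟨i, -, rfl⟩ := List.mem_map.1 hu
    refine zpow_mem (?_ : IsGroupLikeElem k (gen q ℓ (.K i))) _
    exact ⟨counit_gen _, comul_gen _⟩
  exact ⟨h.2, h.1⟩

end Characters

section Translations

variable [hqℓ : Fact (IsPrimitiveRoot q ℓ)] [hℓ : NeZero ℓ] (χ : TaftAlgebra n q ℓ →ₐ[k] k)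

theorem rightTrans_x (i : Fin n) : rightTrans χ (gen q ℓ (.x i)) = gen q ℓ (.x i) := by
  simp [rightTrans_eq, comul_gen, comulGen, char_x]

theorem leftTrans_x (i : Fin n) :
    leftTrans χ (gen q ℓ (.x i)) = χ (gen q ℓ (.K i)) • gen q ℓ (.x i) := by
  simp [leftTrans_eq, comul_gen, comulGen, char_x]

theorem rightTrans_K (α : Fin n → ℤ) : rightTrans χ (K q ℓ α : TaftAlgebra n q ℓ) =
    χ (K q ℓ α : TaftAlgebra n q ℓ) • (K q ℓ α : TaftAlgebra n q ℓ) :=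
  rightTrans_of_comul_eq χ (comul_K α).1

theorem leftTrans_K (α : Fin n → ℤ) : leftTrans χ (K q ℓ α : TaftAlgebra n q ℓ) =
    χ (K q ℓ α : TaftAlgebra n q ℓ) • (K q ℓ α : TaftAlgebra n q ℓ) :=
  leftTrans_of_comul_eq χ (comul_K α).1

theorem rightTrans_xMonomial (γ : Fin n → ℕ) :
    rightTrans χ (xMonomial q ℓ γ) = xMonomial q ℓ γ := by
  rw [xMonomial, map_list_prod, List.map_ofFn]
  congr 2
  funext i
  rw [Function.comp_apply, map_pow, rightTrans_x]

/-- The version of `map_xMonomial` for a product over a list. -/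
theorem map_xProd (f : TaftAlgebra n q ℓ →ₐ[k] TaftAlgebra n q ℓ) (c : Fin n → k)
    (hf : ∀ i, f (gen q ℓ (.x i)) = c i • gen q ℓ (.x i)) (L : List (Fin n)) (γ : Fin n → ℕ) :
    f (xProd q ℓ L γ) = (L.map fun i => c i ^ γ i).prod • xProd q ℓ L γ := by
  induction L with
  | nil => simp [xProd_nil]
  | cons i L ih =>
    rw [xProd_cons, map_mul, map_pow, hf, ih, List.map_cons, List.prod_cons, smul_pow,
      smul_mul_smul_comm]

/-- An algebra map which scales every `x_i` by `c_i` scales `x ^ γ` by `c ^ γ`. -/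
theorem map_xMonomial (f : TaftAlgebra n q ℓ →ₐ[k] TaftAlgebra n q ℓ) (c : Fin n → k)
    (hf : ∀ i, f (gen q ℓ (.x i)) = c i • gen q ℓ (.x i)) (γ : Fin n → ℕ) :
    f (xMonomial q ℓ γ) = (∏ i, c i ^ γ i) • xMonomial q ℓ γ := by
  rw [xMonomial_eq_xProd, map_xProd f c hf, ← List.ofFn_eq_map, List.prod_ofFn]

theorem rightTrans_pbwBasis (p : (Fin n → Fin ℓ) × (Fin n → ZMod ℓ)) :
    rightTrans χ (pbwBasis n q ℓ p) = χ (KMod q ℓ p.2) • pbwBasis n q ℓ p := by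
  rw [pbwBasis_apply, map_mul, rightTrans_xMonomial, KMod, rightTrans_K, mul_smul_comm]

theorem leftTrans_pbwBasis (p : (Fin n → Fin ℓ) × (Fin n → ZMod ℓ)) :
    leftTrans χ (pbwBasis n q ℓ p) =
      ((∏ i, χ (gen q ℓ (.K i)) ^ (p.1 i : ℕ)) * χ (KMod q ℓ p.2)) • pbwBasis n q ℓ p := by
  rw [pbwBasis_apply, map_mul, map_xMonomial _ _ (leftTrans_x χ), KMod, leftTrans_K,
    smul_mul_smul_comm]

theorem repr_eq_mul_of_apply_eq_smul {ι V : Type*} [AddCommGroup V] [Module k V]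
    (b : Module.Basis ι k V) (f : V →ₗ[k] V) (c : ι → k) (h : ∀ i, f (b i) = c i • b i) (v : V)
    (i : ι) : b.repr (f v) i = c i * b.repr v i := by
  have : b.coord i ∘ₗ f = c i • b.coord i := b.ext fun j => by
    simp only [LinearMap.comp_apply, h, map_smul, LinearMap.smul_apply, Module.Basis.coord_apply,
      Module.Basis.repr_self, smul_eq_mul]
    by_cases hij : j = i
    · rw [hij]
    · rw [Finsupp.single_eq_of_ne (Ne.symm hij), mul_zero, mul_zero]
  exact LinearMap.congr_fun this v

/-- The group-like elements of the Taft algebra are the `K(α)`: the translations by a character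
act on the ordered monomials by scalars, so only one monomial can occur. -/
theorem exists_eq_K {g : TaftAlgebra n q ℓ} (hg : comul (R := k) g = g ⊗ₜ[k] g)
    (hε : counit (R := k) g = 1) : ∃ α : Fin n → ℤ, g = K q ℓ α := by
  set b := pbwBasis n q ℓ with hb
  have hg0 : g ≠ 0 := by
    rintro rfl
    simp at hε
  obtain ⟨p, hp⟩ : ∃ p, b.repr g p ≠ 0 := by
    by_contra! h
    exact hg0 (b.repr.map_eq_zero_iff.1 (Finsupp.ext h))
  have h1 : ∀ (χ : TaftAlgebra n q ℓ →ₐ[k] k) (p), b.repr g p ≠ 0 → χ (KMod q ℓ p.2) = χ g := by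
    intro χ p hp
    have := repr_eq_mul_of_apply_eq_smul b (rightTrans χ).toLinearMap _ (rightTrans_pbwBasis χ) g p
    rw [AlgHom.toLinearMap_apply, rightTrans_of_comul_eq χ hg, map_smul, Finsupp.smul_apply,
      smul_eq_mul] at this
    exact (mul_right_cancel₀ hp this).symm
  have h2 : ∀ (χ : TaftAlgebra n q ℓ →ₐ[k] k) (p), b.repr g p ≠ 0 →
      (∏ i, χ (gen q ℓ (.K i)) ^ (p.1 i : ℕ)) = 1 := by
    intro χ p hp
    have := repr_eq_mul_of_apply_eq_smul b (leftTrans χ).toLinearMap _ (leftTrans_pbwBasis χ) g p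
    rw [AlgHom.toLinearMap_apply, leftTrans_of_comul_eq χ hg, map_smul, Finsupp.smul_apply,
      smul_eq_mul] at this
    have h3 := mul_right_cancel₀ hp this
    rw [h1 χ p hp, eq_comm] at h3
    refine (mul_eq_right₀ ?_).1 h3
    exact ((isUnit_of_comul_eq hg hε).map χ).ne_zero
  have hγ : ∀ p, b.repr g p ≠ 0 → ∀ i, (p.1 i : ℕ) = 0 := by
    intro p hp i
    obtain ⟨χ, hχ⟩ := exists_char_single (q := q) (ℓ := ℓ) i
    have h3 : χ (K q ℓ (fun i => ((p.1 i : ℕ) : ℤ)) : TaftAlgebra n q ℓ) = 1 := by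
      rw [char_K]
      simpa using h2 χ p hp
    rw [hχ, zpow_natCast] at h3
    exact Nat.eq_zero_of_dvd_of_lt ((hqℓ.out.pow_eq_one_iff_dvd _).1 h3) (p.1 i).2
  have huniq : ∀ p', b.repr g p' ≠ 0 → p' = p := by
    intro p' hp'
    refine Prod.ext (funext fun i => Fin.ext ?_) (funext fun i => ?_)
    · rw [hγ p hp, hγ p' hp']
    · have := dvd_sub_of_char_eq (q := q) (ℓ := ℓ) (α := fun i => (p'.2 i).cast)
        (β := fun i => (p.2 i).cast) (fun χ => (h1 χ p' hp').trans (h1 χ p hp).symm) i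
      rw [← ZMod.intCast_zmod_eq_zero_iff_dvd, Int.cast_sub, sub_eq_zero] at this
      simpa using this
  have hg1 : g = b.repr g p • (K q ℓ (fun i => (p.2 i).cast) : TaftAlgebra n q ℓ) := by
    conv_lhs => rw [← b.sum_repr g]
    rw [Finset.sum_eq_single p]
    · rw [hb, pbwBasis_apply, (funext (hγ p hp) : (fun i => (p.1 i : ℕ)) = 0), xMonomial_zero,
        one_mul]
      rfl
    · intro p' _ hne
      rw [of_not_not fun h => hne (huniq p' h), zero_smul]
    · simp
  have := congrArg (counit (R := k)) hg1
  rw [map_smul, hε, (comul_K _).2, smul_eq_mul, mul_one] at this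
  rw [← this, one_smul] at hg1
  exact ⟨_, hg1⟩

end Translations

end TaftAlgebra
end Taft

/-! ### The value of the characters on `S(u)` -/

section Taft

open TensorProduct Coalgebra HopfAlgebra

namespace TaftAlgebra

variable {k : Type*} [Field k] {n : ℕ} {q : k} {ℓ : ℕ}

section Trace

variable [hqℓ : Fact (IsPrimitiveRoot q ℓ)] [hℓ : NeZero ℓ] (χ : TaftAlgebra n q ℓ →ₐ[k] k)

theorem antipode_gen (g : TaftGen n) :
    antipode k (gen q ℓ g) = (antipodeGen q ℓ g).unop := antipodeLin_gen g

theorem antipode_antipode (a : TaftAlgebra n q ℓ) :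
    antipode k (antipode k a) = scale q⁻¹ a := antipodeLin_antipodeLin a

theorem antipodeInv_antipodeInv (a : TaftAlgebra n q ℓ) :
    antipodeInv k _ (antipodeInv k _ a) = scale q a := by
  have h : a = antipode k (antipode k (scale q a)) := by
    rw [antipode_antipode, scale_scale, inv_mul_cancel₀ (q_ne_zero q ℓ), scale_one]
  conv_lhs => rw [h]
  rw [antipodeInv_antipode, antipodeInv_antipode]

theorem antipodeInv_Kinv (i : Fin n) :
    antipodeInv k _ (gen q ℓ (.Kinv i)) = gen q ℓ (.K i) := by
  have h : gen q ℓ (.Kinv i) = antipode k (gen q ℓ (.K i)) := (antipode_gen (.K i)).symm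
  rw [h, antipodeInv_antipode]

theorem antipodeInv_Kinv_mul_x (i : Fin n) :
    antipodeInv k _ (gen q ℓ (.Kinv i) * gen q ℓ (.x i)) = -gen q ℓ (.x i) := by
  have h : gen q ℓ (.Kinv i) * gen q ℓ (.x i) = antipode k (-gen q ℓ (.x i)) := by
    rw [map_neg, antipode_gen]
    exact (neg_neg _).symm
  rw [h, antipodeInv_antipode]

/-- The action of `x_i`: of the three terms of `(Δ ⊗ id)Δ(s(x_i))` the middle one is killed by `χ`. -/
theorem adChar_x_mul (i : Fin n) (h : TaftAlgebra n q ℓ) :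
    DrinfeldDouble.adChar χ (gen q ℓ (.x i) * h) =
      gen q ℓ (.x i) * DrinfeldDouble.adChar χ h - χ (gen q ℓ (.Kinv i)) •
        (gen q ℓ (.K i) * DrinfeldDouble.adChar χ h * gen q ℓ (.Kinv i) * gen q ℓ (.x i)) := by
  rw [DrinfeldDouble.adChar_mul, antipode_gen]
  generalize DrinfeldDouble.adChar χ h = y
  have h1 : comul3 (k := k) (gen q ℓ (.Kinv i)) =
      gen q ℓ (.Kinv i) ⊗ₜ (gen q ℓ (.Kinv i) ⊗ₜ gen q ℓ (.Kinv i)) := by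
    simp [comul3, comul_gen, comulGen]
  have h2 : comul3 (k := k) (gen q ℓ (.x i)) = gen q ℓ (.x i) ⊗ₜ (1 ⊗ₜ 1) +
      (gen q ℓ (.K i) ⊗ₜ (gen q ℓ (.x i) ⊗ₜ 1) +
        gen q ℓ (.K i) ⊗ₜ (gen q ℓ (.K i) ⊗ₜ gen q ℓ (.x i))) := by
    simp [comul3, comul_gen, comulGen, Algebra.TensorProduct.one_def, TensorProduct.tmul_add]
  have h3 : comul3 (k := k) (antipodeGen q ℓ (.x i)).unop = -(
      (gen q ℓ (.Kinv i) * gen q ℓ (.x i)) ⊗ₜ (gen q ℓ (.Kinv i) ⊗ₜ gen q ℓ (.Kinv i)) +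
      (1 ⊗ₜ ((gen q ℓ (.Kinv i) * gen q ℓ (.x i)) ⊗ₜ gen q ℓ (.Kinv i)) +
        1 ⊗ₜ (1 ⊗ₜ (gen q ℓ (.Kinv i) * gen q ℓ (.x i))))) := by
    rw [antipodeGen, MulOpposite.unop_op, map_neg, DrinfeldDouble.comul3_mul, h1, h2]
    simp only [mul_add, Algebra.TensorProduct.tmul_mul_tmul, mul_one, gen_relations.Kinv_mul_K]
  rw [h3, map_neg, map_add, map_add, DrinfeldDouble.adAux_tmul, DrinfeldDouble.adAux_tmul,
    DrinfeldDouble.adAux_tmul, map_mul, char_x, antipodeInv_Kinv, antipodeInv_Kinv_mul_x, map_one]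
  simp only [mul_zero, zero_smul, zero_add, one_smul, mul_one, neg_mul, mul_assoc]
  abel

/-- If `i ∉ L`, then `K(ε_i)` and `x_i` skew-commute with the monomial by the same scalar. -/
theorem K_mul_xProd_mul {i : Fin n} {L : List (Fin n)} (hi : i ∉ L) (γ : Fin n → ℕ) :
    gen q ℓ (.K i) * xProd q ℓ L γ * gen q ℓ (.Kinv i) * gen q ℓ (.x i) =
      gen q ℓ (.x i) * xProd q ℓ L γ := by
  induction L with
  | nil => rw [xProd_nil, mul_one, mul_one, gen_relations.K_mul_Kinv, one_mul]
  | cons j L ih =>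
    rw [List.mem_cons, not_or] at hi
    rw [xProd_cons, ← mul_assoc, K_mul_x_pow, if_neg hi.1, pow_zero, mul_one, smul_mul_assoc,
      smul_mul_assoc, smul_mul_assoc, ← mul_assoc, x_mul_x_pow, smul_mul_assoc]
    congr 1
    rw [mul_assoc (_ ^ _) (gen q ℓ (.K i)), mul_assoc (_ ^ _), mul_assoc (_ ^ _), ih hi.2,
      mul_assoc]

/-- If `y` has trivial weight with respect to `x_i`, then each further factor `x_i` contributes
`1 - χ(K(ε_i))⁻¹ q ^ t`. -/
theorem adChar_x_pow_mul (i : Fin n) {h y : TaftAlgebra n q ℓ}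
    (hy : DrinfeldDouble.adChar χ h = y)
    (hw : gen q ℓ (.K i) * y * gen q ℓ (.Kinv i) * gen q ℓ (.x i) = gen q ℓ (.x i) * y) (m : ℕ) :
    DrinfeldDouble.adChar χ (gen q ℓ (.x i) ^ m * h) =
      (∏ t ∈ Finset.range m, (1 - χ (gen q ℓ (.Kinv i)) * q ^ t)) •
        (gen q ℓ (.x i) ^ m * y) := by
  induction m with
  | zero => simp [hy]
  | succ m ih =>
    have e : gen q ℓ (.K i) * (gen q ℓ (.x i) ^ m * y) * gen q ℓ (.Kinv i) * gen q ℓ (.x i) =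
        q ^ m • (gen q ℓ (.x i) ^ (m + 1) * y) := by
      rw [← mul_assoc, K_mul_x_pow, skewBichar_self, if_pos rfl, one_mul, pow_one, smul_mul_assoc,
        smul_mul_assoc, smul_mul_assoc, pow_succ (gen q ℓ (.x i)), mul_assoc _ (gen q ℓ (.x i)) y,
        ← hw]
      simp only [mul_assoc]
    rw [pow_succ' (gen q ℓ (.x i)), mul_assoc, adChar_x_mul, ih, mul_smul_comm, mul_smul_comm,
      smul_mul_assoc, smul_mul_assoc, e, ← mul_assoc, ← pow_succ', Finset.prod_range_succ]
    module

/-- If `h` is sent to a scalar, then `x ^ γ h` is sent to a multiple of `x ^ γ`. -/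
theorem adChar_xProd_mul {h : TaftAlgebra n q ℓ} {e : k} (he : DrinfeldDouble.adChar χ h = e • 1)
    {L : List (Fin n)} (hL : L.Nodup) (γ : Fin n → ℕ) :
    DrinfeldDouble.adChar χ (xProd q ℓ L γ * h) =
      (e * (L.map fun i => ∏ t ∈ Finset.range (γ i),
        (1 - χ (gen q ℓ (.Kinv i)) * q ^ t)).prod) • xProd q ℓ L γ := by
  induction L with
  | nil => simpa [xProd_nil] using he
  | cons i L ih =>
    rw [List.nodup_cons] at hL
    rw [xProd_cons, mul_assoc, adChar_x_pow_mul χ i (ih hL.2), mul_smul_comm, smul_smul,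
      List.map_cons, List.prod_cons]
    · congr 1
      ring
    · simp only [mul_smul_comm, smul_mul_assoc, K_mul_xProd_mul hL.1]

theorem adChar_of_comul_eq {g : TaftAlgebra n q ℓ} (hg : comul (R := k) g = g ⊗ₜ[k] g)
    (hε : counit (R := k) g = 1) : DrinfeldDouble.adChar χ g = χ (antipode k g) • 1 := by
  have h1 := mul_antipode_lTensor_comul_apply (R := k) g
  rw [hg, hε, map_one] at h1
  have h2 : comul3 (k := k) (antipode k g) =
      antipode k g ⊗ₜ (antipode k g ⊗ₜ antipode k g) := by
    simp [comul3, comul_antipode, hg]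
  rw [DrinfeldDouble.adChar_apply, h2, DrinfeldDouble.adAux_tmul, antipodeInv_antipode, one_mul]
  congr 1

/-- The `q`-analogue of a geometric sum: `C q ^ m (C; q)_m = (C; q)_m - (C; q)_{m+1}` telescopes, and
`(C; q)_ℓ = 1 - C ^ ℓ = 0`. -/
theorem sum_pow_mul_prod {C : k} (hC : C ^ ℓ = 1) :
    ∑ m : Fin ℓ, q ^ (m : ℕ) * ∏ t ∈ Finset.range m, (1 - C * q ^ t) = C⁻¹ := by
  have hC0 : C ≠ 0 := fun h => by simp [h, hℓ.out] at hC
  have h1 : ∀ M, C * ∑ m ∈ Finset.range M, q ^ m * ∏ t ∈ Finset.range m, (1 - C * q ^ t) =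
      1 - ∏ t ∈ Finset.range M, (1 - C * q ^ t) := by
    intro M
    induction M with
    | zero => simp
    | succ M ih => rw [Finset.sum_range_succ, mul_add, ih, Finset.prod_range_succ]; ring
  have h2 : ∏ t ∈ Finset.range ℓ, (1 - C * q ^ t) = 0 := by
    obtain ⟨t, ht, h⟩ := hqℓ.out.eq_pow_of_pow_eq_one (ξ := C⁻¹) (by rw [inv_pow, hC, inv_one])
    exact Finset.prod_eq_zero (Finset.mem_range.2 ht) (by rw [h, mul_inv_cancel₀ hC0, sub_self])
  rw [Fin.sum_univ_eq_sum_range (fun m => q ^ m * ∏ t ∈ Finset.range m, (1 - C * q ^ t)) ℓ]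
  refine eq_inv_of_mul_eq_one_right ?_
  rw [h1, h2, sub_zero]

/-- In the basis of ordered monomials only the `x ^ γ` contribute to the trace that computes the
value on `S(u)`, and the sum over `γ` factors into one sum for each `i`. -/
theorem evalChar_antipode_drinfeldElement :
    DrinfeldDouble.evalChar χ (antipode k (drinfeldElement k
      (DrinfeldDouble.rMatrix k (TaftAlgebra n q ℓ)))) =
      ∏ i, χ (gen q ℓ (.K i)) := by
  rw [DrinfeldDouble.evalChar_antipode_drinfeldElement χ (pbwBasis n q ℓ)]
  have h1 : ∀ γ : Fin n → Fin ℓ, xMonomial q ℓ (fun i => γ i) = pbwBasis n q ℓ (γ, 0) := by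
    intro γ
    rw [pbwBasis_apply, KMod_zero, mul_one]
  have h2 : ∀ p : (Fin n → Fin ℓ) × (Fin n → ZMod ℓ), (pbwBasis n q ℓ).coord p
      (antipodeInv k _ (antipodeInv k _ (DrinfeldDouble.adChar χ (pbwBasis n q ℓ p)))) =
      if p.2 = 0 then ∏ i, (q ^ (p.1 i : ℕ) * ∏ t ∈ Finset.range (p.1 i),
        (1 - χ (gen q ℓ (.Kinv i)) * q ^ t)) else 0 := by
    intro p
    have hs : ∀ i, scale q (gen (n := n) q ℓ (.x i)) = q • gen q ℓ (.x i) := fun i =>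
      lift_gen _ _ _
    conv_lhs => rw [pbwBasis_apply, xMonomial_eq_xProd, KMod]
    rw [adChar_xProd_mul χ (adChar_of_comul_eq χ (comul_K _).1 (comul_K _).2)
      (List.nodup_finRange n), antipodeInv_antipodeInv, ← xMonomial_eq_xProd, map_smul,
      map_xMonomial _ _ hs, ← List.ofFn_eq_map, List.prod_ofFn, h1, map_smul, map_smul,
      Module.Basis.coord_apply, Module.Basis.repr_self]
    split_ifs with hp
    · have e : (p.1, (0 : Fin n → ZMod ℓ)) = p := Prod.ext rfl hp.symm
      have e2 : (K q ℓ (fun i => (p.2 i).cast) : TaftAlgebra n q ℓ) = 1 := by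
        rw [← KMod_zero, ← hp]
        rfl
      rw [e, Finsupp.single_eq_same, e2, antipode_one, map_one, Finset.prod_mul_distrib]
      simp [mul_comm]
    · rw [Finsupp.single_eq_of_ne, smul_zero, smul_zero]
      exact fun h => hp (by rw [h])
  rw [Finset.sum_congr rfl fun p _ => h2 p, Fintype.sum_prod_type]
  simp only [Finset.sum_ite_eq', Finset.mem_univ, if_true]
  rw [← Fintype.piFinset_univ, ← Finset.prod_univ_sum (fun _ => Finset.univ)
    (fun i (m : Fin ℓ) => q ^ (m : ℕ) * ∏ t ∈ Finset.range m,
      (1 - χ (gen q ℓ (.Kinv i)) * q ^ t))]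
  refine Finset.prod_congr rfl fun i _ => ?_
  rw [sum_pow_mul_prod, inv_eq_of_mul_eq_one_left (char_K_mul_Kinv χ i)]
  rw [eq_inv_of_mul_eq_one_right (char_K_mul_Kinv χ i), inv_pow, char_K_pow, inv_one]

end Trace

end TaftAlgebra
end Taft

/-! ### Square roots of `u⁻¹ S(u)` and ribbon elements -/

section Taft

open TensorProduct Coalgebra HopfAlgebra

namespace TaftAlgebra

variable {k : Type*} [Field k] {n : ℕ} {q : k} {ℓ : ℕ}
variable [hqℓ : Fact (IsPrimitiveRoot q ℓ)] [hℓ : NeZero ℓ]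

/-- The commutation rule of `K(β)` with `x_i`. -/
theorem K_mul_x_eq (β : Fin n → ℤ) (i : Fin n) : (K q ℓ β : TaftAlgebra n q ℓ) * gen q ℓ (.x i) =
    q ^ (starForm β (basisVec i) - starForm (basisVec i) β + β i) •
      (gen q ℓ (.x i) * (K q ℓ β : TaftAlgebra n q ℓ)) := by
  have hq := q_ne_zero q ℓ
  let e : (Fin n → ℤ) → ℤ := fun β => starForm β (basisVec i) - starForm (basisVec i) β + β i
  have he : ∀ α β, e (α + β) = e α + e β := fun α β => by
    simp only [e, starForm_add_left, starForm_add_right, Pi.add_apply]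
    ring
  have hz : e 0 = 0 := by simpa using he 0 0
  have hneg : ∀ α, e (-α) = -e α := fun α => by
    have := he α (-α)
    rw [add_neg_cancel, hz] at this
    omega
  let S : AddSubgroup (Fin n → ℤ) :=
    { carrier := {β | (K q ℓ β : TaftAlgebra n q ℓ) * gen q ℓ (.x i) =
        q ^ e β • (gen q ℓ (.x i) * (K q ℓ β : TaftAlgebra n q ℓ))}
      zero_mem' := by simp [hz, K_zero]
      add_mem' := fun {α β} ha hb => by
        rw [Set.mem_ofPred_eq] at ha hb ⊢
        rw [he, K_add, Units.val_mul, mul_assoc, hb, mul_smul_comm, ← mul_assoc, ha,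
          smul_mul_assoc, smul_smul, ← zpow_add₀ hq, mul_assoc, add_comm]
      neg_mem' := fun {α} ha => by
        rw [Set.mem_ofPred_eq] at ha ⊢
        rw [hneg, K_neg, Units.inv_mul_eq_iff_eq_mul, mul_smul_comm, ← mul_assoc, ha,
          smul_mul_assoc, smul_smul, ← zpow_add₀ hq, mul_assoc, Units.mul_inv, mul_one,
          neg_add_cancel, zpow_zero, one_smul] }
  have hb : ∀ j, (basisVec j : Fin n → ℤ) ∈ S := fun j => by
    change (K q ℓ (basisVec j) : TaftAlgebra n q ℓ) * _ = _
    have : (K q ℓ (basisVec j) : TaftAlgebra n q ℓ) = gen q ℓ (.K j) := by rw [K_basisVec]; rfl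
    have h2 : (basisVec j : Fin n → ℤ) i = ((if j = i then 1 else 0 : ℕ) : ℤ) := by
      simp [basisVec, Pi.single_apply, eq_comm]
    rw [this, K_mul_x, skewBichar]
    simp only [e]
    rw [h2, zpow_add₀ hq, zpow_natCast]
  have : β ∈ S := by
    have h : β = ∑ j, β j • basisVec j := by
      ext l
      rw [Finset.sum_apply, Finset.sum_eq_single l]
      · simp [basisVec]
      · intro j _ hj
        simp [basisVec, hj.symm]
      · simp
    rw [h]
    exact sum_mem fun j _ => zsmul_mem (hb j) _
  exact this

theorem ktildeHom_gen_K (β : Fin n → ℤ) (i : Fin n) :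
    ktildeHom q ℓ β (gen q ℓ (.K i)) =
      q ^ (starForm (basisVec i) β - starForm β (basisVec i) + β i) := by
  rw [ktildeHom, lift_gen, ktildeGen, ktildeVal, skewBichar, ← zpow_add₀ (q_ne_zero q ℓ)]

theorem rightTrans_surjective (χ : TaftAlgebra n q ℓ →ₐ[k] k) :
    Function.Surjective (rightTrans χ) := by
  have hK : ∀ g : TaftAlgebra n q ℓ, comul (R := k) g = g ⊗ₜ[k] g → χ g ≠ 0 →
      g ∈ (rightTrans χ).range := fun g hg h0 =>
    ⟨(χ g)⁻¹ • g, by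
      rw [AlgHom.toRingHom_eq_coe, RingHom.coe_coe, map_smul, rightTrans_of_comul_eq χ hg,
        smul_smul, inv_mul_cancel₀ h0, one_smul]⟩
  intro y
  change y ∈ (rightTrans χ).range
  induction y using induction with
  | h0 r => exact Subalgebra.algebraMap_mem _ r
  | h1 g =>
    cases g with
    | K i => exact hK _ (comul_gen _) (char_K_ne_zero χ i)
    | Kinv i => exact hK _ (comul_gen _) (right_ne_zero_of_mul_eq_one (char_K_mul_Kinv χ i))
    | x i => exact ⟨_, rightTrans_x χ i⟩
  | hm a b ha hb => exact mul_mem ha hb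
  | ha a b ha hb => exact add_mem ha hb

theorem scale_gen_x (c : k) (i : Fin n) :
    scale c (gen q ℓ (.x i)) = c • gen q ℓ (.x i) := lift_gen _ _ _

/-- The group-like `χ ⊗ K(β)` implements `S²` as soon as it does so on the `x_i`. -/
theorem tmul_mul_antipode_antipode {χ : TaftAlgebra n q ℓ →ₐ[k] k} {β : Fin n → ℤ}
    (h : ∀ i, χ (gen q ℓ (.K i)) =
      q⁻¹ * q ^ (starForm β (basisVec i) - starForm (basisVec i) β + β i))
    (X : DrinfeldDouble k (TaftAlgebra n q ℓ)) :
    DrinfeldDouble.tmul (charDual χ) (K q ℓ β).val * antipode k (antipode k X) =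
      X * DrinfeldDouble.tmul (charDual χ) (K q ℓ β).val := by
  refine DrinfeldDouble.tmul_charDual_mul_antipode_antipode χ (comul_K β).1 (comul_K β).2
    (rightTrans_surjective χ) (fun x => ?_) X
  rw [antipode_antipode]
  have hK : ∀ i, Commute (gen q ℓ (.K i)) (K q ℓ β : TaftAlgebra n q ℓ) := fun i => by
    have e : (K q ℓ (basisVec i) : TaftAlgebra n q ℓ) = gen q ℓ (.K i) := by rw [K_basisVec]; rfl
    rw [← e, Commute, SemiconjBy, ← Units.val_mul, ← Units.val_mul, ← K_add, ← K_add, add_comm]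
  have hKinv : ∀ i, Commute (gen q ℓ (.Kinv i)) (K q ℓ β : TaftAlgebra n q ℓ) := fun i =>
    Commute.units_inv_left (u := KUnit q ℓ i) (hK i)
  induction x using induction with
  | h0 r =>
    rw [AlgHom.commutes, AlgHom.commutes, AlgHom.commutes]
    exact Algebra.commutes r _
  | h1 g =>
    cases g with
    | K i =>
      have hs : scale q⁻¹ (gen (n := n) q ℓ (.K i)) = gen q ℓ (.K i) := lift_gen _ _ _
      rw [rightTrans_of_comul_eq χ (comul_gen (.K i)), leftTrans_of_comul_eq χ (comul_gen (.K i)),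
        map_smul, hs, smul_mul_assoc, mul_smul_comm, (hK i).eq]
    | Kinv i =>
      have hs : scale q⁻¹ (gen (n := n) q ℓ (.Kinv i)) = gen q ℓ (.Kinv i) := lift_gen _ _ _
      rw [rightTrans_of_comul_eq χ (comul_gen (.Kinv i)),
        leftTrans_of_comul_eq χ (comul_gen (.Kinv i)),
        map_smul, hs, smul_mul_assoc, mul_smul_comm, (hKinv i).eq]
    | x i =>
      rw [rightTrans_x, leftTrans_x, scale_gen_x, mul_smul_comm, K_mul_x_eq, smul_mul_assoc,
        smul_smul, h]
  | hm a b ha hb =>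
    rw [map_mul, map_mul, map_mul, mul_assoc, hb, ← mul_assoc, ha, mul_assoc]
  | ha a b ha hb => rw [map_add, map_add, map_add, add_mul, mul_add, ha, hb]

theorem x_ne_zero (hℓ1 : 1 < ℓ) (i : Fin n) : gen q ℓ (.x i) ≠ 0 := by
  have h : gen q ℓ (.x i) = pbwBasis n q ℓ
      (Pi.single (M := fun _ : Fin n => Fin ℓ) i ⟨1, hℓ1⟩, 0) := by
    rw [pbwBasis_apply, KMod_zero, mul_one, xMonomial_eq_xProd, xProd,
      List.prod_map_eq_pow_single i]
    · simp
    · intro j hj _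
      simp [hj]
  rw [h]
  exact Module.Basis.ne_zero _ _

/-- If `χ ⊗ K(β)` implements `S⁴`, then comparing both sides at `x_i`, where `S⁴` is multiplication by
`q⁻²`, determines `χ(K(ε_i))`. -/
theorem char_K_of_mul_antipode_pow_four {χ : TaftAlgebra n q ℓ →ₐ[k] k} {β : Fin n → ℤ}
    (h : ∀ X : DrinfeldDouble k (TaftAlgebra n q ℓ),
      DrinfeldDouble.tmul (charDual χ) (K q ℓ β).val *
        antipode k (antipode k (antipode k (antipode k X))) =
      X * DrinfeldDouble.tmul (charDual χ) (K q ℓ β).val) (i : Fin n) :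
    χ (gen q ℓ (.K i)) =
      (q⁻¹ * q⁻¹) * q ^ (starForm β (basisVec i) - starForm (basisVec i) β + β i) := by
  rcases Nat.lt_or_ge 1 ℓ with hℓ1 | hℓ1
  · have hx := h (DrinfeldDouble.inH k _ (gen q ℓ (.x i)))
    have hr := DrinfeldDouble.inH_rightTrans_mul χ (gen q ℓ (.x i))
    rw [rightTrans_x, leftTrans_x] at hr
    simp only [DrinfeldDouble.antipode_inH, antipode_antipode] at hx
    rw [scale_scale, scale_gen_x, ← DrinfeldDouble.inDual_mul_inH, ← mul_assoc, hr, mul_assoc,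
      mul_assoc, ← DrinfeldDouble.inH_mul, ← DrinfeldDouble.inH_mul,
      DrinfeldDouble.inDual_mul_inH, DrinfeldDouble.inDual_mul_inH] at hx
    have hχ1 : charDual χ 1 = 1 := map_one χ
    have hx' := DrinfeldDouble.right_eq_of_tmul_eq_tmul hχ1 hχ1 hx
    rw [mul_smul_comm, K_mul_x_eq, smul_mul_assoc, smul_smul] at hx'
    refine (smul_left_injective k ?_ hx').symm
    intro h0
    exact x_ne_zero (q := q) hℓ1 i ((Units.mul_left_eq_zero _).1 h0)
  -- for `ℓ = 1` the generators `x_i` vanish, but every `ℓ`-th root of unity is `1`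
  · have hℓ' : ℓ = 1 := le_antisymm hℓ1 (Nat.pos_of_ne_zero hℓ.out)
    have h : ∀ c : k, c ^ ℓ = 1 → c = 1 := fun c hc => by rwa [hℓ', pow_one] at hc
    rw [h _ (char_K_pow χ i), ← zpow_neg_one, ← zpow_add₀ (q_ne_zero q ℓ),
      ← zpow_add₀ (q_ne_zero q ℓ)]
    exact (h _ (zpow_pow_order _)).symm

/-- The group-like element `u⁻¹ S(u)` has the form `χ ⊗ K(1, …, 1)`: its second factor is found by
evaluating characters on `S(u)`, its first factor because it implements `S⁴`. -/
theorem exists_antipode_drinfeldElement_eq : ∃ χ : TaftAlgebra n q ℓ →ₐ[k] k,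
    (∀ i, χ (gen q ℓ (.K i)) = (q⁻¹ * q⁻¹) * q ^ (starForm (fun _ => 1) (basisVec i) -
      starForm (basisVec i) (fun _ => 1) + 1)) ∧
    antipode k (drinfeldElement k (DrinfeldDouble.rMatrix k (TaftAlgebra n q ℓ))) =
      drinfeldElement k (DrinfeldDouble.rMatrix k (TaftAlgebra n q ℓ)) *
        DrinfeldDouble.tmul (charDual χ) (K q ℓ fun _ => 1).val := by
  obtain ⟨z, hz, hz1, hz2, hz4⟩ := (DrinfeldDouble.isUniversalRMatrix_rMatrix k
    (TaftAlgebra n q ℓ)).exists_antipode_drinfeldElement_eq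
  obtain ⟨χ, g, hg, hε, rfl⟩ := DrinfeldDouble.exists_eq_tmul_charDual hz1 hz2
  obtain ⟨β, rfl⟩ := exists_eq_K hg hε
  have hβ : K q ℓ β = K q ℓ fun _ => 1 := K_congr_of_dvd <| dvd_sub_of_char_eq (q := q) fun ψ => by
    have := evalChar_antipode_drinfeldElement ψ
    rw [hz, DrinfeldDouble.evalChar_drinfeldElement_mul, DrinfeldDouble.evalChar_tmul,
      charDual_apply, map_one, one_mul] at this
    rw [this, char_K]
    simp
  rw [hβ] at hz hz4
  exact ⟨χ, char_K_of_mul_antipode_pow_four hz4, hz⟩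

/-- The convolution square of a character is a character. -/
theorem charDual_mul_charDual (χ : TaftAlgebra n q ℓ →ₐ[k] k) :
    charDual χ * charDual χ = charDual (χ.comp (rightTrans χ)) :=
  DualCop.ext fun x => mul_charDual_apply _ χ x

theorem comp_rightTrans_K (χ : TaftAlgebra n q ℓ →ₐ[k] k) (i : Fin n) :
    χ.comp (rightTrans χ) (gen q ℓ (.K i)) = χ (gen q ℓ (.K i)) ^ 2 := by
  rw [AlgHom.comp_apply, rightTrans_of_comul_eq χ (comul_gen (.K i)), map_smul, smul_eq_mul, sq]

theorem charDual_mul_charDual_one (χ : TaftAlgebra n q ℓ →ₐ[k] k) :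
    (charDual χ * charDual χ) 1 = 1 := by
  rw [charDual_mul_charDual, charDual_apply, map_one]

theorem tmul_mul_self (χ : TaftAlgebra n q ℓ →ₐ[k] k) (β : Fin n → ℤ) :
    DrinfeldDouble.tmul (charDual χ) (K q ℓ β).val *
      DrinfeldDouble.tmul (charDual χ) (K q ℓ β).val =
      DrinfeldDouble.tmul (charDual χ * charDual χ) (K q ℓ (β + β)).val := by
  rw [DrinfeldDouble.tmul_charDual_mul_tmul χ χ (comul_K β).1 (comul_K β).2, K_add, Units.val_mul]

theorem dvd_sub_of_K_eq {α β : Fin n → ℤ}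
    (h : (K q ℓ α : TaftAlgebra n q ℓ) = K q ℓ β) (i : Fin n) : (ℓ : ℤ) ∣ α i - β i :=
  dvd_sub_of_char_eq (fun χ => by rw [h]) i

/-- A square root of `χ ⊗ K(1, …, 1)` among the group-likes exists only if `ℓ` is odd. -/
theorem odd_of_tmul_mul_self_eq (hn : 0 < n) {χ χ' : TaftAlgebra n q ℓ →ₐ[k] k} {β : Fin n → ℤ}
    (h : DrinfeldDouble.tmul (charDual χ') (K q ℓ β).val *
      DrinfeldDouble.tmul (charDual χ') (K q ℓ β).val =
      DrinfeldDouble.tmul (charDual χ) (K q ℓ fun _ => 1).val) : Odd ℓ := by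
  rw [tmul_mul_self] at h
  have h1 := dvd_sub_of_K_eq (DrinfeldDouble.right_eq_of_tmul_eq_tmul (charDual_mul_charDual_one χ')
    (map_one χ : charDual χ 1 = 1) h) ⟨0, hn⟩
  rw [← Nat.not_even_iff_odd]
  intro he
  have h2 : (2 : ℤ) ∣ ℓ := by exact_mod_cast he.two_dvd
  have h3 := h2.trans h1
  rw [Pi.add_apply] at h3
  omega

/-- For odd `ℓ` a group-like element of the double is determined by its square. -/
theorem tmul_eq_of_mul_self_eq (hodd : Odd ℓ) {χ χ' : TaftAlgebra n q ℓ →ₐ[k] k}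
    {β β' : Fin n → ℤ} (h : DrinfeldDouble.tmul (charDual χ) (K q ℓ β).val *
      DrinfeldDouble.tmul (charDual χ) (K q ℓ β).val =
      DrinfeldDouble.tmul (charDual χ') (K q ℓ β').val *
        DrinfeldDouble.tmul (charDual χ') (K q ℓ β').val) :
    DrinfeldDouble.tmul (charDual χ) (K q ℓ β).val =
      DrinfeldDouble.tmul (charDual χ') (K q ℓ β').val := by
  rw [tmul_mul_self, tmul_mul_self] at h
  have h1 := dvd_sub_of_K_eq (DrinfeldDouble.right_eq_of_tmul_eq_tmul (charDual_mul_charDual_one χ)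
    (charDual_mul_charDual_one χ') h)
  have h2 := DrinfeldDouble.left_eq_of_tmul_eq_tmul (comul_K _).2 (comul_K _).2 h
  have hβ : K q ℓ β = K q ℓ β' := K_congr_of_dvd fun i => by
    have h3 := h1 i
    have hc : IsCoprime (ℓ : ℤ) 2 :=
      Nat.isCoprime_iff_coprime.2 (Nat.coprime_two_right.2 hodd)
    refine hc.dvd_of_dvd_mul_left (?_ : (ℓ : ℤ) ∣ 2 * (β i - β' i))
    rwa [Pi.add_apply, Pi.add_apply, show β i + β i - (β' i + β' i) = 2 * (β i - β' i) by ring]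
      at h3
  have hχ : χ = χ' := char_ext fun i => by
    have h3 : χ (gen q ℓ (.K i)) ^ 2 = χ' (gen q ℓ (.K i)) ^ 2 := by
      rw [charDual_mul_charDual, charDual_mul_charDual] at h2
      rw [← comp_rightTrans_K, ← comp_rightTrans_K, ← charDual_apply, h2, charDual_apply]
    obtain ⟨m, hm⟩ := hodd
    -- an `ℓ`-th root of unity is the `(m+1)`-st power of its square when `ℓ = 2 m + 1`
    have h4 : ∀ χ : TaftAlgebra n q ℓ →ₐ[k] k,
        χ (gen q ℓ (.K i)) = (χ (gen q ℓ (.K i)) ^ 2) ^ (m + 1) := fun χ => by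
      rw [← pow_mul, show 2 * (m + 1) = ℓ + 1 by omega, pow_succ, char_K_pow, one_mul]
    rw [h4 χ, h3, ← h4]
  rw [hβ, hχ]

end TaftAlgebra
end Taft

theorem theorem3p7 {k : Type*} [Field k] [IsAlgClosed k] [CharZero k] (n ℓ : ℕ) (hn : 0 < n)
    [NeZero ℓ] (q : k) [Fact (IsPrimitiveRoot q ℓ)] :
    let R := DrinfeldDouble.rMatrix k (TaftAlgebra n q ℓ)
    let u := drinfeldElement k R
    let a : Fin n → ℤ := fun _ => ((ℓ : ℤ) + 1) / 2
    let b : Fin n → ℤ := fun _ => ((ℓ : ℤ) - 1) / 2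
    ((∃ v, IsRibbonHopfAlgebra k R v) ↔ Odd ℓ) ∧
    (Odd ℓ →
      (∀ v, IsRibbonElement k R v ↔
        v = u * DrinfeldDouble.tmul ((TaftAlgebra.ktilde q ℓ a)⁻¹).val
          ((TaftAlgebra.K q ℓ b)⁻¹).val) ∧
      u * DrinfeldDouble.tmul ((TaftAlgebra.ktilde q ℓ a)⁻¹).val ((TaftAlgebra.K q ℓ b)⁻¹).val =
        u * DrinfeldDouble.tmul (TaftAlgebra.ktilde q ℓ b).val (TaftAlgebra.K q ℓ a).val) := by
  intro R u a b
  have hR : IsUniversalRMatrix k R :=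
    DrinfeldDouble.isUniversalRMatrix_rMatrix k (TaftAlgebra n q ℓ)
  obtain ⟨χ, hχ, hz⟩ := TaftAlgebra.exists_antipode_drinfeldElement_eq (n := n) (q := q) (ℓ := ℓ)
  -- every ribbon element comes from a square root of `u⁻¹ S(u)`
  have hroot : ∀ v, IsRibbonElement k R v → ∃ (χ' : TaftAlgebra n q ℓ →ₐ[k] k) (β : Fin n → ℤ),
      v = u * DrinfeldDouble.tmul (charDual χ') (TaftAlgebra.K q ℓ β).val ∧
      DrinfeldDouble.tmul (charDual χ') (TaftAlgebra.K q ℓ β).val *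
        DrinfeldDouble.tmul (charDual χ') (TaftAlgebra.K q ℓ β).val =
        DrinfeldDouble.tmul (charDual χ) (TaftAlgebra.K q ℓ fun _ => 1).val := by
    intro v hv
    obtain ⟨w, hvw, hw1, hw2, -, hw4⟩ := (hR.isRibbonElement_iff v).1 hv
    obtain ⟨χ', g, hg, hε, rfl⟩ := DrinfeldDouble.exists_eq_tmul_charDual hw1 hw2
    obtain ⟨β, rfl⟩ := TaftAlgebra.exists_eq_K hg hε
    exact ⟨χ', β, hvw, hR.isUnit_drinfeldElement.mul_left_cancel (hw4.symm.trans hz)⟩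
  have hq := TaftAlgebra.q_ne_zero q ℓ
  have hmain : Odd ℓ → (∀ v, IsRibbonElement k R v ↔
        v = u * DrinfeldDouble.tmul ((TaftAlgebra.ktilde q ℓ a)⁻¹).val
          ((TaftAlgebra.K q ℓ b)⁻¹).val) ∧
      u * DrinfeldDouble.tmul ((TaftAlgebra.ktilde q ℓ a)⁻¹).val ((TaftAlgebra.K q ℓ b)⁻¹).val =
        u * DrinfeldDouble.tmul (TaftAlgebra.ktilde q ℓ b).val (TaftAlgebra.K q ℓ a).val := by
    intro hodd
    obtain ⟨m, hm⟩ := hodd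
    have ha : a = fun _ => (m : ℤ) + 1 := funext fun _ => by simp only [a]; omega
    have hb : b = fun _ => (m : ℤ) := funext fun _ => by simp only [b]; omega
    have hna : -a = fun _ => -((m : ℤ) + 1) := by rw [ha]; rfl
    have hnb : -b = fun _ => -(m : ℤ) := by rw [hb]; rfl
    have hℓ : (ℓ : ℤ) = 2 * m + 1 := by exact_mod_cast hm
    have hka : ((TaftAlgebra.ktilde q ℓ a)⁻¹).val = charDual (TaftAlgebra.ktildeHom q ℓ (-a)) :=
      rfl
    have hkb : (TaftAlgebra.ktilde q ℓ b).val = charDual (TaftAlgebra.ktildeHom q ℓ b) := rfl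
    rw [hka, hkb, ← TaftAlgebra.K_neg]
    -- the given element is a square root of `u⁻¹ S(u)`
    have hsq : DrinfeldDouble.tmul (charDual (TaftAlgebra.ktildeHom q ℓ (-a)))
        (TaftAlgebra.K q ℓ (-b)).val *
        DrinfeldDouble.tmul (charDual (TaftAlgebra.ktildeHom q ℓ (-a)))
          (TaftAlgebra.K q ℓ (-b)).val =
        DrinfeldDouble.tmul (charDual χ) (TaftAlgebra.K q ℓ fun _ => 1).val := by
      rw [TaftAlgebra.tmul_mul_self]
      congr 1
      · rw [TaftAlgebra.charDual_mul_charDual]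
        refine congrArg charDual (TaftAlgebra.char_ext fun i => ?_)
        rw [TaftAlgebra.comp_rightTrans_K, TaftAlgebra.ktildeHom_gen_K, hχ, ← zpow_neg_one,
          ← zpow_add₀ hq, ← zpow_add₀ hq, ← zpow_natCast, ← zpow_mul, hna,
          starForm_const_left, starForm_const_right]
        refine TaftAlgebra.zpow_eq_zpow_of_dvd (ℓ := ℓ)
          ⟨starForm (fun _ => 1) (basisVec i) - starForm (basisVec i) (fun _ => 1) - 1, ?_⟩
        rw [hℓ]
        push_cast
        ring
      · rw [hnb]
        refine congrArg Units.val (TaftAlgebra.K_congr_of_dvd fun i => ⟨-1, ?_⟩)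
        rw [hℓ, Pi.add_apply]
        ring
    refine ⟨fun v => ⟨fun hv => ?_, ?_⟩, ?_⟩
    · obtain ⟨χ', β, rfl, hβ⟩ := hroot v hv
      rw [TaftAlgebra.tmul_eq_of_mul_self_eq ⟨m, hm⟩ (hβ.trans hsq.symm)]
    · rintro rfl
      refine (hR.isRibbonElement_iff _).2 ⟨_, rfl, ?_, ?_, ?_, ?_⟩
      · exact DrinfeldDouble.comul_tmul_charDual _ (TaftAlgebra.comul_K _).1
      · exact DrinfeldDouble.counit_tmul_charDual _ (TaftAlgebra.comul_K _).2
      · refine TaftAlgebra.tmul_mul_antipode_antipode fun i => ?_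
        rw [TaftAlgebra.ktildeHom_gen_K, ← zpow_neg_one, ← zpow_add₀ hq, hna, hnb,
          starForm_const_left, starForm_const_right, starForm_const_left _ (-(m : ℤ)),
          starForm_const_right _ (-(m : ℤ))]
        refine TaftAlgebra.zpow_eq_zpow_of_dvd (ℓ := ℓ)
          ⟨starForm (fun _ => 1) (basisVec i) - starForm (basisVec i) (fun _ => 1), ?_⟩
        rw [hℓ]
        ring
      · rw [hsq]
        exact hz
    · congr 2
      · refine congrArg charDual (TaftAlgebra.char_ext fun i => ?_)
        rw [TaftAlgebra.ktildeHom_gen_K, TaftAlgebra.ktildeHom_gen_K, hna, hb,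
          starForm_const_left, starForm_const_right, starForm_const_left _ (m : ℤ),
          starForm_const_right _ (m : ℤ)]
        refine TaftAlgebra.zpow_eq_zpow_of_dvd (ℓ := ℓ)
          ⟨starForm (fun _ => 1) (basisVec i) - starForm (basisVec i) (fun _ => 1) - 1, ?_⟩
        rw [hℓ]
        ring
      · rw [hnb, ha]
        refine congrArg Units.val (TaftAlgebra.K_congr_of_dvd fun i => ⟨-1, ?_⟩)
        rw [hℓ]
        ring
  refine ⟨⟨fun ⟨v, hv⟩ => ?_, fun hodd => ?_⟩, hmain⟩
  · obtain ⟨χ', β, -, hβ⟩ := hroot v hv.ribbon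
    exact TaftAlgebra.odd_of_tmul_mul_self_eq hn hβ
  · exact ⟨_, hR, ((hmain hodd).1 _).2 rfl⟩
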